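/- Let $v_1,v_2,w_1,w_2$ be points of the unit sphere $\mathbb S^2\subset\mathbb R^3$, any three of which are linearly independent, and let $D_4$ be the geodesic drawing of $K_{4,4}$ with parts $\{\pm v_1,\pm v_2\}$ and $\{\pm w_1,\pm w_2\}$, in which every edge is the shortest great-circle arc between its endpoints. Let the vertices be labelled so that the edges $v_1w_2$ and $v_2w_1$ cross (this can always be achieved by replacing some of the four points by their antipodes). Let $\alpha$ be the spherical angle at $w_2$ between the arcs $w_2v_2$ and $w_2v_1$, $\beta$ the angle at $v_2$ between $v_2w_2$ and $v_2w_1$, $\gamma$ the angle at $v_1$ between $v_1w_1$ and $v_1w_2$, and $\delta$ the angle at $w_1$ between $w_1v_1$ and $w_1v_2$. For $n\ge 1$ and $r>0$, a blowup drawing $D_4^{(n)}$ of radius $r$ is a geodesic drawing of $K_{4n,4n}$ obtained by replacing each of the eight vertices of $D_4$ by $n$ evenly spaced points on the circle of (geodesic) radius $r$ on $\mathbb S^2$ around it (each circle with an arbitrary rotation), such that no two of the $8n$ points coincide or are antipodal and no three lie on a common great circle. Its crossing graph $X_n$ has as vertices the $16n^2$ edges of the drawing, two of them being adjacent if they cross;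 its triangle density is the homomorphism density $t(K_3,X_n)=\hom(K_3,X_n)/|V(X_n)|^3$. Put $$F=\frac{3}{2^{12}\pi^2}\Bigl((2\pi-\alpha-\delta)(2\pi-\gamma-\beta)+2(\alpha^2+\beta^2+\gamma^2+\delta^2)-2\pi(\alpha+\beta+\gamma+\delta)\Bigr)+\frac{23}{3\cdot 2^{10}}.$$ Then there are constants $C$ and $r_0>0$, depending only on $D_4$, such that for every $\rho\in[0,r_0)$ there is a number $t=t_\rho(K_3)$ with $|t-F|\le C\rho$ and with the following property: for every sequence $D_4^{(1)},D_4^{(2)},\dots$ of blowup drawings of radii $r(n)>0$ with $r(n)\to\rho$, the triangle densities $t(K_3,X_n)$ of their crossing graphs converge to $t$. In particular, for blowups of fixed radius $r<r_0$ the limiting triangle density exists and equals $F+O(r)$, and it equals $F$ if $r(n)\to 0$. -/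

import Mathlib

namespace SphericalDrawing

noncomputable section

/-- Euclidean three-space; the unit sphere is the set of its vectors of norm one. -/
abbrev E3 : Type := EuclideanSpace ℝ (Fin 3)

/-- Unit vectors are in general position if any three of them (with distinct indices) are linearly
independent. As soon as there are at least three of them, this says that no two coincide or are
antipodal and that no three lie on a common great circle. -/
def GeneralPosition {ι : Type*} (p : ι → E3) : Prop :=
  ∀ i j k : ι, i ≠ j → i ≠ k → j ≠ k → LinearIndependent ℝ ![p i, p j, p k]

/-- The relative interior of the (shortest) geodesic arc between two distinct, non-antipodal points
`x` and `y` of the unit sphere. -/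
def openArc (x y : E3) : Set E3 :=
  {p | ‖p‖ = 1 ∧ ∃ s t : ℝ, 0 < s ∧ 0 < t ∧ p = s • x + t • y}

/-- The spherical angle at the point `b` of the unit sphere between the geodesic arcs from `b` to
`a` and from `b` to `c`: the angle between the tangent directions of these arcs at `b`. -/
def sphericalAngle (a b c : E3) : ℝ :=
  InnerProductGeometry.angle (a - inner ℝ a b • b) (c - inner ℝ c b • b)

/-- The crossing graph of the geodesic drawing of the complete bipartite graph whose two parts are
placed at the points `a i` and at the points `b j`. Its vertices are the edges `(i, j)` of the
bipartite graph; two different edges are adjacent if their arcs cross, that is, have a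
common interior point. -/
def crossingGraph {ι κ : Type*} (a : ι → E3) (b : κ → E3) : SimpleGraph (ι × κ) where
  Adj e f := e ≠ f ∧ (openArc (a e.1) (b e.2) ∩ openArc (a f.1) (b f.2)).Nonempty
  symm := ⟨fun _ _ h => ⟨h.1.symm, by rw [Set.inter_comm]; exact h.2⟩⟩
  loopless := ⟨fun _ h => h.1 rfl⟩

/-- The homomorphism density `t(H, G) = hom(H, G) / |G| ^ |H|`. -/
def homDensity {U V : Type*} (H : SimpleGraph U) (G : SimpleGraph V) : ℝ :=
  (Nat.card (H →g G) : ℝ) / (Nat.card V : ℝ) ^ Nat.card U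

/-- The four points `p 0, -p 0, p 1, -p 1`. -/
def withAntipodes (p : Fin 2 → E3) (x : Fin 2 × Bool) : E3 :=
  if x.2 then p x.1 else -p x.1

/-- The points `v 0, v 1, w 0, w 1` of the unit sphere define a geodesic drawing of `K_{4,4}` with
parts `{± v 0, ± v 1}` and `{± w 0, ± w 1}`. The general position condition says that no two
incident edges overlap. -/
structure IsAntipodalDrawing (v w : Fin 2 → E3) : Prop where
  norm_left : ∀ i, ‖v i‖ = 1
  norm_right : ∀ i, ‖w i‖ = 1
  generalPosition : GeneralPosition (Sum.elim v w)

/-- The points `p 0, …, p (n - 1)` are evenly spaced on the circle on the unit sphere with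
centre `c` and (geodesic) radius `r`. The rotation of the `n` points along the circle is
arbitrary: it is encoded in the choice of the orthonormal frame `c, e, f`. -/
def EvenlySpacedOnCircle (c : E3) (r : ℝ) {n : ℕ} (p : Fin n → E3) : Prop :=
  ∃ e f : E3, Orthonormal ℝ ![c, e, f] ∧ ∀ k : Fin n,
    p k = Real.cos r • c +
      Real.sin r • (Real.cos (2 * Real.pi * (k : ℝ) / (n : ℝ)) • e +
        Real.sin (2 * Real.pi * (k : ℝ) / (n : ℝ)) • f)

/-- All points of the nodes of one part, as a single family. -/
def nodePoints {n : ℕ} (P : Fin 2 × Bool → Fin n → E3) (x : (Fin 2 × Bool) × Fin n) : E3 :=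
  P x.1 x.2

/-- `P` and `Q` are the two parts of a blowup drawing of the antipodal drawing of `K_{4,4}` given
by `v` and `w`: each of the eight vertices is replaced by `n` evenly spaced points on the circle of
radius `r` around it, and all `8 n` points are in general position. -/
structure IsBlowup (v w : Fin 2 → E3) (r : ℝ) (n : ℕ) (P Q : Fin 2 × Bool → Fin n → E3) :
    Prop where
  left : ∀ x, EvenlySpacedOnCircle (withAntipodes v x) r (P x)
  right : ∀ x, EvenlySpacedOnCircle (withAntipodes w x) r (Q x)
  generalPosition : GeneralPosition (Sum.elim (nodePoints P) (nodePoints Q))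

/-- The triangle density `t(K₃, X)` of the crossing graph `X` of the drawing of `K_{4n,4n}` whose
parts are the points of the nodes `P` and of the nodes `Q`. -/
def triangleDensity {n : ℕ} (P Q : Fin 2 × Bool → Fin n → E3) : ℝ :=
  homDensity (⊤ : SimpleGraph (Fin 3)) (crossingGraph (nodePoints P) (nodePoints Q))

end

end SphericalDrawing

open Filter Topology SphericalDrawing

namespace SphericalDrawing

open MeasureTheory Filter Topology

noncomputable section

/-! ### Determinants and the crossing criterion -/

section Signs

open SignType

/-! Two arcs in general position cross exactly when four orientation determinants of their endpoints
have a common nonzero sign (`crossingGraph_adj_iff`). A point near `± v i` is plus or minus a point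
of the circle around `v i`, so whether three edges cross pairwise depends only on the antipodes
chosen and on signs of determinants of points on four circles. If two of the points lie on the same
circle, a positive factor `sin r` splits off, and what remains (`side`) extends to `r = 0`, where it
is the increment of a linear functional along a chord.

The triangle density is therefore an average, over evenly spaced angles, of indicators that are
almost everywhere locally constant, jointly in the angles and the radius. By dominated convergence
(`tendsto_average`) it tends to `limitDensity`, an integral over six independent uniform angles.
Raising the radius from `0` to `ρ` changes each sign with probability `O(ρ)` (`turn_sign_side_ne`),
which yields the error bound.

At radius `0` one family of signs depends only on the angles at the `v`-side and the other only on
those at the `w`-side, so the two are independent. For fixed signs, the antipode choices making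
three edges cross pairwise solve a linear system over the field with two elements, with no solution
or two; the count is an explicit polynomial in the signs (`sum_allCross`). Its expectation needs two
facts. Three independent points are ordered exchangeably by one functional. Two functionals have
increments of equal sign along a random chord from a fixed point with probability `(1 + τ) / 2`,
where `τ = 1 - 2θ/π` and `θ` is the spherical angle; by the inscribed angle theorem this does not
depend on the point (`integral_sgn_increments`).

According to how the three edges are distributed over the lines through `v i` and `w j`, the
expectation is `2/3`, `(5/3 + τ²)/4`, `1` or `(1 + τ)(1 + σ)/8`, with `σ` the correlation at a point
`w j`. Summing over all patterns (`sum_signExpectation`) gives `F`. The assumed crossing enters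
through the signs of the determinants of three centres: these do not depend on the third centre. -/

/-- The determinant of three vectors of Euclidean three-space. -/
def det3 (x y z : E3) : ℝ :=
  x 0 * (y 1 * z 2 - y 2 * z 1) - x 1 * (y 0 * z 2 - y 2 * z 0) + x 2 * (y 0 * z 1 - y 1 * z 0)

lemma det3_add_left (x x' y z : E3) : det3 (x + x') y z = det3 x y z + det3 x' y z := by
  simp [det3]; ring

lemma det3_add_mid (x y y' z : E3) : det3 x (y + y') z = det3 x y z + det3 x y' z := by
  simp [det3]; ring

lemma det3_add_right (x y z z' : E3) : det3 x y (z + z') = det3 x y z + det3 x y z' := by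
  simp [det3]; ring

lemma det3_sub_left (x x' y z : E3) : det3 (x - x') y z = det3 x y z - det3 x' y z := by
  simp [det3]; ring

lemma det3_sub_mid (x y y' z : E3) : det3 x (y - y') z = det3 x y z - det3 x y' z := by
  simp [det3]; ring

lemma det3_sub_right (x y z z' : E3) : det3 x y (z - z') = det3 x y z - det3 x y z' := by
  simp [det3]; ring

lemma det3_smul_left (c : ℝ) (x y z : E3) : det3 (c • x) y z = c * det3 x y z := by
  simp [det3]; ring

lemma det3_smul_mid (c : ℝ) (x y z : E3) : det3 x (c • y) z = c * det3 x y z := by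
  simp [det3]; ring

lemma det3_smul_right (c : ℝ) (x y z : E3) : det3 x y (c • z) = c * det3 x y z := by
  simp [det3]; ring

@[simp] lemma det3_self_left (x y : E3) : det3 x x y = 0 := by
  simp [det3]; ring

@[simp] lemma det3_self_right (x y : E3) : det3 x y y = 0 := by
  simp [det3]; ring

@[simp] lemma det3_self_outer (x y : E3) : det3 x y x = 0 := by
  simp [det3]; ring

lemma det3_swap (x y z : E3) : det3 y x z = -det3 x y z := by
  simp [det3]; ring

lemma det3_swap_right (x y z : E3) : det3 x z y = -det3 x y z := by
  simp [det3]; ring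

lemma det3_cycle (x y z : E3) : det3 y z x = det3 x y z := by
  simp [det3]; ring

lemma continuous_det3 : Continuous fun p : E3 × E3 × E3 => det3 p.1 p.2.1 p.2.2 := by
  unfold det3; fun_prop

lemma det3_ne_zero {x y z : E3} (h : LinearIndependent ℝ ![x, y, z]) : det3 x y z ≠ 0 := by
  have h1 : LinearIndependent ℝ (Matrix.of ![x.ofLp, y.ofLp, z.ofLp]).row := by
    have := h.map' (WithLp.linearEquiv 2 ℝ (Fin 3 → ℝ)).toLinearMap (LinearEquiv.ker _)
    have e : (Matrix.of ![x.ofLp, y.ofLp, z.ofLp]).row =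
        ⇑(WithLp.linearEquiv 2 ℝ (Fin 3 → ℝ)).toLinearMap ∘ ![x, y, z] := by
      ext i j
      fin_cases i <;> rfl
    rw [e]
    exact this
  rw [Matrix.linearIndependent_rows_iff_isUnit, Matrix.isUnit_iff_isUnit_det,
    isUnit_iff_ne_zero, Matrix.det_fin_three] at h1
  intro h0
  apply h1
  simp only [det3] at h0
  simp
  linarith

/-- The linear relation between four vectors of three-space, sorted into two sides. -/
lemma det3_relation (p q p' q' : E3) :
    det3 q q' p' • p + det3 p p' q' • q = det3 q q' p • p' + det3 p p' q • q' := by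
  ext i
  fin_cases i <;> simp [det3] <;> ring

lemma abs_apply_le_norm (x : E3) (i : Fin 3) : |x i| ≤ ‖x‖ := by
  simpa using PiLp.norm_apply_le x i

lemma abs_det3_le (x y z : E3) : |det3 x y z| ≤ 6 * (‖x‖ * ‖y‖ * ‖z‖) := by
  have key : ∀ i j k, |x i * y j * z k| ≤ ‖x‖ * ‖y‖ * ‖z‖ := fun i j k => by
    rw [abs_mul, abs_mul]
    gcongr <;> exact abs_apply_le_norm _ _
  have e : det3 x y z = x 0 * y 1 * z 2 - x 0 * y 2 * z 1 - x 1 * y 0 * z 2 + x 1 * y 2 * z 0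
      + x 2 * y 0 * z 1 - x 2 * y 1 * z 0 := by
    simp only [det3]; ring
  have h1 := abs_le.1 (key 0 1 2)
  have h2 := abs_le.1 (key 0 2 1)
  have h3 := abs_le.1 (key 1 0 2)
  have h4 := abs_le.1 (key 1 2 0)
  have h5 := abs_le.1 (key 2 0 1)
  have h6 := abs_le.1 (key 2 1 0)
  rw [e, abs_le]
  constructor <;> linarith [h1.1, h1.2, h2.1, h2.2, h3.1, h3.2, h4.1, h4.2, h5.1, h5.2, h6.1, h6.2]

/-- Four signs are equal and nonzero. -/
def SameSign (a b c d : SignType) : Prop := a ≠ 0 ∧ a = b ∧ a = c ∧ a = d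

instance (a b c d : SignType) : Decidable (SameSign a b c d) := by
  unfold SameSign; infer_instance

lemma sameSign_sign_iff {a b c d : ℝ} : SameSign (sign a) (sign b) (sign c) (sign d) ↔
    (0 < a ∧ 0 < b ∧ 0 < c ∧ 0 < d) ∨ (a < 0 ∧ b < 0 ∧ c < 0 ∧ d < 0) := by
  constructor
  · rintro ⟨h0, hb, hc, hd⟩
    rcases lt_trichotomy a 0 with h | h | h
    · rw [sign_neg h] at hb hc hd
      exact .inr ⟨h, sign_eq_neg_one_iff.1 hb.symm, sign_eq_neg_one_iff.1 hc.symm,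
        sign_eq_neg_one_iff.1 hd.symm⟩
    · simp [h] at h0
    · rw [sign_pos h] at hb hc hd
      exact .inl ⟨h, sign_eq_one_iff.1 hb.symm, sign_eq_one_iff.1 hc.symm,
        sign_eq_one_iff.1 hd.symm⟩
  · rintro (⟨ha, hb, hc, hd⟩ | ⟨ha, hb, hc, hd⟩)
    · simp [sign_pos ha, sign_pos hb, sign_pos hc, sign_pos hd, SameSign]
    · simp [sign_neg ha, sign_neg hb, sign_neg hc, sign_neg hd, SameSign]

/-- The sign condition for the arcs `p q` and `p' q'` to cross. -/
def CrossSign (p q p' q' : E3) : Prop :=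
  SameSign (sign (det3 p p' q)) (sign (det3 p p' q')) (sign (det3 q q' p)) (sign (det3 q q' p'))

lemma arcs_cross_of_pos {p q p' q' : E3} {s t s' t' : ℝ} (hs : 0 < s) (ht : 0 < t)
    (hs' : 0 < s') (ht' : 0 < t') (h : s • p + t • q = s' • p' + t' • q')
    (h0 : s • p + t • q ≠ 0) : (openArc p q ∩ openArc p' q').Nonempty := by
  set x := s • p + t • q with hx
  have hn : 0 < ‖x‖ := norm_pos_iff.2 h0
  refine ⟨‖x‖⁻¹ • x, ⟨?_, ‖x‖⁻¹ * s, ‖x‖⁻¹ * t, by positivity, by positivity, ?_⟩, ?_,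
    ‖x‖⁻¹ * s', ‖x‖⁻¹ * t', by positivity, by positivity, ?_⟩
  · rw [norm_smul, norm_inv, norm_norm, inv_mul_cancel₀ hn.ne']
  · rw [hx, smul_add, smul_smul, smul_smul]
  · rw [norm_smul, norm_inv, norm_norm, inv_mul_cancel₀ hn.ne']
  · rw [h, smul_add, smul_smul, smul_smul]

/-- `det3_relation` writes one vector as a combination of both pairs of endpoints. Its coefficients
are the four determinants, so after a possible global sign change it lies in both open cones. It is
nonzero because `det3 p p'` maps it to a product of two nonzero determinants. -/
lemma CrossSign.nonempty {p q p' q' : E3} (h : CrossSign p q p' q') :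
    (openArc p q ∩ openArc p' q').Nonempty := by
  rw [CrossSign, sameSign_sign_iff] at h
  have hrel := det3_relation p q p' q'
  have h0 : det3 q q' p' • p + det3 p p' q' • q ≠ 0 := by
    intro h0
    have : det3 p p' (det3 q q' p' • p + det3 p p' q' • q) = 0 := by rw [h0]; simp [det3]
    rw [det3_add_right, det3_smul_right, det3_smul_right, det3_self_outer, mul_zero,
      zero_add] at this
    rcases mul_eq_zero.1 this with h1 | h1 <;> rcases h with h | h <;> linarith [h.1, h.2.1]
  rcases h with ⟨h1, h2, h3, h4⟩ | ⟨h1, h2, h3, h4⟩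
  · exact arcs_cross_of_pos h4 h2 h3 h1 hrel h0
  · refine arcs_cross_of_pos (neg_pos.2 h4) (neg_pos.2 h2) (neg_pos.2 h3) (neg_pos.2 h1) ?_ ?_
    · simp only [neg_smul, ← neg_add]; rw [hrel]
    · simp only [neg_smul, ← neg_add]; exact neg_ne_zero.2 h0

/-- Applying `det3 p p'`, `det3 q q'` and `det3 p q` to the two expressions for a common point gives
three proportions with positive factors. They link all four determinants, so a single nonvanishing
one fixes every sign. -/
lemma crossSign_of_nonempty {p q p' q' : E3} (h1 : det3 p p' q ≠ 0)
    (h : (openArc p q ∩ openArc p' q').Nonempty) : CrossSign p q p' q' := by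
  obtain ⟨x, ⟨-, s, t, hs, ht, hx⟩, -, s', t', hs', ht', hx'⟩ := h
  have e : s • p + t • q = s' • p' + t' • q' := hx.symm.trans hx'
  have e1 : t * det3 p p' q = t' * det3 p p' q' := by
    have := congrArg (det3 p p') e
    simpa [det3_add_right, det3_smul_right] using this
  have e2 : s * det3 q q' p = s' * det3 q q' p' := by
    have := congrArg (det3 q q') e
    simpa [det3_add_right, det3_smul_right] using this
  have e3 : s' * det3 p p' q = t' * det3 q q' p := by
    have := congrArg (det3 p q) e
    simp only [det3_add_right, det3_smul_right, det3_self_outer, det3_self_right, mul_zero,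
      add_zero] at this
    rw [det3_swap_right p p' q, ← det3_cycle p q q'] at this
    linarith
  rw [CrossSign, sameSign_sign_iff]
  rcases lt_or_gt_of_ne h1 with h1 | h1
  · right
    have a2 : det3 p p' q' < 0 := by
      by_contra hc; push Not at hc
      nlinarith [mul_neg_of_pos_of_neg ht h1, mul_nonneg ht'.le hc]
    have a3 : det3 q q' p < 0 := by
      by_contra hc; push Not at hc
      nlinarith [mul_neg_of_pos_of_neg hs' h1, mul_nonneg ht'.le hc]
    have a4 : det3 q q' p' < 0 := by
      by_contra hc; push Not at hc
      nlinarith [mul_neg_of_pos_of_neg hs a3, mul_nonneg hs'.le hc]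
    exact ⟨h1, a2, a3, a4⟩
  · left
    have a2 : 0 < det3 p p' q' := pos_of_mul_pos_right (e1 ▸ mul_pos ht h1) ht'.le
    have a3 : 0 < det3 q q' p := pos_of_mul_pos_right (e3 ▸ mul_pos hs' h1) ht'.le
    have a4 : 0 < det3 q q' p' := pos_of_mul_pos_right (e2 ▸ mul_pos hs a3) hs'.le
    exact ⟨h1, a2, a3, a4⟩

lemma not_crossSign_left (p q q' : E3) : ¬CrossSign p q p q' := by
  simp [CrossSign, SameSign]

/-- A common interior point of two distinct incident edges would make three of their endpoints
dependent. Conversely a crossing sign pattern already produces a common point, so only equality of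
the edges has to be excluded. -/
lemma crossingGraph_adj_iff {ι κ : Type*} {a : ι → E3} {b : κ → E3}
    (h : GeneralPosition (Sum.elim a b)) (e f : ι × κ) :
    (crossingGraph a b).Adj e f ↔ CrossSign (a e.1) (b e.2) (a f.1) (b f.2) := by
  constructor
  · rintro ⟨hne, hc⟩
    by_cases h1 : e.1 = f.1
    · have h2 : e.2 ≠ f.2 := fun h2 => hne (Prod.ext h1 h2)
      exfalso
      obtain ⟨x, ⟨-, s, t, hs, ht, hx⟩, -, s', t', hs', ht', hx'⟩ := hc
      have hd := det3_ne_zero (h (.inl e.1) (.inr e.2) (.inr f.2) (by simp) (by simp) (by simpa))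
      simp only [Sum.elim_inl, Sum.elim_inr] at hd
      have := congrArg (fun z => det3 (a e.1) z (b f.2)) (hx.symm.trans hx')
      simp only [det3_add_mid, det3_smul_mid, ← h1, det3_self_left, det3_self_right, mul_zero,
        zero_add] at this
      rcases mul_eq_zero.1 this with h | h
      · exact ht.ne' h
      · exact hd h
    by_cases h2 : e.2 = f.2
    · exfalso
      obtain ⟨x, ⟨-, s, t, hs, ht, hx⟩, -, s', t', hs', ht', hx'⟩ := hc
      have hd := det3_ne_zero (h (.inl e.1) (.inl f.1) (.inr e.2) (by simpa) (by simp) (by simp))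
      simp only [Sum.elim_inl, Sum.elim_inr] at hd
      have := congrArg (fun z => det3 z (a f.1) (b e.2)) (hx.symm.trans hx')
      simp only [det3_add_left, det3_smul_left, ← h2, det3_self_left, det3_self_outer, mul_zero,
        add_zero] at this
      rcases mul_eq_zero.1 this with h | h
      · exact hs.ne' h
      · exact hd h
    · exact crossSign_of_nonempty
        (det3_ne_zero (h (.inl e.1) (.inl f.1) (.inr e.2) (by simpa) (by simp) (by simp))) hc
  · intro hc
    refine ⟨?_, hc.nonempty⟩
    rintro rfl
    exact not_crossSign_left _ _ _ hc

/-! ### Frames and circles -/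

/-- An orthonormal frame with a distinguished first vector, the centre of a family of circles. -/
structure Frame where
  /-- the centre -/
  c : E3
  /-- the first tangent vector -/
  e : E3
  /-- the second tangent vector -/
  f : E3
  orthonormal : Orthonormal ℝ ![c, e, f]

lemma exists_frame {c : E3} (hc : ‖c‖ = 1) : ∃ F : Frame, F.c = c := by
  have h : Orthonormal ℝ (({0} : Set (Fin 3)).domRestrict ![c, 0, 0]) := by
    constructor
    · rintro ⟨i, hi⟩
      obtain rfl : i = 0 := hi
      exact hc
    · rintro ⟨i, hi⟩ ⟨j, hj⟩ hij
      exact absurd (Subtype.ext ((Set.mem_singleton_iff.1 hi).trans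
        (Set.mem_singleton_iff.1 hj).symm)) hij
  obtain ⟨b, hb⟩ := h.exists_orthonormalBasis_extension_of_card_eq (by simp)
  refine ⟨⟨c, b 1, b 2, ?_⟩, rfl⟩
  have h0 : b 0 = c := by simpa using hb 0 rfl
  have h1 : ![c, b 1, b 2] = b := by
    funext i
    fin_cases i
    · exact h0.symm
    · rfl
    · rfl
  rw [h1]
  exact b.orthonormal

namespace Frame

variable (F : Frame)

/-- The tangent direction at angle `2 * π * s`. -/
def dir (s : ℝ) : E3 :=
  Real.cos (2 * Real.pi * s) • F.e + Real.sin (2 * Real.pi * s) • F.f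

/-- The point at angle `2 * π * s` of the circle of radius `r`. -/
def pt (r s : ℝ) : E3 := Real.cos r • F.c + Real.sin r • F.dir s

lemma norm_c : ‖F.c‖ = 1 := F.orthonormal.1 0

lemma norm_e : ‖F.e‖ = 1 := F.orthonormal.1 1

lemma norm_f : ‖F.f‖ = 1 := F.orthonormal.1 2

lemma inner_ce : inner ℝ F.c F.e = 0 := F.orthonormal.2 (i := 0) (j := 1) (by decide)

lemma inner_cf : inner ℝ F.c F.f = 0 := F.orthonormal.2 (i := 0) (j := 2) (by decide)

lemma inner_ef : inner ℝ F.e F.f = 0 := F.orthonormal.2 (i := 1) (j := 2) (by decide)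

lemma expand (w : E3) :
    w = inner ℝ F.c w • F.c + inner ℝ F.e w • F.e + inner ℝ F.f w • F.f := by
  have hs : ⊤ ≤ Submodule.span ℝ (Set.range ![F.c, F.e, F.f]) := by
    rw [F.orthonormal.linearIndependent.span_eq_top_of_card_eq_finrank' (by simp)]
  have := (OrthonormalBasis.mk F.orthonormal hs).sum_repr' w
  rw [Fin.sum_univ_three] at this
  simpa using this.symm

lemma norm_sq_of_tangent {w : E3} (h : inner ℝ F.c w = 0) :
    inner ℝ w w = inner ℝ F.e w ^ 2 + inner ℝ F.f w ^ 2 := by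
  conv_lhs => rw [F.expand w]
  simp only [h, inner_add_left, inner_add_right, inner_smul_left, inner_smul_right,
    real_inner_self_eq_norm_sq, F.norm_e, F.norm_f, F.inner_ef, real_inner_comm F.e F.f, zero_smul,
    inner_zero_left, inner_zero_right]
  simp
  ring

lemma dir_add_int (s : ℝ) (z : ℤ) : F.dir (s + z) = F.dir s := by
  have h : 2 * Real.pi * (s + z) = 2 * Real.pi * s + z * (2 * Real.pi) := by ring
  rw [dir, h, Real.cos_add_int_mul_two_pi, Real.sin_add_int_mul_two_pi, dir]

lemma pt_zero (s : ℝ) : F.pt 0 s = F.c := by simp [pt]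

lemma pt_eq_add (r s s' : ℝ) : F.pt r s' = F.pt r s + Real.sin r • (F.dir s' - F.dir s) := by
  simp only [pt, smul_sub]; abel

lemma norm_dir (s : ℝ) : ‖F.dir s‖ ≤ 2 := by
  refine (norm_add_le _ _).trans ?_
  rw [norm_smul, norm_smul, F.norm_e, F.norm_f]
  have := Real.abs_cos_le_one (2 * Real.pi * s)
  have := Real.abs_sin_le_one (2 * Real.pi * s)
  simp only [Real.norm_eq_abs]; linarith

lemma norm_pt (r s : ℝ) : ‖F.pt r s‖ ≤ 3 := by
  refine (norm_add_le _ _).trans ?_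
  rw [norm_smul, norm_smul, F.norm_c]
  have := Real.abs_cos_le_one r
  have := Real.abs_sin_le_one r
  have := F.norm_dir s
  simp only [Real.norm_eq_abs]; nlinarith [norm_nonneg (F.dir s), abs_nonneg (Real.sin r)]

lemma norm_pt_sub {r : ℝ} (hr : 0 ≤ r) (s : ℝ) : ‖F.pt r s - F.c‖ ≤ 3 * r := by
  have e : F.pt r s - F.c = (Real.cos r - 1) • F.c + Real.sin r • F.dir s := by
    simp only [pt, sub_smul, one_smul]; abel
  rw [e]
  refine (norm_add_le _ _).trans ?_
  rw [norm_smul, norm_smul, F.norm_c]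
  have h1 : |Real.cos r - 1| ≤ r := by
    have := Real.abs_cos_sub_cos_le r 0
    simpa [abs_of_nonneg hr] using this
  have h2 : |Real.sin r| ≤ r := by
    have := Real.abs_sin_le_abs (x := r)
    rwa [abs_of_nonneg hr] at this
  have := F.norm_dir s
  simp only [Real.norm_eq_abs]; nlinarith [norm_nonneg (F.dir s), abs_nonneg (Real.sin r)]

lemma continuous_dir : Continuous F.dir := by unfold dir; fun_prop

lemma continuous_pt : Continuous fun p : ℝ × ℝ => F.pt p.1 p.2 := by
  unfold pt dir; fun_prop

end Frame

lemma exists_polar (x y : ℝ) : ∃ R φ : ℝ, R = √(x ^ 2 + y ^ 2) ∧ x = R * Real.cos φ ∧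
    y = R * Real.sin φ := by
  refine ⟨_, Complex.arg ⟨x, y⟩, rfl, ?_⟩
  have h : √(x ^ 2 + y ^ 2) = ‖(⟨x, y⟩ : ℂ)‖ := by
    rw [Complex.norm_def, Complex.normSq_mk, sq, sq]
  rw [h, Complex.norm_mul_cos_arg, Complex.norm_mul_sin_arg]
  exact ⟨rfl, rfl⟩

/-- Two orthonormal frames of the same plane differ by a rotation, up to orientation. -/
lemma Frame.exists_rotation (F : Frame) {e f : E3} (h : Orthonormal ℝ ![F.c, e, f]) :
    ∃ u d : ℝ, (d = 1 ∨ d = -1) ∧ ∀ t : ℝ,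
      Real.cos (2 * Real.pi * t) • e + Real.sin (2 * Real.pi * t) • f = F.dir (u + d * t) := by
  have he : inner ℝ F.c e = 0 := h.2 (i := 0) (j := 1) (by decide)
  have hf : inner ℝ F.c f = 0 := h.2 (i := 0) (j := 2) (by decide)
  have hef : inner ℝ e f = 0 := h.2 (i := 1) (j := 2) (by decide)
  have hne : inner ℝ e e = (1 : ℝ) := by
    rw [real_inner_self_eq_norm_sq, show ‖e‖ = 1 from h.1 1]; norm_num
  have hnf : inner ℝ f f = (1 : ℝ) := by
    rw [real_inner_self_eq_norm_sq, show ‖f‖ = 1 from h.1 2]; norm_num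
  have Ee := F.expand e
  have Ef := F.expand f
  rw [F.norm_sq_of_tangent he] at hne
  rw [F.norm_sq_of_tangent hf] at hnf
  have hc : inner ℝ F.e e * inner ℝ F.e f + inner ℝ F.f e * inner ℝ F.f f = (0 : ℝ) := by
    rw [Ef, inner_add_right, inner_add_right, inner_smul_right, inner_smul_right,
      inner_smul_right, hf] at hef
    rw [real_inner_comm e F.e, real_inner_comm e F.f]
    linarith
  rw [he, zero_smul, zero_add] at Ee
  rw [hf, zero_smul, zero_add] at Ef
  generalize inner ℝ F.e e = x at *
  generalize inner ℝ F.f e = y at *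
  generalize inner ℝ F.e f = x' at *
  generalize inner ℝ F.f f = y' at *
  obtain ⟨R, φ, hR, hx, hy⟩ := exists_polar x y
  rw [hne, Real.sqrt_one] at hR
  rw [hR, one_mul] at hx hy
  -- Lagrange's identity for two orthonormal vectors of the plane; this determinant is the
  -- orientation `d`.
  have hd : (x * y' - y * x') ^ 2 = 1 := by
    have : (x * y' - y * x') ^ 2 = (x ^ 2 + y ^ 2) * (x' ^ 2 + y' ^ 2) - (x * x' + y * y') ^ 2 := by
      ring
    rw [this, hne, hnf, hc]; norm_num
  have hx' : x' = -y * (x * y' - y * x') := by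
    linear_combination -x' * hne + x * hc
  have hy' : y' = x * (x * y' - y * x') := by
    linear_combination -y' * hne + y * hc
  refine ⟨φ / (2 * Real.pi), x * y' - y * x', mul_self_eq_one_iff.1 ((sq _).symm.trans hd), fun t => ?_⟩
  have ht : 2 * Real.pi * (φ / (2 * Real.pi) + (x * y' - y * x') * t) =
      φ + (x * y' - y * x') * (2 * Real.pi * t) := by
    field_simp
  rw [Frame.dir, ht, Real.cos_add, Real.sin_add, Ee, Ef, ← hx, ← hy]
  rcases mul_self_eq_one_iff.1 ((sq _).symm.trans hd) with h1 | h1 <;> rw [h1] at hx' hy' ⊢ <;>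
    rw [hx', hy'] <;> simp only [one_mul, neg_one_mul, Real.cos_neg, Real.sin_neg] <;> module

/-- The real number `1` or `-1` encoded by a truth value. -/
def unit (b : Bool) : ℝ := if b then 1 else -1

lemma withAntipodes_eq (p : Fin 2 → E3) (i : Fin 2) (b : Bool) :
    withAntipodes p (i, b) = unit b • p i := by
  cases b <;> simp [withAntipodes, unit]

/-- In the fixed frame the points have angles `u + d * k / n` with `d = ± 1`. Splitting `n * u` into
integer part `m` and fractional part turns this into the permutation `k ↦ m + d * k` modulo `n` and
an offset below one grid step. For the antipodal centre the frame is negated as a whole, which pulls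
the sign out of the point. -/
lemma exists_perm_of_evenlySpaced (F : Frame) (b : Bool) {r : ℝ} {n : ℕ} (hn : 1 ≤ n)
    {p : Fin n → E3} (h : EvenlySpacedOnCircle (unit b • F.c) r p) :
    ∃ (π : Equiv.Perm (Fin n)) (ψ : ℝ), 0 ≤ ψ ∧ ψ ≤ 1 / n ∧
      ∀ k, p (π k) = unit b • F.pt r (k / n + ψ) := by
  obtain ⟨e, f, ho, hp⟩ := h
  have ho' : Orthonormal ℝ ![F.c, unit b • e, unit b • f] := by
    constructor
    · intro i
      have := ho.1 i
      fin_cases i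
      · exact F.norm_c
      all_goals cases b <;> simpa [unit] using this
    · intro i j hij
      have := ho.2 hij
      cases b <;> fin_cases i <;> fin_cases j <;> simp [unit] at this hij ⊢ <;> exact this
  obtain ⟨u, d, hd, hdir⟩ := F.exists_rotation ho'
  have hn0 : (0 : ℝ) < n := by exact_mod_cast hn
  have hnz : (0 : ℤ) < n := by exact_mod_cast hn
  obtain ⟨D, hD, hDd⟩ : ∃ D : ℤ, (D = 1 ∨ D = -1) ∧ (D : ℝ) = d := by
    rcases hd with rfl | rfl
    · exact ⟨1, .inl rfl, by simp⟩
    · exact ⟨-1, .inr rfl, by simp⟩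
  set m : ℤ := ⌊n * u⌋ with hm
  let g : Fin n → Fin n := fun k => ⟨((m + D * k) % n).toNat, by
    have := Int.emod_lt_of_pos (m + D * k) hnz
    have := Int.emod_nonneg (m + D * k) hnz.ne'
    omega⟩
  have hg : ∀ k, (((g k : ℕ) : ℤ)) = (m + D * k) % n := fun k =>
    Int.toNat_of_nonneg (Int.emod_nonneg _ hnz.ne')
  have hinj : Function.Injective g := by
    intro k l hkl
    have h1 : (m + D * k) % n = (m + D * l) % n := by rw [← hg, ← hg, hkl]
    have h2 : (n : ℤ) ∣ (k : ℤ) - l := by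
      obtain ⟨c, hc⟩ := Int.ModEq.dvd (show (m + D * k) ≡ (m + D * l) [ZMOD n] from h1)
      rcases hD with rfl | rfl
      · exact ⟨-c, by linarith⟩
      · exact ⟨c, by linarith⟩
    have h3 := Int.eq_zero_of_abs_lt_dvd h2 (by rw [abs_lt]; omega)
    ext; omega
  refine ⟨(Equiv.ofBijective g (Finite.injective_iff_bijective.1 hinj)).symm,
    (n * u - m) / n, ?_, ?_, fun k => ?_⟩
  · have := Int.floor_le (n * u)
    exact div_nonneg (by linarith) hn0.le
  · have := Int.lt_floor_add_one (n * u)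
    exact div_le_div_of_nonneg_right (by linarith) hn0.le
  · obtain ⟨l, rfl⟩ := (Finite.injective_iff_bijective.1 hinj).2 k
    rw [show (Equiv.ofBijective g _).symm (g l) = l from
      (Equiv.ofBijective g (Finite.injective_iff_bijective.1 hinj)).symm_apply_apply l]
    have h1 : ((g l : ℕ) : ℝ) = m + D * l - n * ((m + D * l) / n : ℤ) := by
      have := Int.emod_add_mul_ediv (m + D * l) n
      rw [← hg] at this
      have h2 : (((g l : ℕ) : ℤ) : ℝ) = ((m + D * l - n * ((m + D * l) / n) : ℤ) : ℝ) := by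
        congr 1; linarith
      push_cast at h2 ⊢
      exact_mod_cast h2
    have h2 : ((g l : ℕ) : ℝ) / n + (n * u - m) / n =
        u + d * (l / n) + ((-((m + D * l) / n) : ℤ) : ℝ) := by
      rw [h1, ← hDd]; push_cast; field_simp; ring
    rw [h2, hp, Frame.pt, F.dir_add_int, ← hdir]
    have h3 : 2 * Real.pi * (l : ℝ) / n = 2 * Real.pi * (l / n) := by ring
    rw [h3]
    cases b <;> simp [unit]

/-! ### Triangles in the crossing graph as sign conditions -/

/-- A function whose sign is, for small positive `r`, the sign of the determinant of two points of
the circles of radius `r` around the centres of `X i` and `X i'` and of a point of the circle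
around the centre of `Y j`, and which does not degenerate at `r = 0`. -/
def side (X Y : Fin 2 → Frame) (r : ℝ) (i : Fin 2) (s : ℝ) (i' : Fin 2) (s' : ℝ) (j : Fin 2)
    (t : ℝ) : ℝ :=
  det3 ((X i).pt r s) (if i = i' then (X i).dir s' - (X i).dir s else (X i').pt r s')
    ((Y j).pt r t)

/-- Two points of one circle differ by `sin r` times a difference of directions, and `sin r` is
positive for `0 < r < π`. -/
lemma sign_det3_pt (X Y : Fin 2 → Frame) {r : ℝ} (h0 : 0 < r) (h1 : r < Real.pi) (i : Fin 2)
    (s : ℝ) (i' : Fin 2) (s' : ℝ) (j : Fin 2) (t : ℝ) :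
    sign (det3 ((X i).pt r s) ((X i').pt r s') ((Y j).pt r t)) =
      sign (side X Y r i s i' s' j t) := by
  rw [side]
  split_ifs with h
  · subst h
    rw [(X i).pt_eq_add r s s', det3_add_mid, det3_self_left, zero_add, det3_smul_mid, sign_mul,
      sign_pos (Real.sin_pos_of_pos_of_lt_pi h0 h1), one_mul]
  · rfl

/-- The signs of `side` for three pairs of parameters. -/
def sideSigns (X Y : Fin 2 → Frame) (r : ℝ) (I J : Fin 3 → Fin 2) (a b : Fin 3 → ℝ)
    (k l m : Fin 3) : SignType :=
  sign (side X Y r (I k) (a k) (I l) (a l) (J m) (b m))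

/-- The sign encoded by a truth value. -/
def boolSign (b : Bool) : SignType := if b then 1 else -1

lemma sign_unit (b : Bool) : sign (unit b) = boolSign b := by
  cases b <;> simp [unit, boolSign]

/-- The condition, in terms of signs of determinants, that two of three edges cross. -/
def PairCross (ε η : Fin 3 → Bool) (D E : Fin 3 → Fin 3 → Fin 3 → SignType) (k l : Fin 3) : Prop :=
  SameSign (boolSign (ε k) * boolSign (ε l) * boolSign (η k) * D k l k)
    (boolSign (ε k) * boolSign (ε l) * boolSign (η l) * D k l l)
    (boolSign (η k) * boolSign (η l) * boolSign (ε k) * E k l k)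
    (boolSign (η k) * boolSign (η l) * boolSign (ε l) * E k l l)

/-- The condition that three edges cross pairwise. -/
def AllCross (ε η : Fin 3 → Bool) (D E : Fin 3 → Fin 3 → Fin 3 → SignType) : Prop :=
  ∀ k l, k < l → PairCross ε η D E k l

instance (ε η : Fin 3 → Bool) (D E : Fin 3 → Fin 3 → Fin 3 → SignType) :
    Decidable (AllCross ε η D E) := by
  unfold AllCross PairCross; infer_instance

/-- By trilinearity the antipode signs come out of each determinant as factors. -/
lemma crossSign_iff_pairCross (X Y : Fin 2 → Frame) {r : ℝ} (h0 : 0 < r) (h1 : r < Real.pi)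
    (I J : Fin 3 → Fin 2) (ε η : Fin 3 → Bool) (a b : Fin 3 → ℝ) (k l : Fin 3) :
    CrossSign (unit (ε k) • (X (I k)).pt r (a k)) (unit (η k) • (Y (J k)).pt r (b k))
      (unit (ε l) • (X (I l)).pt r (a l)) (unit (η l) • (Y (J l)).pt r (b l)) ↔
    PairCross ε η (sideSigns X Y r I J a b) (sideSigns Y X r J I b a) k l := by
  simp only [CrossSign, PairCross, sideSigns, det3_smul_left, det3_smul_mid, det3_smul_right,
    sign_mul, sign_det3_pt _ _ h0 h1, sign_unit, mul_assoc, mul_left_comm]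

open Classical in
lemma natCard_triangleHom {V : Type*} [Fintype V] (G : SimpleGraph V) :
    (Nat.card ((⊤ : SimpleGraph (Fin 3)) →g G) : ℝ) =
      ∑ f : Fin 3 → V, if ∀ k l, k < l → G.Adj (f k) (f l) then (1 : ℝ) else 0 := by
  have e : ((⊤ : SimpleGraph (Fin 3)) →g G) ≃
      {f : Fin 3 → V // ∀ k l, k < l → G.Adj (f k) (f l)} :=
    { toFun := fun φ => ⟨φ, fun k l h => φ.map_adj (by simpa using h.ne)⟩
      invFun := fun f => ⟨f.1, fun {k l} h => by
        rcases lt_or_gt_of_ne (show k ≠ l by simpa using h) with h | h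
        · exact f.2 k l h
        · exact (f.2 l k h).symm⟩
      left_inv := fun φ => rfl
      right_inv := fun f => rfl }
  rw [Nat.card_congr e, Nat.card_eq_fintype_card, Fintype.card_subtype, Finset.sum_boole]

/-- Triples of edges, sorted into their nodes and their positions within the nodes. -/
def edgeTripleEquiv (n : ℕ) :
    (Fin 3 → ((Fin 2 × Bool) × Fin n) × ((Fin 2 × Bool) × Fin n)) ≃
      (Fin 3 → Fin 2) × (Fin 3 → Fin 2) × (Fin 3 → Bool) × (Fin 3 → Bool) × (Fin 3 → Fin n) ×
        (Fin 3 → Fin n) where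
  toFun g := (fun k => (g k).1.1.1, fun k => (g k).2.1.1, fun k => (g k).1.1.2,
    fun k => (g k).2.1.2, fun k => (g k).1.2, fun k => (g k).2.2)
  invFun x k := (((x.1 k, x.2.2.1 k), x.2.2.2.2.1 k), ((x.2.1 k, x.2.2.2.1 k), x.2.2.2.2.2 k))
  left_inv _ := rfl
  right_inv _ := rfl

/-- The `16 n²` edges contribute the normalisation `(16 n²)³ = 2 ^ 12 * n ^ 6`; homomorphisms from
`K₃` are ordered triples of pairwise crossing edges, sorted here by nodes and positions. -/
lemma triangleDensity_eq_sum (X Y : Fin 2 → Frame) {r : ℝ} (h0 : 0 < r) (h1 : r < Real.pi)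
    {n : ℕ} {P Q : Fin 2 × Bool → Fin n → E3} {ψ χ : Fin 2 × Bool → ℝ}
    (hP : ∀ x k, P x k = unit x.2 • (X x.1).pt r (k / n + ψ x))
    (hQ : ∀ x k, Q x k = unit x.2 • (Y x.1).pt r (k / n + χ x))
    (hg : GeneralPosition (Sum.elim (nodePoints P) (nodePoints Q))) :
    triangleDensity P Q = 1 / 2 ^ 12 * ∑ I : Fin 3 → Fin 2, ∑ J : Fin 3 → Fin 2,
      ∑ ε : Fin 3 → Bool, ∑ η : Fin 3 → Bool,
        1 / (n : ℝ) ^ 6 * ∑ κ : Fin 3 → Fin n, ∑ μ : Fin 3 → Fin n,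
          if AllCross ε η
            (sideSigns X Y r I J (fun k => κ k / n + ψ (I k, ε k)) (fun k => μ k / n + χ (J k, η k)))
            (sideSigns Y X r J I (fun k => μ k / n + χ (J k, η k)) (fun k => κ k / n + ψ (I k, ε k)))
          then (1 : ℝ) else 0 := by
  classical
  have hcard : Nat.card (((Fin 2 × Bool) × Fin n) × ((Fin 2 × Bool) × Fin n)) =
      16 * n ^ 2 := by
    simp; ring
  rw [triangleDensity, homDensity, hcard, natCard_triangleHom,
    ← (edgeTripleEquiv n).symm.sum_comp]
  simp only [Fintype.sum_prod_type, ← Finset.mul_sum]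
  have hc : ((((16 * n ^ 2 : ℕ) : ℝ)) ^ Nat.card (Fin 3))⁻¹ = 1 / 2 ^ 12 * (1 / (n : ℝ) ^ 6) := by
    rw [Nat.card_fin, Nat.cast_mul, mul_pow, mul_inv, Nat.cast_pow, ← pow_mul]
    norm_num
  rw [← mul_assoc, div_eq_mul_inv, mul_comm, hc]
  refine congrArg _ ?_
  · refine Finset.sum_congr rfl fun I _ => Finset.sum_congr rfl fun J _ =>
      Finset.sum_congr rfl fun ε _ => Finset.sum_congr rfl fun η _ =>
      Finset.sum_congr rfl fun κ _ => Finset.sum_congr rfl fun μ _ => ?_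
    refine if_congr (forall_congr' fun k => forall_congr' fun l => imp_congr Iff.rfl ?_) rfl rfl
    rw [crossingGraph_adj_iff hg, ← crossSign_iff_pairCross X Y h0 h1]
    simp only [nodePoints, edgeTripleEquiv, Equiv.coe_fn_symm_mk, hP, hQ]

/-- Renumbering the points within each node is an isomorphism of crossing graphs; it absorbs the
permutations from `exists_perm_of_evenlySpaced`. -/
lemma triangleDensity_reindex {n : ℕ} (P Q : Fin 2 × Bool → Fin n → E3)
    (π τ : Fin 2 × Bool → Equiv.Perm (Fin n)) :
    triangleDensity (fun x k => P x (π x k)) (fun x k => Q x (τ x k)) = triangleDensity P Q := by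
  have e : crossingGraph (nodePoints fun x k => P x (π x k)) (nodePoints fun x k => Q x (τ x k)) ≃g
      crossingGraph (nodePoints P) (nodePoints Q) :=
    { toEquiv := Equiv.prodCongr (Equiv.prodShear (Equiv.refl _) π)
        (Equiv.prodShear (Equiv.refl _) τ)
      map_rel_iff' := by
        rintro e f
        exact and_congr (Equiv.injective _).ne_iff Iff.rfl }
  unfold triangleDensity homDensity
  congr 2
  exact Nat.card_congr
    { toFun := fun φ => e.toHom.comp φ
      invFun := fun φ => e.symm.toHom.comp φ
      left_inv := fun φ => by ext x <;> simp
      right_inv := fun φ => by ext x <;> simp }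

/-- The triangle density of a blowup drawing, as a sum over equally spaced parameters. -/
lemma IsBlowup.triangleDensity_eq {v w : Fin 2 → E3} {X Y : Fin 2 → Frame}
    (hX : ∀ i, (X i).c = v i) (hY : ∀ i, (Y i).c = w i) {r : ℝ} (h0 : 0 < r) (h1 : r < Real.pi)
    {n : ℕ} (hn : 1 ≤ n) {P Q : Fin 2 × Bool → Fin n → E3} (h : IsBlowup v w r n P Q) :
    ∃ ψ χ : Fin 2 × Bool → ℝ, (∀ x, 0 ≤ ψ x ∧ ψ x ≤ 1 / n) ∧ (∀ x, 0 ≤ χ x ∧ χ x ≤ 1 / n) ∧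
    triangleDensity P Q = 1 / 2 ^ 12 * ∑ I : Fin 3 → Fin 2, ∑ J : Fin 3 → Fin 2,
      ∑ ε : Fin 3 → Bool, ∑ η : Fin 3 → Bool,
        1 / (n : ℝ) ^ 6 * ∑ κ : Fin 3 → Fin n, ∑ μ : Fin 3 → Fin n,
          if AllCross ε η
            (sideSigns X Y r I J (fun k => κ k / n + ψ (I k, ε k)) (fun k => μ k / n + χ (J k, η k)))
            (sideSigns Y X r J I (fun k => μ k / n + χ (J k, η k)) (fun k => κ k / n + ψ (I k, ε k)))
          then (1 : ℝ) else 0 := by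
  have hL : ∀ x : Fin 2 × Bool, ∃ (π : Equiv.Perm (Fin n)) (ψ : ℝ), 0 ≤ ψ ∧ ψ ≤ 1 / n ∧
      ∀ k, P x (π k) = unit x.2 • (X x.1).pt r (k / n + ψ) := fun x => by
    refine exists_perm_of_evenlySpaced (X x.1) x.2 hn ?_
    rw [hX, ← withAntipodes_eq]; exact h.left x
  have hR : ∀ x : Fin 2 × Bool, ∃ (π : Equiv.Perm (Fin n)) (ψ : ℝ), 0 ≤ ψ ∧ ψ ≤ 1 / n ∧
      ∀ k, Q x (π k) = unit x.2 • (Y x.1).pt r (k / n + ψ) := fun x => by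
    refine exists_perm_of_evenlySpaced (Y x.1) x.2 hn ?_
    rw [hY, ← withAntipodes_eq]; exact h.right x
  choose π ψ hψ0 hψ1 hP using hL
  choose τ χ hχ0 hχ1 hQ using hR
  refine ⟨ψ, χ, fun x => ⟨hψ0 x, hψ1 x⟩, fun x => ⟨hχ0 x, hχ1 x⟩, ?_⟩
  rw [← triangleDensity_reindex P Q π τ]
  refine triangleDensity_eq_sum X Y h0 h1 hP hQ ?_
  let g : ((Fin 2 × Bool) × Fin n) ⊕ ((Fin 2 × Bool) × Fin n) ≃
      ((Fin 2 × Bool) × Fin n) ⊕ ((Fin 2 × Bool) × Fin n) :=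
    Equiv.sumCongr (Equiv.prodShear (Equiv.refl _) π) (Equiv.prodShear (Equiv.refl _) τ)
  have hg : Sum.elim (nodePoints fun x k => P x (π x k)) (nodePoints fun x k => Q x (τ x k)) =
      Sum.elim (nodePoints P) (nodePoints Q) ∘ g := by
    ext1 x; rcases x with x | x <;> rfl
  rw [hg]
  intro i j k hij hik hjk
  exact h.generalPosition _ _ _ (g.injective.ne hij) (g.injective.ne hik) (g.injective.ne hjk)

end Signs

/-! ### Averages over evenly spaced points -/

/-- The uniform distribution of an angle, measured in full turns. -/
def turn : Measure ℝ := volume.restrict (Set.Ico 0 1)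

instance : IsProbabilityMeasure turn := ⟨by simp [turn]⟩

/-- The joint distribution of three independent uniform angles. -/
def turns : Measure (Fin 3 → ℝ) := Measure.pi fun _ => turn

instance : IsProbabilityMeasure turns := by unfold turns; infer_instance

lemma ae_turn_mem : ∀ᵐ u ∂turn, u ∈ Set.Ico (0 : ℝ) 1 := ae_restrict_mem measurableSet_Ico

lemma ae_turns_mem : ∀ᵐ a ∂turns, ∀ k, a k ∈ Set.Ico (0 : ℝ) 1 := by
  rw [ae_all_iff]
  intro k
  exact (measurePreserving_eval (fun _ : Fin 3 => turn) k).quasiMeasurePreserving.ae ae_turn_mem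

/-- The index of the interval `[k / n, (k + 1) / n)` that contains a point of `[0, 1)`. -/
def cell (n : ℕ) [NeZero n] (u : ℝ) : Fin n := Fin.ofNat n ⌊n * u⌋₊

section Cell

variable {n : ℕ} [NeZero n]

lemma measurable_cell : Measurable (cell n) := by
  have h : Measurable fun u : ℝ => ⌊(n : ℝ) * u⌋₊ := Nat.measurable_floor.comp (by fun_prop)
  exact (measurable_of_countable (Fin.ofNat n)).comp h

lemma cell_val {u : ℝ} (h : u ∈ Set.Ico (0 : ℝ) 1) : (cell n u : ℕ) = ⌊n * u⌋₊ := by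
  have hn : (0 : ℝ) < n := by exact_mod_cast NeZero.pos n
  rw [cell, Fin.val_ofNat, Nat.mod_eq_of_lt]
  rw [Nat.floor_lt (mul_nonneg hn.le h.1)]
  nlinarith [h.2]

lemma abs_cell_sub_le {u : ℝ} (h : u ∈ Set.Ico (0 : ℝ) 1) : |(cell n u : ℝ) / n - u| ≤ 1 / n := by
  have hn : (0 : ℝ) < n := by exact_mod_cast NeZero.pos n
  have h1 := Nat.floor_le (mul_nonneg hn.le h.1)
  have h2 := Nat.lt_floor_add_one ((n : ℝ) * u)
  have e : (cell n u : ℝ) / n - u = (⌊n * u⌋₊ - n * u) / n := by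
    rw [show ((cell n u : ℕ) : ℝ) = (⌊n * u⌋₊ : ℝ) by rw [cell_val h]]
    field_simp
  rw [e, abs_div, abs_of_pos hn]
  gcongr
  rw [abs_le]; constructor <;> linarith

lemma map_cell_singleton (k : Fin n) : (turn.map (cell n)) {k} = ENNReal.ofReal (1 / n) := by
  have hn : (0 : ℝ) < n := by exact_mod_cast NeZero.pos n
  rw [Measure.map_apply measurable_cell (measurableSet_singleton k), turn,
    Measure.restrict_apply (measurable_cell (measurableSet_singleton k))]
  have e : cell n ⁻¹' {k} ∩ Set.Ico 0 1 = Set.Ico ((k : ℝ) / n) (((k : ℝ) + 1) / n) := by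
    ext u
    simp only [Set.mem_inter_iff, Set.mem_preimage, Set.mem_singleton_iff, Set.mem_Ico]
    have hk : ((k : ℕ) : ℝ) + 1 ≤ n := by exact_mod_cast k.2
    constructor
    · rintro ⟨h1, h2⟩
      have h3 := cell_val (n := n) h2
      rw [h1] at h3
      rw [div_le_iff₀ hn, lt_div_iff₀ hn, h3]
      have := Nat.floor_le (mul_nonneg hn.le h2.1)
      have := Nat.lt_floor_add_one ((n : ℝ) * u)
      constructor <;> linarith
    · rintro ⟨h1, h2⟩
      have h0 : (0 : ℝ) ≤ u := le_trans (by positivity) h1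
      rw [div_le_iff₀ hn] at h1
      rw [lt_div_iff₀ hn] at h2
      have h3 : u < 1 := by nlinarith
      refine ⟨?_, h0, h3⟩
      ext
      rw [cell_val ⟨h0, h3⟩, Nat.floor_eq_iff (by positivity)]
      constructor <;> linarith
  rw [e, Real.volume_Ico]
  congr 1
  field_simp
  ring

lemma map_cells_real_singleton (κ : Fin 3 → Fin n) :
    (turns.map fun a k => cell n (a k)).real {κ} = 1 / n ^ 3 := by
  have : IsProbabilityMeasure (turn.map (cell n)) :=
    Measure.isProbabilityMeasure_map measurable_cell.aemeasurable
  rw [turns, Measure.real, Measure.pi_map_pi (fun _ => measurable_cell.aemeasurable),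
    Measure.pi_singleton]
  simp only [map_cell_singleton, Finset.prod_const, Finset.card_univ, Fintype.card_fin,
    ENNReal.toReal_pow]
  rw [ENNReal.toReal_ofReal (by positivity), div_pow, one_pow]

lemma measurable_cells : Measurable fun (a : Fin 3 → ℝ) (k : Fin 3) => cell n (a k) :=
  measurable_pi_lambda _ fun k => measurable_cell.comp (measurable_pi_apply k)

/-- The cell of a uniform angle is uniform on `Fin n`, so a grid average is exactly an integral over
angles, on a space independent of `n`. -/
lemma integral_cells (g : (Fin 3 → Fin n) → ℝ) :
    ∫ a, g (fun k => cell n (a k)) ∂turns = 1 / (n : ℝ) ^ 3 * ∑ κ, g κ := by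
  have : IsProbabilityMeasure (turns.map fun a k => cell n (a k)) :=
    Measure.isProbabilityMeasure_map measurable_cells.aemeasurable
  rw [← integral_map (φ := fun (a : Fin 3 → ℝ) k => cell n (a k)) (f := g)
    measurable_cells.aemeasurable
    (measurable_of_countable g).aestronglyMeasurable, integral_fintype .of_finite]
  simp [map_cells_real_singleton, Finset.mul_sum]

lemma integral_cells_prod (g : (Fin 3 → Fin n) → (Fin 3 → Fin n) → ℝ) :
    ∫ ω, g (fun k => cell n (ω.1 k)) (fun k => cell n (ω.2 k)) ∂(turns.prod turns) =
      1 / (n : ℝ) ^ 6 * ∑ κ, ∑ μ, g κ μ := by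
  have hm : Measurable fun ω : (Fin 3 → ℝ) × (Fin 3 → ℝ) =>
      g (fun k => cell n (ω.1 k)) (fun k => cell n (ω.2 k)) :=
    (measurable_of_countable (Function.uncurry g)).comp
      ((measurable_cells.comp measurable_fst).prodMk (measurable_cells.comp measurable_snd))
  obtain ⟨c, hc⟩ := (Set.finite_range (Function.uncurry g)).isBounded.exists_norm_le
  rw [integral_prod]
  · simp only [integral_cells]
    rw [integral_cells (fun κ => 1 / (n : ℝ) ^ 3 * ∑ μ, g κ μ), ← Finset.mul_sum, ← mul_assoc]
    congr 1
    rw [div_mul_div_comm, ← pow_add]; norm_num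
  · exact Integrable.of_bound hm.aestronglyMeasurable c
      (Eventually.of_forall fun ω => hc _ ⟨(_, _), rfl⟩)

end Cell

/-- Averages over equally spaced parameters of functions that are, almost everywhere, locally
constant converge to the integral. -/
lemma tendsto_average {F : ℝ → (Fin 3 → ℝ) → (Fin 3 → ℝ) → ℝ} {ρ : ℝ}
    (hF : ∀ r a b, |F r a b| ≤ 1)
    (hc : ∀ᵐ ω ∂(turns.prod turns), ∀ᶠ p in 𝓝 (ρ, ω.1, ω.2), F p.1 p.2.1 p.2.2 = F ρ ω.1 ω.2)
    {r : ℕ → ℝ} (hr : Tendsto r atTop (𝓝 ρ)) {ψ χ : ℕ → Fin 3 → ℝ}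
    (hψ : ∀ n, 1 ≤ n → ∀ k, 0 ≤ ψ n k ∧ ψ n k ≤ 1 / n)
    (hχ : ∀ n, 1 ≤ n → ∀ k, 0 ≤ χ n k ∧ χ n k ≤ 1 / n) :
    Tendsto (fun n : ℕ => 1 / (n : ℝ) ^ 6 * ∑ κ : Fin 3 → Fin n, ∑ μ : Fin 3 → Fin n,
      F (r n) (fun k => κ k / n + ψ n k) (fun k => μ k / n + χ n k)) atTop
      (𝓝 (∫ ω, F ρ ω.1 ω.2 ∂(turns.prod turns))) := by
  -- The shift by one keeps the number of grid points nonzero, as `cell` requires.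
  rw [← tendsto_add_atTop_iff_nat 1]
  have hn : ∀ n : ℕ, NeZero (n + 1) := fun n => inferInstance
  simp only [← integral_cells_prod (n := _ + 1) (fun κ μ => F _ (fun k => κ k / _ + _) (fun k => μ k / _ + _))]
  have hconv : ∀ {ψ : ℕ → Fin 3 → ℝ}, (∀ n, 1 ≤ n → ∀ k, 0 ≤ ψ n k ∧ ψ n k ≤ 1 / n) →
      ∀ {a : Fin 3 → ℝ}, (∀ k, a k ∈ Set.Ico (0 : ℝ) 1) →
      Tendsto (fun n : ℕ => fun k => (cell (n + 1) (a k) : ℝ) / ((n + 1 : ℕ) : ℝ) + ψ (n + 1) k)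
        atTop (𝓝 a) := by
    intro ψ hψ a ha
    rw [tendsto_pi_nhds]
    intro k
    rw [tendsto_iff_dist_tendsto_zero]
    have h0 : Tendsto (fun n : ℕ => 2 * (1 / ((n + 1 : ℕ) : ℝ))) atTop (𝓝 0) := by
      have := (tendsto_one_div_add_atTop_nhds_zero_nat (𝕜 := ℝ)).const_mul 2
      simpa using this
    refine squeeze_zero (fun _ => dist_nonneg) (fun n => ?_) h0
    have h1 := abs_le.1 (abs_cell_sub_le (n := n + 1) (ha k))
    have h2 := hψ (n + 1) (by omega) k
    rw [Real.dist_eq, abs_le]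
    constructor <;> linarith
  refine tendsto_integral_of_dominated_convergence (fun _ => 1) (fun n => ?_)
    (integrable_const _) (fun n => Eventually.of_forall fun ω => hF _ _ _) ?_
  · exact ((measurable_of_countable (Function.uncurry fun κ μ : Fin 3 → Fin (n + 1) =>
      F (r (n + 1)) (fun k => κ k / ((n + 1 : ℕ) : ℝ) + ψ (n + 1) k)
        (fun k => μ k / ((n + 1 : ℕ) : ℝ) + χ (n + 1) k))).comp
      ((measurable_cells.comp measurable_fst).prodMk
        (measurable_cells.comp measurable_snd))).aestronglyMeasurable
  · have m1 := Measure.quasiMeasurePreserving_fst (μ := turns) (ν := turns) |>.ae ae_turns_mem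
    have m2 := Measure.quasiMeasurePreserving_snd (μ := turns) (ν := turns) |>.ae ae_turns_mem
    filter_upwards [hc, m1, m2] with ω h h1 h2
    -- The radius and the shifted grid parameters converge to `(ρ, ω)`, so they eventually enter the
    -- neighbourhood on which `F` is constant.
    refine tendsto_const_nhds.congr' ?_
    have ht := ((hr.comp (tendsto_add_atTop_nat 1)).prodMk_nhds
      ((hconv hψ h1).prodMk_nhds (hconv hχ h2))).eventually h
    filter_upwards [ht] with n hn
    exact hn.symm

/-! ### Signs of trigonometric functions and thin sets of angles -/

/-- The sign of a real number, as a real number. -/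
def sgn (x : ℝ) : ℝ := (SignType.sign x : SignType)

lemma sgn_of_pos {x : ℝ} (h : 0 < x) : sgn x = 1 := by simp [sgn, sign_pos h]

lemma sgn_of_neg {x : ℝ} (h : x < 0) : sgn x = -1 := by simp [sgn, sign_neg h]

@[simp] lemma sgn_zero : sgn 0 = 0 := by simp [sgn]

lemma sgn_mul (x y : ℝ) : sgn (x * y) = sgn x * sgn y := by simp [sgn, sign_mul]

lemma sgn_neg (x : ℝ) : sgn (-x) = -sgn x := by
  rw [← neg_one_mul, sgn_mul, sgn_of_neg (by norm_num : (-1 : ℝ) < 0), neg_one_mul]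

lemma sgn_sq {x : ℝ} (h : x ≠ 0) : sgn x ^ 2 = 1 := by
  rcases lt_or_gt_of_ne h with h | h
  · simp [sgn_of_neg h]
  · simp [sgn_of_pos h]

lemma abs_sgn_le (x : ℝ) : |sgn x| ≤ 1 := by
  rcases lt_trichotomy x 0 with h | rfl | h
  · simp [sgn_of_neg h]
  · simp
  · simp [sgn_of_pos h]

lemma sgn_eq_ite : sgn = fun x => if 0 < x then 1 else if x < 0 then -1 else 0 := by
  ext x
  rcases lt_trichotomy x 0 with h | rfl | h
  · simp [sgn_of_neg h, h, h.le]
  · simp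
  · simp [sgn_of_pos h, h]

lemma measurable_sgn : Measurable sgn := by
  rw [sgn_eq_ite]
  exact Measurable.ite measurableSet_Ioi measurable_const
    (Measurable.ite measurableSet_Iio measurable_const measurable_const)

lemma sign_eq_sign_iff_sgn {x y : ℝ} : SignType.sign x = SignType.sign y ↔ sgn x = sgn y := by
  constructor
  · intro h; rw [sgn, sgn, h]
  · intro h
    rcases lt_trichotomy x 0 with h1 | rfl | h1 <;> rcases lt_trichotomy y 0 with h2 | rfl | h2 <;>
    simp_all [sgn_of_neg, sgn_of_pos, sign_pos, sign_neg] <;> norm_num at h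

/-! ### One uniform angle -/

lemma integral_turn_periodic {g : ℝ → ℝ} (hg : Function.Periodic g (2 * Real.pi)) (k : ℝ) :
    ∫ x, g (2 * Real.pi * x + k) ∂turn =
      (2 * Real.pi)⁻¹ * ∫ x in (-Real.pi)..Real.pi, g x := by
  rw [turn, integral_Ico_eq_integral_Ioc, ← intervalIntegral.integral_of_le zero_le_one,
    intervalIntegral.integral_comp_mul_add g (by positivity) k, smul_eq_mul, mul_zero, zero_add,
    mul_one, add_comm (2 * Real.pi), hg.intervalIntegral_add_eq k (-Real.pi)]
  congr 3
  ring

/-- On the period `(-π, π]` the condition is `|x| < θ`, an interval of length `2θ` out of `2π`. -/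
lemma turn_real_cos_lt {θ : ℝ} (h0 : 0 ≤ θ) (h1 : θ ≤ Real.pi) (k : ℝ) :
    turn.real {x | Real.cos θ < Real.cos (2 * Real.pi * x + k)} = θ / Real.pi := by
  have hm : MeasurableSet {x : ℝ | Real.cos θ < Real.cos (2 * Real.pi * x + k)} :=
    measurableSet_lt measurable_const (by fun_prop)
  have hp : Function.Periodic ({x : ℝ | Real.cos θ < Real.cos x}.indicator (1 : ℝ → ℝ))
      (2 * Real.pi) := by
    intro x
    simp only [Set.indicator, Set.mem_ofPred_eq, Real.cos_add_two_pi, Pi.one_apply]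
  have h := integral_turn_periodic hp k
  have e1 : (fun x => ({x : ℝ | Real.cos θ < Real.cos x}.indicator (1 : ℝ → ℝ))
      (2 * Real.pi * x + k)) =
      {x | Real.cos θ < Real.cos (2 * Real.pi * x + k)}.indicator (1 : ℝ → ℝ) := by
    ext x; simp [Set.indicator]
  rw [e1, integral_indicator_one hm] at h
  rw [h]
  have hpi := Real.pi_pos
  have e2 : ∫ x in (-Real.pi)..Real.pi, ({x : ℝ | Real.cos θ < Real.cos x}.indicator 1 x : ℝ) =
      ∫ x in Set.Ioc (-Real.pi) Real.pi, ((Set.Ioo (-θ) θ).indicator 1 x : ℝ) := by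
    rw [intervalIntegral.integral_of_le (by linarith)]
    refine setIntegral_congr_fun measurableSet_Ioc fun x hx => ?_
    have h : x ∈ {x : ℝ | Real.cos θ < Real.cos x} ↔ x ∈ Set.Ioo (-θ) θ := by
      rw [Set.mem_ofPred_eq, ← Real.cos_abs x, Real.strictAntiOn_cos.lt_iff_gt ⟨h0, h1⟩
        ⟨abs_nonneg x, abs_le.2 ⟨hx.1.le, hx.2⟩⟩, abs_lt, Set.mem_Ioo]
    by_cases hxθ : x ∈ Set.Ioo (-θ) θ
    · simp only [Set.indicator_of_mem hxθ, Set.indicator_of_mem (h.2 hxθ)]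
    · simp only [Set.indicator_of_notMem hxθ, Set.indicator_of_notMem (mt h.1 hxθ)]
  rw [e2, integral_indicator_one measurableSet_Ioo, Measure.real,
    Measure.restrict_apply measurableSet_Ioo]
  have e3 : Set.Ioo (-θ) θ ∩ Set.Ioc (-Real.pi) Real.pi = Set.Ioo (-θ) θ :=
    Set.inter_eq_left.2 fun x hx => ⟨by linarith [hx.1], by linarith [hx.2]⟩
  rw [e3, Real.volume_Ioo, ENNReal.toReal_ofReal (by linarith)]
  field_simp
  ring

lemma countable_cos_eq (c k : ℝ) : {x : ℝ | Real.cos (2 * Real.pi * x + k) = c}.Countable := by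
  rcases Set.eq_empty_or_nonempty {x : ℝ | Real.cos (2 * Real.pi * x + k) = c} with h | ⟨y, hy⟩
  · rw [h]; exact Set.countable_empty
  refine ((Set.countable_range fun z : ℤ => y - z).union
    (Set.countable_range fun z : ℤ => z - k / Real.pi - y)).mono fun x hx => ?_
  have hpi := Real.pi_pos
  obtain ⟨z, hz | hz⟩ := Real.cos_eq_cos_iff.1 (Eq.trans hx (Eq.symm hy))
  · refine .inl ⟨z, ?_⟩
    have : 2 * Real.pi * (y - z - x) = 0 := by linarith
    have := (mul_eq_zero.1 this).resolve_left (by positivity)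
    simp only; linarith
  · refine .inr ⟨z, ?_⟩
    simp only
    field_simp
    linarith

lemma turn_countable {s : Set ℝ} (h : s.Countable) : turn s = 0 :=
  Measure.absolutelyContinuous_of_le Measure.restrict_le_self (h.measure_zero volume)

/-- In polar form the equation prescribes the cosine of a shifted angle, which has countably many
solutions. -/
lemma turn_trig_eq_zero {B C : ℝ} (h : 0 < √(B ^ 2 + C ^ 2)) (A : ℝ) :
    turn {x | A + (B * Real.cos (2 * Real.pi * x) + C * Real.sin (2 * Real.pi * x)) = 0} = 0 := by
  obtain ⟨R, φ, hR, hB, hC⟩ := exists_polar B C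
  rw [← hR] at h
  refine turn_countable ((countable_cos_eq (-A / R) (-φ)).mono fun x hx => ?_)
  simp only [Set.mem_ofPred_eq] at hx ⊢
  rw [eq_div_iff h.ne', ← sub_eq_add_neg, Real.cos_sub]
  rw [hB, hC] at hx
  linarith

lemma integral_sgn_cos {θ : ℝ} (h0 : 0 ≤ θ) (h1 : θ ≤ Real.pi) (k : ℝ) :
    ∫ x, sgn (Real.cos θ - Real.cos (2 * Real.pi * x + k)) ∂turn = 1 - 2 * (θ / Real.pi) := by
  have hm : MeasurableSet {x : ℝ | Real.cos θ < Real.cos (2 * Real.pi * x + k)} :=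
    measurableSet_lt measurable_const (by fun_prop)
  have e : (fun x => sgn (Real.cos θ - Real.cos (2 * Real.pi * x + k))) =ᵐ[turn] fun x =>
      1 - 2 * {x | Real.cos θ < Real.cos (2 * Real.pi * x + k)}.indicator (1 : ℝ → ℝ) x := by
    have h := turn_countable (countable_cos_eq (Real.cos θ) k)
    filter_upwards [compl_mem_ae_iff.2 h] with x hx
    rcases lt_or_gt_of_ne (show Real.cos (2 * Real.pi * x + k) ≠ Real.cos θ from hx) with h | h
    · rw [sgn_of_pos (by linarith), Set.indicator_of_notMem (by simp [h.le])]; ring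
    · rw [sgn_of_neg (by linarith), Set.indicator_of_mem (by simpa using h)]; norm_num
  have hi : Integrable ({x | Real.cos θ < Real.cos (2 * Real.pi * x + k)}.indicator
      (1 : ℝ → ℝ)) turn :=
    (integrable_indicator_iff hm).2 (integrable_const (1 : ℝ)).integrableOn
  rw [integral_congr_ae e, integral_sub (integrable_const _) (hi.const_mul 2), integral_const_mul,
    integral_indicator_one hm, turn_real_cos_lt h0 h1]
  simp

/-- The sign of the product of the increments of two linear functionals on the circle, averaged
over one of the two endpoints: the inscribed angle theorem. -/
lemma integral_sgn_increments {B C B' C' θ : ℝ} (h0 : 0 ≤ θ) (h1 : θ ≤ Real.pi)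
    (h : 0 < √(B ^ 2 + C ^ 2)) (h' : 0 < √(B' ^ 2 + C' ^ 2))
    (hθ : B * B' + C * C' = √(B ^ 2 + C ^ 2) * √(B' ^ 2 + C' ^ 2) * Real.cos θ) (s : ℝ) :
    ∫ x, sgn (B * (Real.cos (2 * Real.pi * x) - Real.cos (2 * Real.pi * s)) +
        C * (Real.sin (2 * Real.pi * x) - Real.sin (2 * Real.pi * s))) *
      sgn (B' * (Real.cos (2 * Real.pi * x) - Real.cos (2 * Real.pi * s)) +
        C' * (Real.sin (2 * Real.pi * x) - Real.sin (2 * Real.pi * s))) ∂turn =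
      1 - 2 * (θ / Real.pi) := by
  obtain ⟨R, φ, hR, hB, hC⟩ := exists_polar B C
  obtain ⟨R', φ', hR', hB', hC'⟩ := exists_polar B' C'
  rw [← hR] at h
  rw [← hR'] at h'
  have hc : Real.cos (φ - φ') = Real.cos θ := by
    rw [← hR, ← hR', hB, hC, hB', hC'] at hθ
    have : R * R' * (Real.cos (φ - φ') - Real.cos θ) = 0 := by rw [Real.cos_sub]; linarith
    have := (mul_eq_zero.1 this).resolve_left (by positivity)
    linarith
  rw [← integral_sgn_cos h0 h1 (2 * Real.pi * s - φ - φ')]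
  refine integral_congr_ae ?_
  have hz : turn {x | Real.sin (Real.pi * (x - s)) = 0} = 0 := by
    refine turn_countable ((Set.countable_range fun z : ℤ => s + z).mono fun x hx => ?_)
    obtain ⟨z, hz⟩ := Real.sin_eq_zero_iff.1 hx
    refine ⟨z, ?_⟩
    have : Real.pi * (x - s - z) = 0 := by linarith
    have := (mul_eq_zero.1 this).resolve_left Real.pi_pos.ne'
    simp only; linarith
  filter_upwards [compl_mem_ae_iff.2 hz] with x hx
  -- A chord from angle `s` to angle `x` is perpendicular to the direction of their mean angle. The
  -- length factor `sin (π (x - s))` is common to both functionals and enters the product squared,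
  -- so it does not affect the sign.
  have key : ∀ R φ : ℝ, R * Real.cos φ * (Real.cos (2 * Real.pi * x) - Real.cos (2 * Real.pi * s)) +
      R * Real.sin φ * (Real.sin (2 * Real.pi * x) - Real.sin (2 * Real.pi * s)) =
      (-2 * R) * Real.sin (Real.pi * (x - s)) * Real.sin (Real.pi * (x + s) - φ) := by
    intro R φ
    rw [Real.cos_sub_cos, Real.sin_sub_sin, Real.sin_sub,
      show (2 * Real.pi * x + 2 * Real.pi * s) / 2 = Real.pi * (x + s) by ring,
      show (2 * Real.pi * x - 2 * Real.pi * s) / 2 = Real.pi * (x - s) by ring]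
    ring
  -- The remaining product of sines is a difference of cosines in which `s` occurs only as a phase,
  -- and a uniform angle does not see the phase.
  have hprod : Real.cos θ - Real.cos (2 * Real.pi * x + (2 * Real.pi * s - φ - φ')) =
      2 * (Real.sin (Real.pi * (x + s) - φ) * Real.sin (Real.pi * (x + s) - φ')) := by
    rw [← hc, Real.cos_sub_cos,
      show (φ - φ' + (2 * Real.pi * x + (2 * Real.pi * s - φ - φ'))) / 2 =
        Real.pi * (x + s) - φ' by ring,
      show (φ - φ' - (2 * Real.pi * x + (2 * Real.pi * s - φ - φ'))) / 2 =
        -(Real.pi * (x + s) - φ) by ring, Real.sin_neg]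
    ring
  rw [hB, hC, hB', hC', key, key, hprod, ← sgn_mul]
  have : (-2 * R) * Real.sin (Real.pi * (x - s)) * Real.sin (Real.pi * (x + s) - φ) *
      ((-2 * R') * Real.sin (Real.pi * (x - s)) * Real.sin (Real.pi * (x + s) - φ')) =
      (4 * (R * R' * Real.sin (Real.pi * (x - s)) ^ 2)) *
      (Real.sin (Real.pi * (x + s) - φ) * Real.sin (Real.pi * (x + s) - φ')) := by ring
  have hx' : Real.sin (Real.pi * (x - s)) ≠ 0 := hx
  rw [this, sgn_mul, sgn_mul 2, sgn_of_pos (by norm_num : (0 : ℝ) < 2),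
    sgn_of_pos (show 0 < 4 * (R * R' * Real.sin (Real.pi * (x - s)) ^ 2) by positivity)]

/-- Doubling the angle turns a small `|cos|` into a cosine near `1`, whose distribution is known
from `turn_real_cos_lt`. The threshold angle `2πε` has probability `2ε`. -/
lemma turn_abs_cos_le {ε : ℝ} (h : 0 < ε) (k : ℝ) :
    turn {x | |Real.cos (Real.pi * x + k)| ≤ ε} ≤ ENNReal.ofReal (2 * ε) := by
  rcases le_or_gt (1 / 2) ε with h1 | h1
  · exact prob_le_one.trans (by rw [ENNReal.one_le_ofReal]; linarith)
  have hpi := Real.pi_pos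
  have hψ1 : 2 * Real.pi * ε ≤ Real.pi := by nlinarith
  -- The quadratic bound `cos x ≤ 1 - 2 x² / π²` gives `1 - 8 ε²` here, which leaves room for a
  -- strict inequality.
  have hc : Real.cos (2 * Real.pi * ε) < 1 - 2 * ε ^ 2 := by
    have := Real.cos_le_one_sub_mul_cos_sq (x := 2 * Real.pi * ε) (abs_le.2 ⟨by nlinarith, hψ1⟩)
    have e : 2 / Real.pi ^ 2 * (2 * Real.pi * ε) ^ 2 = 8 * ε ^ 2 := by field_simp; norm_num
    nlinarith [sq_pos_of_pos h]
  have h2 := turn_real_cos_lt (by positivity) hψ1 (2 * k + Real.pi)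
  have e : 2 * Real.pi * ε / Real.pi = 2 * ε := by field_simp
  rw [e, Measure.real] at h2
  rw [← h2, ENNReal.ofReal_toReal (measure_ne_top _ _)]
  refine measure_mono fun x hx => ?_
  simp only [Set.mem_ofPred_eq] at hx ⊢
  have e3 : 2 * Real.pi * x + (2 * k + Real.pi) = 2 * (Real.pi * x + k) + Real.pi := by ring
  rw [e3, Real.cos_add_pi, Real.cos_two_mul]
  have := sq_le_sq' (neg_le_of_abs_le hx) (le_of_abs_le hx)
  linarith

/-! ### Reduction to one angle -/

/-- Tonelli: a bound for every fixed choice of the other two angles survives averaging over them. -/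
lemma turns_le_of_slices {S : Set (Fin 3 → ℝ)} (hS : MeasurableSet S) (l : Fin 3) {c : ENNReal}
    (h : ∀ a, turn {x | Function.update a l x ∈ S} ≤ c) : turns S ≤ c := by
  have e := measurePreserving_piFinSuccAbove (fun _ : Fin 3 => turn) l
  rw [turns, ← e.symm.measure_preimage hS.nullMeasurableSet,
    Measure.prod_apply_symm (e.symm.measurable hS)]
  refine (lintegral_mono (g := fun _ => c) fun y => ?_).trans (by simp)
  refine le_of_eq_of_le ?_ (h (l.insertNth 0 y))
  congr 1
  ext x
  simp only [Set.mem_preimage, Set.mem_ofPred_eq]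
  rw [Fin.update_insertNth]
  rfl

lemma prod_le_of_slices_fst {S : Set ((Fin 3 → ℝ) × (Fin 3 → ℝ))} (hS : MeasurableSet S)
    (l : Fin 3) {c : ENNReal} (h : ∀ a b, turn {x | (Function.update a l x, b) ∈ S} ≤ c) :
    (turns.prod turns) S ≤ c := by
  rw [Measure.prod_apply_symm hS]
  refine (lintegral_mono (g := fun _ => c) fun b => ?_).trans (by simp)
  exact turns_le_of_slices (measurable_prodMk_right hS) l fun a => h a b

/-! ### The crossing indicator in the limit -/

lemma side_same (X Y : Fin 2 → Frame) (r : ℝ) (i : Fin 2) (s s' : ℝ) (j : Fin 2) (t : ℝ) :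
    side X Y r i s i s' j t =
      det3 ((X i).pt r s) (X i).e ((Y j).pt r t) *
        (Real.cos (2 * Real.pi * s') - Real.cos (2 * Real.pi * s)) +
      det3 ((X i).pt r s) (X i).f ((Y j).pt r t) *
        (Real.sin (2 * Real.pi * s') - Real.sin (2 * Real.pi * s)) := by
  simp only [side, if_true, Frame.dir, det3_sub_mid, det3_add_mid, det3_smul_mid]
  ring

lemma side_self (X Y : Fin 2 → Frame) (r : ℝ) (i : Fin 2) (s : ℝ) (j : Fin 2) (t : ℝ) :
    side X Y r i s i s j t = 0 := by
  simp [side_same]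

/-- The unit tangent vector orthogonal to the direction at angle `π * u`. -/
def Frame.normalDir (F : Frame) (u : ℝ) : E3 :=
  (-Real.sin (Real.pi * u)) • F.e + Real.cos (Real.pi * u) • F.f

lemma Frame.norm_normalDir (F : Frame) (u : ℝ) : ‖F.normalDir u‖ ≤ 2 := by
  refine (norm_add_le _ _).trans ?_
  rw [norm_smul, norm_smul, F.norm_e, F.norm_f]
  have := Real.abs_cos_le_one (Real.pi * u)
  have := Real.abs_sin_le_one (Real.pi * u)
  simp only [Real.norm_eq_abs, abs_neg]; linarith

/-- The factor vanishing when the two points coincide does not involve the radius, so it cancels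
when signs at two radii are compared. -/
lemma side_same_eq_mul (X Y : Fin 2 → Frame) (r : ℝ) (i : Fin 2) (s s' : ℝ) (j : Fin 2) (t : ℝ) :
    side X Y r i s i s' j t = 2 * Real.sin (Real.pi * (s' - s)) *
      det3 ((X i).pt r s) ((X i).normalDir (s' + s)) ((Y j).pt r t) := by
  rw [side_same, Real.cos_sub_cos, Real.sin_sub_sin, Frame.normalDir, det3_add_mid,
    det3_smul_mid, det3_smul_mid,
    show (2 * Real.pi * s' + 2 * Real.pi * s) / 2 = Real.pi * (s' + s) by ring,
    show (2 * Real.pi * s' - 2 * Real.pi * s) / 2 = Real.pi * (s' - s) by ring]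
  ring

/-- The points of the circles of radius `r` are close to the centres. -/
lemma abs_det3_pt_sub_le (F G : Frame) {r : ℝ} (hr : 0 ≤ r) (s t : ℝ) {m : E3} (hm : ‖m‖ ≤ 2) :
    |det3 (F.pt r s) m (G.pt r t) - det3 F.c m G.c| ≤ 200 * r := by
  have e : det3 (F.pt r s) m (G.pt r t) - det3 F.c m G.c =
      det3 (F.pt r s - F.c) m (G.pt r t) + det3 F.c m (G.pt r t - G.c) := by
    rw [det3_sub_left, det3_sub_right]; ring
  rw [e]
  refine (abs_add_le _ _).trans ?_
  have h1 : ‖F.pt r s - F.c‖ * ‖m‖ * ‖G.pt r t‖ ≤ (3 * r) * 2 * 3 := by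
    gcongr
    exacts [F.norm_pt_sub hr s, G.norm_pt r t]
  have h2 : ‖F.c‖ * ‖m‖ * ‖G.pt r t - G.c‖ ≤ 1 * 2 * (3 * r) := by
    gcongr
    exacts [F.norm_c.le, G.norm_pt_sub hr t]
  linarith [abs_det3_le (F.pt r s - F.c) m (G.pt r t), abs_det3_le F.c m (G.pt r t - G.c)]

lemma abs_det3_pt_pt_sub_le (F F' G : Frame) {r : ℝ} (hr : 0 ≤ r) (s s' t : ℝ) :
    |det3 (F.pt r s) (F'.pt r s') (G.pt r t) - det3 F.c F'.c G.c| ≤ 400 * r := by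
  have e : det3 (F.pt r s) (F'.pt r s') (G.pt r t) - det3 F.c F'.c G.c =
      det3 (F.pt r s) (F'.pt r s' - F'.c) (G.pt r t) +
        (det3 (F.pt r s) F'.c (G.pt r t) - det3 F.c F'.c G.c) := by
    rw [det3_sub_mid]; ring
  rw [e]
  refine (abs_add_le _ _).trans ?_
  have h1 : ‖F.pt r s‖ * ‖F'.pt r s' - F'.c‖ * ‖G.pt r t‖ ≤ 3 * (3 * r) * 3 := by
    gcongr
    exacts [F.norm_pt r s, F'.norm_pt_sub hr s', G.norm_pt r t]
  have h2 := abs_det3_pt_sub_le F G hr s t (m := F'.c) (by rw [F'.norm_c]; norm_num)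
  linarith [abs_det3_le (F.pt r s) (F'.pt r s' - F'.c) (G.pt r t)]

/-- The centres of the frames are in general position, quantitatively. -/
structure Nondegenerate (X Y : Fin 2 → Frame) (m : ℝ) : Prop where
  pos : 0 < m
  le_det3 : ∀ i i' j, i ≠ i' → m ≤ |det3 (X i).c (X i').c (Y j).c|
  le_tangent : ∀ i j, m ≤
    √(det3 (X i).c (X i).e (Y j).c ^ 2 + det3 (X i).c (X i).f (Y j).c ^ 2)

lemma sign_eq_of_abs_sub_lt {x y : ℝ} (h : |x - y| < |y|) : SignType.sign x = SignType.sign y := by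
  rcases lt_trichotomy y 0 with hy | rfl | hy
  · rw [abs_of_neg hy, abs_lt] at h
    rw [sign_neg hy, sign_neg (by linarith)]
  · simp at h
    exact absurd h (not_lt.2 (abs_nonneg x))
  · rw [abs_of_pos hy, abs_lt] at h
    rw [sign_pos hy, sign_pos (by linarith)]

/-! ### Stability of a single sign under a change of radius -/

section Estimates

variable {X Y : Fin 2 → Frame} {m ρ : ℝ}

lemma side_zero_of_ne {i i' : Fin 2} (h : i ≠ i') (s s' : ℝ) (j : Fin 2) (t : ℝ) :
    side X Y 0 i s i' s' j t = det3 (X i).c (X i').c (Y j).c := by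
  simp [side, h, Frame.pt_zero]

/-- For distinct circles the determinant stays within `400 ρ` of its value at the centres, whose
absolute value is at least `m`. -/
lemma sign_side_of_ne (hN : Nondegenerate X Y m) (h0 : 0 ≤ ρ) (h1 : 1000 * ρ < m)
    {i i' : Fin 2} (h : i ≠ i') (s s' : ℝ) (j : Fin 2) (t : ℝ) :
    SignType.sign (side X Y ρ i s i' s' j t) = SignType.sign (side X Y 0 i s i' s' j t) := by
  rw [side_zero_of_ne h]
  apply sign_eq_of_abs_sub_lt
  have h2 := abs_det3_pt_pt_sub_le (X i) (X i') (Y j) h0 s s' t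
  rw [side, if_neg h]
  linarith [hN.le_det3 i i' j h]

lemma side_zero_ne_zero_of_ne (hN : Nondegenerate X Y m)
    {i i' : Fin 2} (h : i ≠ i') (s s' : ℝ) (j : Fin 2) (t : ℝ) :
    side X Y 0 i s i' s' j t ≠ 0 := by
  rw [side_zero_of_ne h, ← abs_pos]
  exact hN.pos.trans_le (hN.le_det3 i i' j h)

/-- On one circle the determinant is a trigonometric polynomial of degree one in the last angle, and
its leading coefficients cannot both vanish when the radius is small. On distinct circles it never
vanishes. -/
lemma turn_side_eq_zero (hN : Nondegenerate X Y m) (h0 : 0 ≤ ρ) (h1 : 1000 * ρ < m)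
    (i : Fin 2) (s : ℝ) (i' j : Fin 2) (t : ℝ) :
    turn {x | side X Y ρ i s i' x j t = 0} = 0 := by
  by_cases h : i = i'
  · subst h
    set B := det3 ((X i).pt ρ s) (X i).e ((Y j).pt ρ t) with hB
    set C := det3 ((X i).pt ρ s) (X i).f ((Y j).pt ρ t) with hC
    have hR : 0 < √(B ^ 2 + C ^ 2) := by
      have hB' := abs_det3_pt_sub_le (X i) (Y j) h0 s t (m := (X i).e)
        (by rw [(X i).norm_e]; norm_num)
      have hC' := abs_det3_pt_sub_le (X i) (Y j) h0 s t (m := (X i).f)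
        (by rw [(X i).norm_f]; norm_num)
      rw [Real.sqrt_pos]
      by_contra hcon
      have hB0 : B = 0 := by nlinarith [sq_nonneg B, sq_nonneg C]
      have hC0 : C = 0 := by nlinarith [sq_nonneg B, sq_nonneg C]
      rw [← hB, hB0, zero_sub, abs_neg] at hB'
      rw [← hC, hC0, zero_sub, abs_neg] at hC'
      have h2 := hN.le_tangent i j
      -- If both coefficients vanished, those at the centres would be at most `200 ρ` each,
      -- contradicting the lower bound `m > 1000 ρ` on their norm.
      have h3 : √(det3 (X i).c (X i).e (Y j).c ^ 2 + det3 (X i).c (X i).f (Y j).c ^ 2) ≤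
          400 * ρ := by
        apply Real.sqrt_le_iff.2 ⟨by positivity, ?_⟩
        have a := sq_le_sq' (neg_le_of_abs_le hB') (le_of_abs_le hB')
        have b := sq_le_sq' (neg_le_of_abs_le hC') (le_of_abs_le hC')
        nlinarith [sq_nonneg ρ]
      linarith
    have := turn_trig_eq_zero hR
      (-(B * Real.cos (2 * Real.pi * s) + C * Real.sin (2 * Real.pi * s)))
    rw [← this]
    congr 1
    ext x
    rw [Set.mem_ofPred_eq, Set.mem_ofPred_eq, side_same, ← hB, ← hC]
    constructor <;> intro h <;> linarith
  · have : {x | side X Y ρ i s i' x j t = 0} = ∅ := by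
      ext x
      simp only [Set.mem_ofPred_eq, Set.mem_empty_iff_false, iff_false]
      rw [← sign_eq_zero_iff, sign_side_of_ne hN h0 h1 h, sign_eq_zero_iff]
      exact side_zero_ne_zero_of_ne hN h _ _ _ _
    rw [this, measure_empty]

/-- A sign can change only where the determinant at radius zero, `R * cos` of half the angle plus a
phase, is at most the perturbation `200 ρ`. This is the source of the linear error term. -/
lemma turn_sign_side_ne (hN : Nondegenerate X Y m) (h0 : 0 ≤ ρ) (h1 : 1000 * ρ < m)
    (i : Fin 2) (s : ℝ) (i' j : Fin 2) (t : ℝ) :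
    turn {x | SignType.sign (side X Y ρ i s i' x j t) ≠ SignType.sign (side X Y 0 i s i' x j t)} ≤
      ENNReal.ofReal (400 / m * ρ) := by
  rcases h0.eq_or_lt with rfl | hρ
  · simp
  by_cases h : i = i'
  · subst h
    obtain ⟨R, φ, hR, hC, hB⟩ := exists_polar (det3 (X i).c (X i).f (Y j).c)
      (det3 (X i).c (X i).e (Y j).c)
    have hR' : m ≤ R := by
      rw [hR, add_comm]; exact hN.le_tangent i j
    have hm := hN.pos
    have hRpos : 0 < R := hm.trans_le hR'
    refine (measure_mono fun x hx => ?_).trans ((turn_abs_cos_le (ε := 200 * ρ / R)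
      (by positivity) (Real.pi * s + φ)).trans (ENNReal.ofReal_le_ofReal ?_))
    · simp only [Set.mem_ofPred_eq] at hx ⊢
      by_contra hcon
      push Not at hcon
      apply hx
      rw [side_same_eq_mul, side_same_eq_mul, sign_mul, sign_mul (2 * _)]
      congr 1
      rw [Frame.pt_zero, Frame.pt_zero]
      apply sign_eq_of_abs_sub_lt
      refine (abs_det3_pt_sub_le _ _ h0 _ _ ((X i).norm_normalDir _)).trans_lt ?_
      have e : det3 (X i).c ((X i).normalDir (x + s)) (Y j).c =
          R * Real.cos (Real.pi * x + (Real.pi * s + φ)) := by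
        rw [Frame.normalDir, det3_add_mid, det3_smul_mid, det3_smul_mid, hC, hB, ← add_assoc,
          Real.cos_add (_ + _), mul_add]
        ring
      rw [e, abs_mul, abs_of_pos hRpos]
      rwa [div_lt_iff₀' hRpos] at hcon
    · have : 2 * (200 * ρ / R) = 400 * ρ / R := by ring
      rw [this, div_mul_eq_mul_div]
      gcongr
  · have : {x | SignType.sign (side X Y ρ i s i' x j t) ≠
        SignType.sign (side X Y 0 i s i' x j t)} = ∅ := by
      ext x
      simp [sign_side_of_ne hN h0 h1 h]
    rw [this, measure_empty]
    exact zero_le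

end Estimates

/-! ### Joint continuity and measurability of the signs -/

lemma continuous_side (X Y : Fin 2 → Frame) (i i' j : Fin 2) :
    Continuous fun p : ℝ × ℝ × ℝ × ℝ => side X Y p.1 i p.2.1 i' p.2.2.1 j p.2.2.2 := by
  have h1 : Continuous fun p : ℝ × ℝ × ℝ × ℝ => (X i).pt p.1 p.2.1 :=
    (X i).continuous_pt.comp (f := fun p : ℝ × ℝ × ℝ × ℝ => (p.1, p.2.1)) (by fun_prop)
  have h2 : Continuous fun p : ℝ × ℝ × ℝ × ℝ => (X i').pt p.1 p.2.2.1 :=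
    (X i').continuous_pt.comp (f := fun p : ℝ × ℝ × ℝ × ℝ => (p.1, p.2.2.1)) (by fun_prop)
  have h3 : Continuous fun p : ℝ × ℝ × ℝ × ℝ => (Y j).pt p.1 p.2.2.2 :=
    (Y j).continuous_pt.comp (f := fun p : ℝ × ℝ × ℝ × ℝ => (p.1, p.2.2.2)) (by fun_prop)
  have h4 : Continuous fun p : ℝ × ℝ × ℝ × ℝ => (X i).dir p.2.2.1 - (X i).dir p.2.1 :=
    ((X i).continuous_dir.comp (by fun_prop : Continuous fun p : ℝ × ℝ × ℝ × ℝ => p.2.2.1)).sub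
      ((X i).continuous_dir.comp (by fun_prop : Continuous fun p : ℝ × ℝ × ℝ × ℝ => p.2.1))
  unfold side
  split_ifs
  · exact continuous_det3.comp (h1.prodMk (h4.prodMk h3))
  · exact continuous_det3.comp (h1.prodMk (h2.prodMk h3))

/-- The discrete measurable structure on signs. -/
instance : MeasurableSpace SignType := ⊤

instance : DiscreteMeasurableSpace SignType := ⟨fun _ => trivial⟩

instance : MeasurableSingletonClass (Fin 3 → Fin 3 → Fin 3 → SignType) :=
  Pi.instMeasurableSingletonClass

lemma measurable_sign : Measurable (SignType.sign : ℝ → SignType) := by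
  refine measurable_to_countable' fun s => ?_
  rcases s with _ | _ | _
  · convert measurableSet_singleton (0 : ℝ) using 1
    ext x; exact sign_eq_zero_iff
  · convert measurableSet_Iio (a := (0 : ℝ)) using 1
    ext x; exact sign_eq_neg_one_iff
  · convert measurableSet_Ioi (a := (0 : ℝ)) using 1
    ext x; exact sign_eq_one_iff

/-- The parameters of three edges. -/
abbrev Params : Type := (Fin 3 → ℝ) × (Fin 3 → ℝ)

/-- The distribution of six independent uniform angles. -/
abbrev params : Measure Params := turns.prod turns

lemma continuous_side_params (X Y : Fin 2 → Frame) (I J : Fin 3 → Fin 2) (k l m : Fin 3) :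
    Continuous fun p : ℝ × Params =>
      side X Y p.1 (I k) (p.2.1 k) (I l) (p.2.1 l) (J m) (p.2.2 m) :=
  (continuous_side X Y (I k) (I l) (J m)).comp
    (f := fun p : ℝ × Params => (p.1, p.2.1 k, p.2.1 l, p.2.2 m)) (by fun_prop)

lemma measurable_sideSigns (X Y : Fin 2 → Frame) (r : ℝ) (I J : Fin 3 → Fin 2) :
    Measurable fun ω : Params => sideSigns X Y r I J ω.1 ω.2 := by
  refine measurable_pi_lambda _ fun k => measurable_pi_lambda _ fun l =>
    measurable_pi_lambda _ fun m => ?_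
  exact measurable_sign.comp (((continuous_side_params X Y I J k l m).comp
    (f := fun ω : Params => (r, ω)) (by fun_prop)).measurable)

/-- The indicator of the event that three edges with given nodes cross pairwise. -/
def crossWeight (X Y : Fin 2 → Frame) (I J : Fin 3 → Fin 2) (ε η : Fin 3 → Bool) (r : ℝ)
    (a b : Fin 3 → ℝ) : ℝ :=
  if AllCross ε η (sideSigns X Y r I J a b) (sideSigns Y X r J I b a) then 1 else 0

lemma abs_crossWeight_le (X Y : Fin 2 → Frame) (I J : Fin 3 → Fin 2) (ε η : Fin 3 → Bool) (r : ℝ)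
    (a b : Fin 3 → ℝ) : |crossWeight X Y I J ε η r a b| ≤ 1 := by
  unfold crossWeight; split_ifs <;> simp

lemma measurable_crossWeight (X Y : Fin 2 → Frame) (I J : Fin 3 → Fin 2) (ε η : Fin 3 → Bool)
    (r : ℝ) : Measurable fun ω : Params => crossWeight X Y I J ε η r ω.1 ω.2 :=
  (measurable_of_countable fun p : (Fin 3 → Fin 3 → Fin 3 → SignType) ×
    (Fin 3 → Fin 3 → Fin 3 → SignType) => if AllCross ε η p.1 p.2 then (1 : ℝ) else 0).comp
    ((measurable_sideSigns X Y r I J).prodMk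
      ((measurable_sideSigns Y X r J I).comp measurable_swap))

lemma integrable_crossWeight (X Y : Fin 2 → Frame) (I J : Fin 3 → Fin 2) (ε η : Fin 3 → Bool)
    (r : ℝ) : Integrable (fun ω : Params => crossWeight X Y I J ε η r ω.1 ω.2) params :=
  Integrable.of_bound (measurable_crossWeight X Y I J ε η r).aestronglyMeasurable 1
    (Eventually.of_forall fun _ => abs_crossWeight_le _ _ _ _ _ _ _ _ _)

/-! ### Exceptional sets for triples of edges -/

section Params

variable {X Y : Fin 2 → Frame} {m ρ : ℝ}

lemma ae_side_ne_zero (hN : Nondegenerate X Y m) (h0 : 0 ≤ ρ) (h1 : 1000 * ρ < m)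
    (I J : Fin 3 → Fin 2) {k l : Fin 3} (hkl : k ≠ l) (n : Fin 3) :
    ∀ᵐ ω ∂params, side X Y ρ (I k) (ω.1 k) (I l) (ω.1 l) (J n) (ω.2 n) ≠ 0 := by
  rw [ae_iff]
  simp only [not_not]
  refine le_antisymm (prod_le_of_slices_fst ?_ l fun a b => ?_) zero_le
  · exact (measurableSet_singleton (0 : ℝ)).preimage ((continuous_side_params X Y I J k l n).comp
      (f := fun ω : Params => (ρ, ω)) (by fun_prop)).measurable
  · have := turn_side_eq_zero hN h0 h1 (I k) (a k) (I l) (J n) (b n)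
    simpa [Function.update_of_ne hkl] using this.le

lemma ae_side_ne_zero' (hN : Nondegenerate X Y m) (h0 : 0 ≤ ρ) (h1 : 1000 * ρ < m)
    (I J : Fin 3 → Fin 2) {k l : Fin 3} (hkl : k ≠ l) (n : Fin 3) :
    ∀ᵐ ω ∂params, side X Y ρ (I k) (ω.2 k) (I l) (ω.2 l) (J n) (ω.1 n) ≠ 0 := by
  have h := (Measure.measurePreserving_swap (μ := turns) (ν := turns)).quasiMeasurePreserving.ae
    (ae_side_ne_zero hN h0 h1 I J hkl n)
  simpa using h

lemma measurableSet_sideSigns_ne (X Y : Fin 2 → Frame) (ρ : ℝ) (I J : Fin 3 → Fin 2)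
    (k l n : Fin 3) :
    MeasurableSet {ω : Params | sideSigns X Y ρ I J ω.1 ω.2 k l n ≠
      sideSigns X Y 0 I J ω.1 ω.2 k l n} := by
  have h : ∀ r, Measurable fun ω : Params => sideSigns X Y r I J ω.1 ω.2 k l n := fun r =>
    (measurable_pi_apply n).comp ((measurable_pi_apply l).comp ((measurable_pi_apply k).comp
      (measurable_sideSigns X Y r I J)))
  exact (measurableSet_eq_fun (h ρ) (h 0)).compl

lemma params_sideSigns_ne_le (hN : Nondegenerate X Y m) (h0 : 0 ≤ ρ) (h1 : 1000 * ρ < m)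
    (I J : Fin 3 → Fin 2) (k l n : Fin 3) :
    params {ω | sideSigns X Y ρ I J ω.1 ω.2 k l n ≠ sideSigns X Y 0 I J ω.1 ω.2 k l n} ≤
      ENNReal.ofReal (400 / m * ρ) := by
  by_cases hkl : k = l
  · subst hkl
    simp [sideSigns, side_self]
  refine prod_le_of_slices_fst (measurableSet_sideSigns_ne X Y ρ I J k l n) l fun a b => ?_
  have := turn_sign_side_ne hN h0 h1 (I k) (a k) (I l) (J n) (b n)
  simpa [sideSigns, Function.update_of_ne hkl] using this

lemma params_sideSigns_ne_le' (hN : Nondegenerate X Y m) (h0 : 0 ≤ ρ) (h1 : 1000 * ρ < m)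
    (I J : Fin 3 → Fin 2) (k l n : Fin 3) :
    params {ω | sideSigns X Y ρ I J ω.2 ω.1 k l n ≠ sideSigns X Y 0 I J ω.2 ω.1 k l n} ≤
      ENNReal.ofReal (400 / m * ρ) := by
  have h := (Measure.measurePreserving_swap (μ := turns) (ν := turns)).measure_preimage
    (measurableSet_sideSigns_ne X Y ρ I J k l n).nullMeasurableSet
  exact h.trans_le (params_sideSigns_ne_le hN h0 h1 I J k l n)

/-- Almost surely no relevant determinant vanishes, and a continuous function has constant sign near
a point where it is nonzero. The radius is one of the variables, which handles radii that merely
converge to `ρ`. -/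
lemma crossWeight_locally_constant (hX : Nondegenerate X Y m) (hY : Nondegenerate Y X m)
    (h0 : 0 ≤ ρ) (h1 : 1000 * ρ < m) (I J : Fin 3 → Fin 2) (ε η : Fin 3 → Bool) :
    ∀ᵐ ω ∂params, ∀ᶠ p in 𝓝 (ρ, ω.1, ω.2),
      crossWeight X Y I J ε η p.1 p.2.1 p.2.2 = crossWeight X Y I J ε η ρ ω.1 ω.2 := by
  have hA : ∀ᵐ ω ∂params, ∀ k l n : Fin 3, k ≠ l →
      side X Y ρ (I k) (ω.1 k) (I l) (ω.1 l) (J n) (ω.2 n) ≠ 0 := by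
    simp only [ae_all_iff]
    exact fun k l n h => ae_side_ne_zero hX h0 h1 I J h n
  have hB : ∀ᵐ ω ∂params, ∀ k l n : Fin 3, k ≠ l →
      side Y X ρ (J k) (ω.2 k) (J l) (ω.2 l) (I n) (ω.1 n) ≠ 0 := by
    simp only [ae_all_iff]
    exact fun k l n h => ae_side_ne_zero' hY h0 h1 J I h n
  filter_upwards [hA, hB] with ω h2 h3
  have key : ∀ {f : ℝ × Params → ℝ}, Continuous f → f (ρ, ω) ≠ 0 →
      ∀ᶠ p in 𝓝 (ρ, ω), SignType.sign (f p) = SignType.sign (f (ρ, ω)) := by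
    intro f hf hne
    rcases lt_or_gt_of_ne hne with h | h
    · filter_upwards [hf.continuousAt.eventually_lt continuousAt_const h] with p hp
      rw [sign_neg hp, sign_neg h]
    · filter_upwards [continuousAt_const.eventually_lt hf.continuousAt h] with p hp
      rw [sign_pos hp, sign_pos h]
  have e1 : ∀ᶠ p in 𝓝 (ρ, ω), ∀ k l n : Fin 3, sideSigns X Y p.1 I J p.2.1 p.2.2 k l n =
      sideSigns X Y ρ I J ω.1 ω.2 k l n := by
    simp only [eventually_all]
    intro k l n
    -- With a repeated index the quantity is identically zero, so its sign is constant without any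
    -- nonvanishing.
    by_cases h : k = l
    · subst h
      simp [sideSigns, side_self]
    · exact key (continuous_side_params X Y I J k l n) (h2 k l n h)
  have e2 : ∀ᶠ p in 𝓝 (ρ, ω), ∀ k l n : Fin 3, sideSigns Y X p.1 J I p.2.2 p.2.1 k l n =
      sideSigns Y X ρ J I ω.2 ω.1 k l n := by
    simp only [eventually_all]
    intro k l n
    by_cases h : k = l
    · subst h
      simp [sideSigns, side_self]
    · exact key (f := fun p => side Y X p.1 (J k) (p.2.2 k) (J l) (p.2.2 l) (I n) (p.2.1 n))
        ((continuous_side_params Y X J I k l n).comp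
          (f := fun p : ℝ × Params => (p.1, p.2.swap)) (by fun_prop)) (h3 k l n h)
  filter_upwards [e1, e2] with p hp1 hp2
  have hp1' : sideSigns X Y p.1 I J p.2.1 p.2.2 = sideSigns X Y ρ I J ω.1 ω.2 := by
    funext k l n; exact hp1 k l n
  have hp2' : sideSigns Y X p.1 J I p.2.2 p.2.1 = sideSigns Y X ρ J I ω.2 ω.1 := by
    funext k l n; exact hp2 k l n
  rw [crossWeight, crossWeight, hp1', hp2']

lemma abs_integral_crossWeight_sub_le (hX : Nondegenerate X Y m) (hY : Nondegenerate Y X m)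
    (h0 : 0 ≤ ρ) (h1 : 1000 * ρ < m) (I J : Fin 3 → Fin 2) (ε η : Fin 3 → Bool) :
    |∫ ω, crossWeight X Y I J ε η ρ ω.1 ω.2 ∂params -
      ∫ ω, crossWeight X Y I J ε η 0 ω.1 ω.2 ∂params| ≤ 54 * (400 / m * ρ) := by
  set S : Set Params :=
    (⋃ k, ⋃ l, ⋃ n, {ω | sideSigns X Y ρ I J ω.1 ω.2 k l n ≠ sideSigns X Y 0 I J ω.1 ω.2 k l n}) ∪
    (⋃ k, ⋃ l, ⋃ n, {ω | sideSigns Y X ρ J I ω.2 ω.1 k l n ≠ sideSigns Y X 0 J I ω.2 ω.1 k l n})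
    with hS
  have hm := hX.pos
  have hmS : MeasurableSet S := by
    refine (MeasurableSet.iUnion fun k => .iUnion fun l => .iUnion fun n => ?_).union
      (MeasurableSet.iUnion fun k => .iUnion fun l => .iUnion fun n => ?_)
    · exact measurableSet_sideSigns_ne X Y ρ I J k l n
    · exact measurable_swap (measurableSet_sideSigns_ne Y X ρ J I k l n)
  -- A union bound: 27 index triples for each of the two families of signs.
  have hle : params S ≤ ENNReal.ofReal (54 * (400 / m * ρ)) := by
    have hu : ∀ T : Fin 3 → Fin 3 → Fin 3 → Set Params,
        (∀ k l n, params (T k l n) ≤ ENNReal.ofReal (400 / m * ρ)) →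
        params (⋃ k, ⋃ l, ⋃ n, T k l n) ≤ 27 * ENNReal.ofReal (400 / m * ρ) := by
      intro T hT
      calc params (⋃ k, ⋃ l, ⋃ n, T k l n) ≤ ∑ k, ∑ l, ∑ n, params (T k l n) :=
            (measure_iUnion_fintype_le _ _).trans (Finset.sum_le_sum fun k _ =>
              (measure_iUnion_fintype_le _ _).trans (Finset.sum_le_sum fun l _ =>
                measure_iUnion_fintype_le _ _))
        _ ≤ ∑ _k : Fin 3, ∑ _l : Fin 3, ∑ _n : Fin 3, ENNReal.ofReal (400 / m * ρ) :=
            Finset.sum_le_sum fun k _ => Finset.sum_le_sum fun l _ =>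
              Finset.sum_le_sum fun n _ => hT k l n
        _ = 27 * ENNReal.ofReal (400 / m * ρ) := by
            simp only [Finset.sum_const, Finset.card_univ, Fintype.card_fin, nsmul_eq_mul]
            rw [← mul_assoc, ← mul_assoc]; norm_num
    refine (measure_union_le _ _).trans ((add_le_add
      (hu _ fun k l n => params_sideSigns_ne_le hX h0 h1 I J k l n)
      (hu _ fun k l n => params_sideSigns_ne_le' hY h0 h1 J I k l n)).trans ?_)
    rw [ENNReal.ofReal_mul (p := 54) (by norm_num), ← add_mul]
    norm_num
  rw [← integral_sub (integrable_crossWeight _ _ _ _ _ _ _) (integrable_crossWeight _ _ _ _ _ _ _)]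
  refine abs_integral_le_integral_abs.trans ?_
  calc ∫ ω : Params, |crossWeight X Y I J ε η ρ ω.1 ω.2 - crossWeight X Y I J ε η 0 ω.1 ω.2| ∂params
      ≤ ∫ ω, S.indicator 1 ω ∂params := by
        refine integral_mono ((integrable_crossWeight _ _ _ _ _ _ _).sub
          (integrable_crossWeight _ _ _ _ _ _ _)).abs
          ((integrable_indicator_iff hmS).2 (integrable_const (1 : ℝ)).integrableOn) fun ω => ?_
        by_cases hω : ω ∈ S
        · simp only [Set.indicator_of_mem hω, Pi.one_apply]
          unfold crossWeight
          split_ifs <;> norm_num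
        · simp only [Set.indicator_of_notMem hω]
          simp only [hS, Set.mem_union, Set.mem_iUnion, Set.mem_ofPred_eq, not_or, not_exists,
            not_not] at hω
          have hp1 : sideSigns X Y ρ I J ω.1 ω.2 = sideSigns X Y 0 I J ω.1 ω.2 := by
            funext k l n; exact hω.1 k l n
          have hp2 : sideSigns Y X ρ J I ω.2 ω.1 = sideSigns Y X 0 J I ω.2 ω.1 := by
            funext k l n; exact hω.2 k l n
          rw [crossWeight, crossWeight, hp1, hp2, sub_self, abs_zero]
    _ = params.real S := integral_indicator_one hmS
    _ ≤ 54 * (400 / m * ρ) := ENNReal.toReal_le_of_le_ofReal (by positivity) hle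

end Params

/-! ### The limit of the triangle densities -/

/-- The limit of the triangle densities of blowup drawings whose radii tend to `ρ`. -/
def limitDensity (X Y : Fin 2 → Frame) (ρ : ℝ) : ℝ :=
  1 / 2 ^ 12 * ∑ I : Fin 3 → Fin 2, ∑ J : Fin 3 → Fin 2, ∑ ε : Fin 3 → Bool, ∑ η : Fin 3 → Bool,
    ∫ ω, crossWeight X Y I J ε η ρ ω.1 ω.2 ∂params

variable {X Y : Fin 2 → Frame} {m ρ : ℝ}

lemma tendsto_triangleDensity (hX : Nondegenerate X Y m) (hY : Nondegenerate Y X m)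
    (h0 : 0 ≤ ρ) (h1 : 1000 * ρ < m) (h2 : ρ < Real.pi) {v w : Fin 2 → E3}
    (hv : ∀ i, (X i).c = v i) (hw : ∀ i, (Y i).c = w i) {r : ℕ → ℝ}
    {P Q : (n : ℕ) → Fin 2 × Bool → Fin n → E3} (hr : ∀ n, 1 ≤ n → 0 < r n)
    (hρ : Tendsto r atTop (𝓝 ρ)) (hB : ∀ n, 1 ≤ n → IsBlowup v w (r n) n (P n) (Q n)) :
    Tendsto (fun n => triangleDensity (P n) (Q n)) atTop (𝓝 (limitDensity X Y ρ)) := by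
  -- Offsets are chosen for every `n`; zero is a dummy value where `n = 0` or `r n ≥ π`, which
  -- happens only finitely often since `ρ < π`.
  have hex : ∀ n : ℕ, ∃ ψ χ : Fin 2 × Bool → ℝ,
      (1 ≤ n → ∀ x, 0 ≤ ψ x ∧ ψ x ≤ 1 / n) ∧ (1 ≤ n → ∀ x, 0 ≤ χ x ∧ χ x ≤ 1 / n) ∧
      (1 ≤ n → r n < Real.pi → triangleDensity (P n) (Q n) =
        1 / 2 ^ 12 * ∑ I : Fin 3 → Fin 2, ∑ J : Fin 3 → Fin 2, ∑ ε : Fin 3 → Bool,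
          ∑ η : Fin 3 → Bool, 1 / (n : ℝ) ^ 6 * ∑ κ : Fin 3 → Fin n, ∑ μ : Fin 3 → Fin n,
            crossWeight X Y I J ε η (r n) (fun k => κ k / n + ψ (I k, ε k))
              (fun k => μ k / n + χ (J k, η k))) := by
    intro n
    by_cases h : 1 ≤ n ∧ r n < Real.pi
    · obtain ⟨ψ, χ, a, b, c⟩ := (hB n h.1).triangleDensity_eq hv hw (hr n h.1) h.2 h.1
      exact ⟨ψ, χ, fun _ => a, fun _ => b, fun _ _ => c⟩
    · have hz : ∀ x : Fin 2 × Bool, (0 : ℝ) ≤ (fun _ => 0 : Fin 2 × Bool → ℝ) x ∧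
          (fun _ => 0 : Fin 2 × Bool → ℝ) x ≤ 1 / n := fun x => ⟨le_rfl, by positivity⟩
      exact ⟨fun _ => 0, fun _ => 0, fun _ => hz, fun _ => hz, fun a b => absurd ⟨a, b⟩ h⟩
  choose ψ χ hψ hχ heq using hex
  have hlim : Tendsto (fun n : ℕ => 1 / 2 ^ 12 * ∑ I : Fin 3 → Fin 2, ∑ J : Fin 3 → Fin 2,
      ∑ ε : Fin 3 → Bool, ∑ η : Fin 3 → Bool,
        1 / (n : ℝ) ^ 6 * ∑ κ : Fin 3 → Fin n, ∑ μ : Fin 3 → Fin n,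
          crossWeight X Y I J ε η (r n) (fun k => κ k / n + ψ n (I k, ε k))
              (fun k => μ k / n + χ n (J k, η k))) atTop (𝓝 (limitDensity X Y ρ)) := by
    refine Tendsto.const_mul _ (tendsto_finsetSum _ fun I _ => tendsto_finsetSum _ fun J _ =>
      tendsto_finsetSum _ fun ε _ => tendsto_finsetSum _ fun η _ => ?_)
    exact tendsto_average (F := fun r a b => crossWeight X Y I J ε η r a b)
      (abs_crossWeight_le X Y I J ε η) (crossWeight_locally_constant hX hY h0 h1 I J ε η) hρ
      (ψ := fun n k => ψ n (I k, ε k)) (χ := fun n k => χ n (J k, η k))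
      (fun n hn k => hψ n hn _) (fun n hn k => hχ n hn _)
  refine hlim.congr' ?_
  filter_upwards [eventually_ge_atTop 1, hρ.eventually_lt_const h2] with n hn hn'
  exact (heq n hn hn').symm

/-- The sum has `8 ^ 4 = 2 ^ 12` terms, so the normalising factor cancels and the bound for one term
remains. -/
lemma abs_limitDensity_sub_le (hX : Nondegenerate X Y m) (hY : Nondegenerate Y X m)
    (h0 : 0 ≤ ρ) (h1 : 1000 * ρ < m) :
    |limitDensity X Y ρ - limitDensity X Y 0| ≤ 54 * (400 / m) * ρ := by
  have hb : ∀ {ι : Type} [Fintype ι] {f g : ι → ℝ} {c : ℝ}, (∀ i, |f i - g i| ≤ c) →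
      |∑ i, f i - ∑ i, g i| ≤ Fintype.card ι * c := by
    intro ι _ f g c h
    rw [← Finset.sum_sub_distrib]
    refine (Finset.abs_sum_le_sum_abs _ _).trans ((Finset.sum_le_sum fun i _ => h i).trans ?_)
    simp
  rw [limitDensity, limitDensity, ← mul_sub, abs_mul]
  have key := hb fun I : Fin 3 → Fin 2 => hb fun J : Fin 3 → Fin 2 => hb fun ε : Fin 3 → Bool =>
    hb fun η : Fin 3 → Bool => abs_integral_crossWeight_sub_le hX hY h0 h1 I J ε η
  refine (mul_le_mul_of_nonneg_left key (abs_nonneg _)).trans (le_of_eq ?_)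
  simp
  norm_num
  ring

/-! ### Expectations of signs of differences -/

lemma measurePreserving_comp_perm (π : Equiv.Perm (Fin 3)) :
    MeasurePreserving (fun a : Fin 3 → ℝ => a ∘ π) turns turns := by
  have h := measurePreserving_piCongrLeft (fun _ : Fin 3 => turn) π.symm
  have e : (fun a : Fin 3 → ℝ => a ∘ π) =
      MeasurableEquiv.piCongrLeft (fun _ : Fin 3 => ℝ) π.symm := by
    funext a k
    have := Equiv.piCongrLeft_apply_apply (fun _ : Fin 3 => ℝ) π.symm a (π k)
    rw [Equiv.symm_apply_apply] at this
    exact this.symm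
  rw [e]
  exact h

lemma integral_comp_perm (π : Equiv.Perm (Fin 3)) {f : (Fin 3 → ℝ) → ℝ} (hf : Measurable f) :
    ∫ a, f (a ∘ π) ∂turns = ∫ a, f a ∂turns := by
  have h := measurePreserving_comp_perm π
  conv_rhs => rw [← h.map_eq]
  rw [integral_map h.measurable.aemeasurable hf.aestronglyMeasurable]

/-- Averaging over one coordinate does not change the expectation. -/
lemma integral_update (l : Fin 3) {f : (Fin 3 → ℝ) → ℝ} (hf : Measurable f) {c : ℝ}
    (hc : ∀ a, |f a| ≤ c) {g : (Fin 3 → ℝ) → ℝ} (hg : Measurable g)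
    (h : ∀ a, ∫ x, f (Function.update a l x) ∂turn = g a) :
    ∫ a, f a ∂turns = ∫ a, g a ∂turns := by
  have e := (measurePreserving_piFinSuccAbove (fun _ : Fin 3 => turn) l).symm
  have hb : ∀ a, |g a| ≤ c := fun a => by
    rw [← h a]
    have := norm_integral_le_of_norm_le_const (μ := turn)
      (f := fun x => f (Function.update a l x)) (C := c) (Eventually.of_forall fun x => hc _)
    simpa using this
  have key : ∀ {f : (Fin 3 → ℝ) → ℝ}, Measurable f → (∀ a, |f a| ≤ c) → ∫ a, f a ∂turns =
      ∫ y, ∫ x, f (l.insertNth (α := fun _ => ℝ) x y) ∂turn ∂(Measure.pi fun _ : Fin 2 => turn) := by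
    intro f hf hc
    have hm : Measurable fun p : ℝ × (Fin 2 → ℝ) => f (l.insertNth (α := fun _ => ℝ) p.1 p.2) :=
      hf.comp e.measurable
    rw [turns, ← e.map_eq, integral_map e.measurable.aemeasurable hf.aestronglyMeasurable]
    exact integral_prod_symm _ (Integrable.of_bound hm.aestronglyMeasurable c
      (Eventually.of_forall fun p => hc _))
  rw [key hf hc, key hg hb]
  refine integral_congr_ae (Eventually.of_forall fun y => ?_)
  simp only [← h, Fin.update_insertNth, integral_const, probReal_univ, one_smul]

/-- A continuous function that almost surely separates two independent uniform angles. -/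
structure IsHeight (H : ℝ → ℝ) : Prop where
  continuous : Continuous H
  turn_eq : ∀ s, turn {x | H x = H s} = 0

/-- The sign of the increment of a function of an angle. -/
def incr (H : ℝ → ℝ) (k l : Fin 3) (a : Fin 3 → ℝ) : ℝ := sgn (H (a l) - H (a k))

lemma incr_swap (H : ℝ → ℝ) (k l : Fin 3) (a : Fin 3 → ℝ) : incr H l k a = -incr H k l a := by
  rw [incr, incr, ← sgn_neg, neg_sub]

lemma abs_incr_le (H : ℝ → ℝ) (k l : Fin 3) (a : Fin 3 → ℝ) : |incr H k l a| ≤ 1 := abs_sgn_le _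

section Heights

variable {H H' : ℝ → ℝ} {τ : ℝ}

lemma IsHeight.measurable_incr (hH : IsHeight H) (k l : Fin 3) : Measurable (incr H k l) :=
  measurable_sgn.comp (((hH.continuous.comp (continuous_apply l)).sub
    (hH.continuous.comp (continuous_apply k))).measurable)

lemma IsHeight.ae_ne (hH : IsHeight H) {k l : Fin 3} (hkl : k ≠ l) :
    ∀ᵐ a ∂turns, H (a l) - H (a k) ≠ 0 := by
  rw [ae_iff]
  simp only [not_not]
  refine le_antisymm (turns_le_of_slices ?_ l fun a => ?_) zero_le
  · exact (measurableSet_singleton (0 : ℝ)).preimage ((hH.continuous.comp (continuous_apply l)).sub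
      (hH.continuous.comp (continuous_apply k))).measurable
  · simpa [Function.update_of_ne hkl, sub_eq_zero] using (hH.turn_eq (a k)).le

lemma IsHeight.ae_sq (hH : IsHeight H) {k l : Fin 3} (hkl : k ≠ l) :
    ∀ᵐ a ∂turns, incr H k l a ^ 2 = 1 := by
  filter_upwards [hH.ae_ne hkl] with a ha using sgn_sq ha

lemma IsHeight.integrable_incr (hH : IsHeight H) (k l : Fin 3) : Integrable (incr H k l) turns :=
  Integrable.of_bound (hH.measurable_incr k l).aestronglyMeasurable 1
    (Eventually.of_forall fun a => abs_incr_le H k l a)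

lemma IsHeight.integrable_incr_mul (hH : IsHeight H) (hH' : IsHeight H') (k l k' l' : Fin 3) :
    Integrable (fun a => incr H k l a * incr H' k' l' a) turns :=
  (hH.integrable_incr k l).mul_bdd (c := 1) (hH'.measurable_incr k' l').aestronglyMeasurable
    (Eventually.of_forall fun a => abs_incr_le H' k' l' a)

/-- Exchanging the two angles preserves their distribution and reverses the sign. -/
lemma IsHeight.integral_incr (hH : IsHeight H) {k l : Fin 3} : ∫ a, incr H k l a ∂turns = 0 := by
  have h := integral_comp_perm (Equiv.swap k l) (hH.measurable_incr k l)
  have e : ∀ a : Fin 3 → ℝ, incr H k l (a ∘ Equiv.swap k l) = -incr H k l a := fun a => by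
    rw [← incr_swap]; simp [incr]
  simp only [e, integral_neg] at h
  linarith

lemma integral_add₃ {α : Type*} [MeasurableSpace α] {ν : Measure α} {f g h : α → ℝ}
    (hf : Integrable f ν) (hg : Integrable g ν) (hh : Integrable h ν) :
    ∫ a, (f a + g a + h a) ∂ν = ∫ a, f a ∂ν + ∫ a, g a ∂ν + ∫ a, h a ∂ν := by
  rw [integral_add (f := fun a => f a + g a) (hf.add hg) hh, integral_add hf hg]

/-- The product at a point is `-1` exactly if that point has the middle height. So the three
products almost surely sum to `1`, and by exchangeability they have equal expectations. -/
lemma IsHeight.integral_incr_mul_incr (hH : IsHeight H) :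
    ∫ a, incr H 0 1 a * incr H 0 2 a ∂turns = 1 / 3 ∧
    ∫ a, incr H 1 0 a * incr H 1 2 a ∂turns = 1 / 3 ∧
    ∫ a, incr H 2 0 a * incr H 2 1 a ∂turns = 1 / 3 := by
  have hm : Measurable fun a => incr H 0 1 a * incr H 0 2 a :=
    (hH.measurable_incr 0 1).mul (hH.measurable_incr 0 2)
  have h1 := integral_comp_perm (Equiv.swap 0 1) hm
  have h2 := integral_comp_perm (Equiv.swap 0 2) hm
  have e1 : ∀ a : Fin 3 → ℝ, incr H 0 1 (a ∘ Equiv.swap 0 1) * incr H 0 2 (a ∘ Equiv.swap 0 1) =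
      incr H 1 0 a * incr H 1 2 a := fun a => by
    simp [incr, Equiv.swap_apply_of_ne_of_ne]
  have e2 : ∀ a : Fin 3 → ℝ, incr H 0 1 (a ∘ Equiv.swap 0 2) * incr H 0 2 (a ∘ Equiv.swap 0 2) =
      incr H 2 0 a * incr H 2 1 a := fun a => by
    simp [incr, Equiv.swap_apply_of_ne_of_ne, mul_comm]
  simp only [e1] at h1
  simp only [e2] at h2
  have h3 : ∫ a, (incr H 0 1 a * incr H 0 2 a + incr H 1 0 a * incr H 1 2 a +
      incr H 2 0 a * incr H 2 1 a) ∂turns = ∫ _, 1 ∂turns := by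
    refine integral_congr_ae ?_
    filter_upwards [hH.ae_ne (show (0 : Fin 3) ≠ 1 by decide),
      hH.ae_ne (show (0 : Fin 3) ≠ 2 by decide), hH.ae_ne (show (1 : Fin 3) ≠ 2 by decide)]
      with a n01 n02 n12
    simp only [incr_swap H 0 1, incr_swap H 0 2, incr_swap H 1 2]
    simp only [incr]
    generalize H (a 0) = x at *
    generalize H (a 1) = y at *
    generalize H (a 2) = z at *
    rcases lt_or_gt_of_ne n01 with p | p <;> rcases lt_or_gt_of_ne n02 with q | q <;>
      rcases lt_or_gt_of_ne n12 with s | s <;>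
      first
        | (exfalso; linarith)
        | (simp only [sgn_of_neg, sgn_of_pos, p, q, s]; norm_num)
  rw [integral_add₃ (hH.integrable_incr_mul hH _ _ _ _) (hH.integrable_incr_mul hH _ _ _ _)
    (hH.integrable_incr_mul hH _ _ _ _), h1, h2] at h3
  simp at h3
  refine ⟨by linarith, by linarith, by linarith⟩

/-- Two heights whose increments along a random chord from a fixed point have the same sign with a
probability `(1 + τ) / 2` that does not depend on the point. -/
structure HasCorrelation (H H' : ℝ → ℝ) (τ : ℝ) : Prop where
  left : IsHeight H
  right : IsHeight H'
  integral : ∀ s, ∫ x, sgn (H x - H s) * sgn (H' x - H' s) ∂turn = τ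

lemma abs_incr_mul_incr_le (H H' : ℝ → ℝ) (k l k' l' : Fin 3) (a : Fin 3 → ℝ) :
    |incr H k l a * incr H' k' l' a| ≤ 1 := by
  rw [abs_mul]
  exact mul_le_one₀ (abs_incr_le H k l a) (abs_nonneg _) (abs_incr_le H' k' l' a)

lemma HasCorrelation.integral_incr (h : HasCorrelation H H' τ) {k l : Fin 3} (hkl : k ≠ l) :
    ∫ a, incr H k l a * incr H' k l a ∂turns = τ := by
  rw [integral_update l (f := fun a => incr H k l a * incr H' k l a) ((h.left.measurable_incr k l).mul (h.right.measurable_incr k l))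
    (abs_incr_mul_incr_le H H' k l k l) (measurable_const (a := τ))]
  · simp
  · intro a
    simpa [incr, Function.update_of_ne hkl] using h.integral (a k)

/-- Given the common endpoint, the two chords are independent, and the conditional expectation of
each factor is the constant `τ`. It is here that independence of the starting point is essential. -/
lemma HasCorrelation.integral_incr_mul (h : HasCorrelation H H' τ) :
    ∫ a, (incr H 0 2 a * incr H' 0 2 a) * (incr H 1 2 a * incr H' 1 2 a) ∂turns = τ ^ 2 := by
  have m1 : Measurable fun a => incr H 0 2 a * incr H' 0 2 a :=
    (h.left.measurable_incr 0 2).mul (h.right.measurable_incr 0 2)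
  have m2 : Measurable fun a => incr H 1 2 a * incr H' 1 2 a :=
    (h.left.measurable_incr 1 2).mul (h.right.measurable_incr 1 2)
  rw [integral_update 0 (f := fun a => (incr H 0 2 a * incr H' 0 2 a) *
      (incr H 1 2 a * incr H' 1 2 a)) (m1.mul m2) (c := 1) (fun a => ?_) (m2.const_mul τ) fun a => ?_,
    integral_const_mul, h.integral_incr (by decide), sq]
  · rw [abs_mul]
    exact mul_le_one₀ (abs_incr_mul_incr_le _ _ _ _ _ _ _) (abs_nonneg _)
      (abs_incr_mul_incr_le _ _ _ _ _ _ _)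
  · have e : ∀ x, incr H 0 2 (Function.update a 0 x) * incr H' 0 2 (Function.update a 0 x) =
        sgn (H x - H (a 2)) * sgn (H' x - H' (a 2)) := fun x => by
      rw [incr_swap H 2 0, incr_swap H' 2 0]
      simp [incr]
    have e' : ∀ x, incr H 1 2 (Function.update a 0 x) * incr H' 1 2 (Function.update a 0 x) =
        incr H 1 2 a * incr H' 1 2 a := fun x => by
      simp [incr]
    simp only [e, e']
    rw [integral_mul_const, h.integral]

end Heights

/-! ### The number of choices of signs -/

/-- Triples of elements as functions. -/
def tripleEquiv (α : Type*) : (Fin 3 → α) ≃ α × α × α where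
  toFun f := (f 0, f 1, f 2)
  invFun x := ![x.1, x.2.1, x.2.2]
  left_inv f := by ext k; fin_cases k <;> rfl
  right_inv _ := rfl

lemma sum_triples {α M : Type*} [Fintype α] [AddCommMonoid M] (f : (Fin 3 → α) → M) :
    ∑ x, f x = ∑ x, ∑ y, ∑ z, f ![x, y, z] := by
  rw [← (tripleEquiv α).symm.sum_comp]
  simp only [Fintype.sum_prod_type]
  rfl

lemma sum_bool_ite (x b : Bool) (P : Bool → Prop) [DecidablePred P] :
    (∑ y : Bool, if (x == y) = b ∧ P y then 1 else 0) = if P (x == b) then 1 else 0 := by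
  rw [Fintype.sum_bool]
  cases x <;> cases b <;> simp

/-- Over the field with two elements these are nine affine equations in six unknowns. The
homogeneous system has only the simultaneous change of all six, hence two solutions or none.
Consistency is two cycle conditions around the triangle and two compatibility conditions between the
parts. -/
lemma count_bool_solutions (a₀ a₁ a₂ b₀ b₁ b₂ c₀ c₁ c₂ : Bool) :
    (∑ x : Bool, ∑ y : Bool, ∑ z : Bool, ∑ x' : Bool, ∑ y' : Bool, ∑ z' : Bool,
      if ((x == y) = b₀ ∧ (x' == y') = a₀ ∧ (y == y') = c₀) ∧
        ((x == z) = b₁ ∧ (x' == z') = a₁ ∧ (z == z') = c₁) ∧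
        ((y == z) = b₂ ∧ (y' == z') = a₂ ∧ (z == z') = c₂) then 1 else 0) =
    if (a₀ == (a₁ == a₂)) ∧ (b₀ == (b₁ == b₂)) ∧ (c₁ == c₂) ∧ (c₂ == (c₀ == (a₂ == b₂)))
      then 2 else 0 := by
  have e : ∀ x y z x' y' z' : Bool,
      ((x == y) = b₀ ∧ (x' == y') = a₀ ∧ (y == y') = c₀) ∧
        ((x == z) = b₁ ∧ (x' == z') = a₁ ∧ (z == z') = c₁) ∧
        ((y == z) = b₂ ∧ (y' == z') = a₂ ∧ (z == z') = c₂) ↔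
      (x' == z') = a₁ ∧ (x' == y') = a₀ ∧ (x == z) = b₁ ∧ (x == y) = b₀ ∧
        ((y == z) = b₂ ∧ (y' == z') = a₂ ∧ (y == y') = c₀ ∧ (z == z') = c₁ ∧ (z == z') = c₂) := by
    intros; tauto
  simp only [e]
  -- Eliminating `z'` and `y'` by hand keeps the final exhaustive check small.
  have s1 : ∀ x y z x' y' : Bool, (∑ z' : Bool, if (x' == z') = a₁ ∧ (x' == y') = a₀ ∧
      (x == z) = b₁ ∧ (x == y) = b₀ ∧ ((y == z) = b₂ ∧ (y' == z') = a₂ ∧ (y == y') = c₀ ∧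
      (z == z') = c₁ ∧ (z == z') = c₂) then 1 else 0) = _ := fun x y z x' y' =>
    sum_bool_ite x' a₁ fun z' => (x' == y') = a₀ ∧ (x == z) = b₁ ∧ (x == y) = b₀ ∧
      ((y == z) = b₂ ∧ (y' == z') = a₂ ∧ (y == y') = c₀ ∧ (z == z') = c₁ ∧ (z == z') = c₂)
  have s2 : ∀ x y z x' : Bool, (∑ y' : Bool, if (x' == y') = a₀ ∧ (x == z) = b₁ ∧ (x == y) = b₀ ∧
      ((y == z) = b₂ ∧ (y' == (x' == a₁)) = a₂ ∧ (y == y') = c₀ ∧ (z == (x' == a₁)) = c₁ ∧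
        (z == (x' == a₁)) = c₂) then 1 else 0) = _ := fun x y z x' =>
    sum_bool_ite x' a₀ fun y' => (x == z) = b₁ ∧ (x == y) = b₀ ∧
      ((y == z) = b₂ ∧ (y' == (x' == a₁)) = a₂ ∧ (y == y') = c₀ ∧ (z == (x' == a₁)) = c₁ ∧
        (z == (x' == a₁)) = c₂)
  simp only [s1, s2]
  simp only [Fintype.sum_bool]
  clear e s1 s2
  revert a₀ a₁ a₂ b₀ b₁ b₂ c₀ c₁ c₂
  decide

/-! ### The number of choices of antipodes -/

lemma unit_beq (a b : Bool) : unit (a == b) = unit a * unit b := by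
  cases a <;> cases b <;> simp [unit]

lemma coe_boolSign (b : Bool) : ((boolSign b : SignType) : ℝ) = unit b := by
  cases b <;> simp [unit, boolSign]

lemma exists_boolSign {s : SignType} (h : s ≠ 0) : ∃ b, s = boolSign b := by
  revert s; decide

/-- Equality of four products of signs amounts to three affine equations in the antipode choices,
since common factors cancel. -/
lemma sameSign_boolSign : ∀ x x' y y' d d' e e' : Bool,
    SameSign (boolSign x * boolSign x' * boolSign y * boolSign d)
      (boolSign x * boolSign x' * boolSign y' * boolSign d')
      (boolSign y * boolSign y' * boolSign x * boolSign e)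
      (boolSign y * boolSign y' * boolSign x' * boolSign e') ↔
    (x == x') = (e == e') ∧ (y == y') = (d == d') ∧ (x' == y') = (d == e) := by
  decide

lemma allCross_iff (ε η : Fin 3 → Bool) (D E : Fin 3 → Fin 3 → Fin 3 → SignType) :
    AllCross ε η D E ↔
      PairCross ε η D E 0 1 ∧ PairCross ε η D E 0 2 ∧ PairCross ε η D E 1 2 := by
  constructor
  · intro h
    exact ⟨h 0 1 (by decide), h 0 2 (by decide), h 1 2 (by decide)⟩
  · rintro ⟨h1, h2, h3⟩ k l hkl
    fin_cases k <;> fin_cases l <;> first | exact absurd hkl (by decide) | assumption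

/-- The number of choices of signs for which three edges cross pairwise. -/
lemma sum_allCross {D E : Fin 3 → Fin 3 → Fin 3 → SignType}
    (hD : ∀ k l m, k ≠ l → D k l m ≠ 0) (hE : ∀ k l m, k ≠ l → E k l m ≠ 0) :
    ∑ ε, ∑ η, (if AllCross ε η D E then (1 : ℝ) else 0) =
      1 / 8 * (1 + (D 0 1 0 * D 0 1 1 : ℝ) * (D 0 2 0 * D 0 2 2) * (D 1 2 1 * D 1 2 2)) *
        (1 + (E 0 1 0 * E 0 1 1 : ℝ) * (E 0 2 0 * E 0 2 2) * (E 1 2 1 * E 1 2 2)) *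
        (1 + (D 0 2 0 * E 0 2 0 : ℝ) * (D 1 2 1 * E 1 2 1)) *
        (1 + (D 1 2 1 * E 1 2 1 : ℝ) * (D 0 1 0 * E 0 1 0) *
          (D 1 2 1 * D 1 2 2) * (E 1 2 1 * E 1 2 2)) := by
  obtain ⟨d010, h010⟩ := exists_boolSign (hD 0 1 0 (by decide))
  obtain ⟨d011, h011⟩ := exists_boolSign (hD 0 1 1 (by decide))
  obtain ⟨d020, h020⟩ := exists_boolSign (hD 0 2 0 (by decide))
  obtain ⟨d022, h022⟩ := exists_boolSign (hD 0 2 2 (by decide))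
  obtain ⟨d121, h121⟩ := exists_boolSign (hD 1 2 1 (by decide))
  obtain ⟨d122, h122⟩ := exists_boolSign (hD 1 2 2 (by decide))
  obtain ⟨e010, k010⟩ := exists_boolSign (hE 0 1 0 (by decide))
  obtain ⟨e011, k011⟩ := exists_boolSign (hE 0 1 1 (by decide))
  obtain ⟨e020, k020⟩ := exists_boolSign (hE 0 2 0 (by decide))
  obtain ⟨e022, k022⟩ := exists_boolSign (hE 0 2 2 (by decide))
  obtain ⟨e121, k121⟩ := exists_boolSign (hE 1 2 1 (by decide))
  obtain ⟨e122, k122⟩ := exists_boolSign (hE 1 2 2 (by decide))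
  have h := congrArg (Nat.cast (R := ℝ)) (count_bool_solutions (d010 == d011) (d020 == d022)
    (d121 == d122) (e010 == e011) (e020 == e022) (e121 == e122) (d010 == e010) (d020 == e020)
    (d121 == e121))
  push_cast at h
  simp only [sum_triples, allCross_iff, PairCross, h010, h011, h020, h022, h121, h122, k010, k011,
    k020, k022, k121, k122, sameSign_boolSign]
  refine Eq.trans ?_ (h.trans ?_)
  · rfl
  · have assoc : ∀ a b c : Bool, ((a == b) == c) = (a == (b == c)) := by decide
    -- The indicator of each condition is `(1 + sign) / 2`; two solutions times `1 / 16` gives the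
    -- factor `1 / 8`.
    have key : ∀ p q r s : Bool, (if p = true ∧ q = true ∧ r = true ∧ s = true then (2 : ℝ) else 0) =
        1 / 8 * (1 + unit p) * (1 + unit q) * (1 + unit r) * (1 + unit s) := by
      intro p q r s
      cases p <;> cases q <;> cases r <;> cases s <;> (simp [unit]; try norm_num)
    rw [key]
    simp only [coe_boolSign, ← unit_beq]
    rw [← assoc (d010 == d011), ← assoc (e010 == e011), ← assoc (d121 == e121),
      ← assoc ((d121 == e121) == (d010 == e010))]

/-! ### Expectations of crossing triples at radius zero -/

/-- The expected number of choices of signs for which three edges with given lines as nodes cross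
pairwise, in the limit of small radii. -/
def signExpectation (X Y : Fin 2 → Frame) (I J : Fin 3 → Fin 2) : ℝ :=
  ∫ ω, ∑ ε, ∑ η, crossWeight X Y I J ε η 0 ω.1 ω.2 ∂params

lemma limitDensity_zero (X Y : Fin 2 → Frame) :
    limitDensity X Y 0 = 1 / 2 ^ 12 * ∑ I, ∑ J, signExpectation X Y I J := by
  rw [limitDensity]
  refine congrArg _ (Finset.sum_congr rfl fun I _ => Finset.sum_congr rfl fun J _ => ?_)
  rw [signExpectation, integral_finsetSum _ fun ε _ => integrable_finsetSum _ fun η _ =>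
    integrable_crossWeight X Y I J ε η 0]
  refine Finset.sum_congr rfl fun ε _ => ?_
  rw [integral_finsetSum _ fun η _ => integrable_crossWeight X Y I J ε η 0]

/-! ### Symmetries -/

lemma side_zero_swap (X Y : Fin 2 → Frame) (i : Fin 2) (s : ℝ) (i' : Fin 2) (s' : ℝ) (j : Fin 2)
    (t : ℝ) : side X Y 0 i' s' i s j t = -side X Y 0 i s i' s' j t := by
  by_cases h : i = i'
  · subst h
    simp only [side_same, Frame.pt_zero]
    ring
  · rw [side_zero_of_ne h, side_zero_of_ne (Ne.symm h), det3_swap]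

lemma sideSigns_zero_swap (X Y : Fin 2 → Frame) (I J : Fin 3 → Fin 2) (a b : Fin 3 → ℝ)
    (k l m : Fin 3) : sideSigns X Y 0 I J a b l k m = -sideSigns X Y 0 I J a b k l m := by
  rw [sideSigns, side_zero_swap, Left.sign_neg, sideSigns]

lemma sameSign_rotate {a b c d : SignType} : SameSign c d a b ↔ SameSign a b c d := by
  revert a b c d; decide

lemma PairCross.symm {ε η : Fin 3 → Bool} {D E : Fin 3 → Fin 3 → Fin 3 → SignType}
    (hD : ∀ k l m, D l k m = -D k l m) (hE : ∀ k l m, E l k m = -E k l m) {k l : Fin 3}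
    (h : PairCross ε η D E k l) : PairCross ε η D E l k := by
  have key : ∀ {a b c d : SignType}, SameSign a b c d → SameSign (-b) (-a) (-d) (-c) := by decide
  have := key h
  rw [PairCross, hD k l, hD k l, hE k l, hE k l]
  convert this using 1 <;> rw [mul_neg, neg_inj] <;> congr 2 <;> exact mul_comm _ _

lemma allCross_iff_ne {ε η : Fin 3 → Bool} {D E : Fin 3 → Fin 3 → Fin 3 → SignType}
    (hD : ∀ k l m, D l k m = -D k l m) (hE : ∀ k l m, E l k m = -E k l m) :
    AllCross ε η D E ↔ ∀ k l, k ≠ l → PairCross ε η D E k l := by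
  refine ⟨fun h k l hkl => ?_, fun h k l hkl => h k l hkl.ne⟩
  rcases lt_or_gt_of_ne hkl with h' | h'
  · exact h k l h'
  · exact (h l k h').symm hD hE

/-- Pairwise crossing is tested for `k < l` only, but the signs are antisymmetric in the pair, so
the order of the three edges is immaterial. -/
lemma crossWeight_comp_perm (X Y : Fin 2 → Frame) (I J : Fin 3 → Fin 2) (ε η : Fin 3 → Bool)
    (π : Equiv.Perm (Fin 3)) (a b : Fin 3 → ℝ) :
    crossWeight X Y (I ∘ π) (J ∘ π) (ε ∘ π) (η ∘ π) 0 (a ∘ π) (b ∘ π) =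
      crossWeight X Y I J ε η 0 a b := by
  refine if_congr ?_ rfl rfl
  rw [allCross_iff_ne (sideSigns_zero_swap X Y (I ∘ π) (J ∘ π) (a ∘ π) (b ∘ π))
      (sideSigns_zero_swap Y X (J ∘ π) (I ∘ π) (b ∘ π) (a ∘ π)),
    allCross_iff_ne (sideSigns_zero_swap X Y I J a b) (sideSigns_zero_swap Y X J I b a)]
  constructor
  · intro h k l hkl
    have := h (π.symm k) (π.symm l) (π.symm.injective.ne hkl)
    simpa [PairCross, sideSigns] using this
  · intro h k l hkl
    exact h (π k) (π l) (π.injective.ne hkl)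

lemma measurable_sum_crossWeight (X Y : Fin 2 → Frame) (I J : Fin 3 → Fin 2) :
    Measurable fun ω : Params => ∑ ε, ∑ η, crossWeight X Y I J ε η 0 ω.1 ω.2 :=
  Finset.measurable_sum _ fun ε _ => Finset.measurable_sum _ fun η _ =>
    measurable_crossWeight X Y I J ε η 0

lemma signExpectation_comp_perm (X Y : Fin 2 → Frame) (I J : Fin 3 → Fin 2)
    (π : Equiv.Perm (Fin 3)) :
    signExpectation X Y (I ∘ π) (J ∘ π) = signExpectation X Y I J := by
  have h := (measurePreserving_comp_perm π).prod (measurePreserving_comp_perm π)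
  rw [signExpectation, params, ← h.map_eq, integral_map h.measurable.aemeasurable
    (measurable_sum_crossWeight X Y (I ∘ π) (J ∘ π)).aestronglyMeasurable, signExpectation]
  refine integral_congr_ae (Eventually.of_forall fun ω => ?_)
  simp only [Prod.map_fst, Prod.map_snd]
  rw [← (π.arrowCongr (Equiv.refl Bool)).symm.sum_comp]
  refine Finset.sum_congr rfl fun ε _ => ?_
  rw [← (π.arrowCongr (Equiv.refl Bool)).symm.sum_comp]
  exact Finset.sum_congr rfl fun η _ => crossWeight_comp_perm X Y I J ε η π ω.1 ω.2

lemma signExpectation_swap (X Y : Fin 2 → Frame) (I J : Fin 3 → Fin 2) :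
    signExpectation Y X J I = signExpectation X Y I J := by
  have h := Measure.measurePreserving_swap (μ := turns) (ν := turns)
  rw [signExpectation, params, ← h.map_eq, integral_map h.measurable.aemeasurable
    (measurable_sum_crossWeight Y X J I).aestronglyMeasurable, signExpectation]
  refine integral_congr_ae (Eventually.of_forall fun ω => ?_)
  simp only [Prod.fst_swap, Prod.snd_swap]
  rw [Finset.sum_comm]
  refine Finset.sum_congr rfl fun ε _ => Finset.sum_congr rfl fun η _ => if_congr ?_ rfl rfl
  exact forall_congr' fun k => forall_congr' fun l => imp_congr Iff.rfl sameSign_rotate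

/-! ### The expectation as an integral of a polynomial in signs -/

/-- The linear functional, restricted to the circle of tangent directions, whose increments
determine the limits of the signs of determinants. -/
def height (X Y : Fin 2 → Frame) (i j : Fin 2) (s : ℝ) : ℝ :=
  det3 (X i).c (X i).e (Y j).c * Real.cos (2 * Real.pi * s) +
    det3 (X i).c (X i).f (Y j).c * Real.sin (2 * Real.pi * s)

/-- The signs of `side` at radius zero, as real numbers. -/
def limitSign (X Y : Fin 2 → Frame) (I J : Fin 3 → Fin 2) (k l m : Fin 3) (a : Fin 3 → ℝ) : ℝ :=
  sgn (side X Y 0 (I k) (a k) (I l) (a l) (J m) 0)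

lemma side_zero_right (X Y : Fin 2 → Frame) (i : Fin 2) (s : ℝ) (i' : Fin 2) (s' : ℝ) (j : Fin 2)
    (t : ℝ) : side X Y 0 i s i' s' j t = side X Y 0 i s i' s' j 0 := by
  simp only [side, Frame.pt_zero]

lemma limitSign_same (X Y : Fin 2 → Frame) (I J : Fin 3 → Fin 2) (k l m : Fin 3)
    (h : I k = I l) (a : Fin 3 → ℝ) :
    limitSign X Y I J k l m a = incr (height X Y (I k) (J m)) k l a := by
  rw [limitSign, incr, ← h, side_same, height, height, Frame.pt_zero, Frame.pt_zero]
  congr 1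
  ring

/-- The sign of the determinant of three centres. -/
def centreSign (X Y : Fin 2 → Frame) (i i' j : Fin 2) : ℝ := sgn (det3 (X i).c (X i').c (Y j).c)

lemma limitSign_of_ne (X Y : Fin 2 → Frame) (I J : Fin 3 → Fin 2) (k l m : Fin 3)
    (h : I k ≠ I l) (a : Fin 3 → ℝ) :
    limitSign X Y I J k l m a = centreSign X Y (I k) (I l) (J m) := by
  rw [limitSign, side_zero_of_ne h, centreSign]

/-- At radius zero the third point is a centre, so signs of one family do not see the angles of the
other part. This separates the variables `ω.1` and `ω.2`. -/
lemma signExpectation_eq {X Y : Fin 2 → Frame} {m : ℝ} (hX : Nondegenerate X Y m)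
    (hY : Nondegenerate Y X m) (I J : Fin 3 → Fin 2) :
    signExpectation X Y I J = ∫ ω : Params,
      1 / 8 * (1 + (limitSign X Y I J 0 1 0 ω.1 * limitSign X Y I J 0 1 1 ω.1) *
          (limitSign X Y I J 0 2 0 ω.1 * limitSign X Y I J 0 2 2 ω.1) *
          (limitSign X Y I J 1 2 1 ω.1 * limitSign X Y I J 1 2 2 ω.1)) *
        (1 + (limitSign Y X J I 0 1 0 ω.2 * limitSign Y X J I 0 1 1 ω.2) *
          (limitSign Y X J I 0 2 0 ω.2 * limitSign Y X J I 0 2 2 ω.2) *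
          (limitSign Y X J I 1 2 1 ω.2 * limitSign Y X J I 1 2 2 ω.2)) *
        (1 + (limitSign X Y I J 0 2 0 ω.1 * limitSign Y X J I 0 2 0 ω.2) *
          (limitSign X Y I J 1 2 1 ω.1 * limitSign Y X J I 1 2 1 ω.2)) *
        (1 + (limitSign X Y I J 1 2 1 ω.1 * limitSign Y X J I 1 2 1 ω.2) *
          (limitSign X Y I J 0 1 0 ω.1 * limitSign Y X J I 0 1 0 ω.2) *
          (limitSign X Y I J 1 2 1 ω.1 * limitSign X Y I J 1 2 2 ω.1) *
          (limitSign Y X J I 1 2 1 ω.2 * limitSign Y X J I 1 2 2 ω.2)) ∂params := by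
  have h0 : 1000 * (0 : ℝ) < m := by simpa using hX.pos
  have hA : ∀ᵐ ω ∂params, ∀ k l n : Fin 3, k ≠ l →
      side X Y 0 (I k) (ω.1 k) (I l) (ω.1 l) (J n) (ω.2 n) ≠ 0 := by
    simp only [ae_all_iff]
    exact fun k l n h => ae_side_ne_zero hX le_rfl h0 I J h n
  have hB : ∀ᵐ ω ∂params, ∀ k l n : Fin 3, k ≠ l →
      side Y X 0 (J k) (ω.2 k) (J l) (ω.2 l) (I n) (ω.1 n) ≠ 0 := by
    simp only [ae_all_iff]
    exact fun k l n h => ae_side_ne_zero' hY le_rfl h0 J I h n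
  refine integral_congr_ae ?_
  filter_upwards [hA, hB] with ω h1 h2
  have h := sum_allCross (D := sideSigns X Y 0 I J ω.1 ω.2) (E := sideSigns Y X 0 J I ω.2 ω.1)
    (fun k l n hkl => sign_ne_zero.2 (h1 k l n hkl))
    (fun k l n hkl => sign_ne_zero.2 (h2 k l n hkl))
  have e : ∀ (X Y : Fin 2 → Frame) (I J : Fin 3 → Fin 2) (a b : Fin 3 → ℝ) (k l n : Fin 3),
      ((sideSigns X Y 0 I J a b k l n : SignType) : ℝ) = limitSign X Y I J k l n a := by
    intro X Y I J a b k l n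
    rw [sideSigns, side_zero_right]
    rfl
  simp only [e] at h
  exact h

/-! ### Bounded measurable functions -/

/-- A bounded measurable function. -/
def BddMeasurable {α : Type*} [MeasurableSpace α] (f : α → ℝ) : Prop :=
  Measurable f ∧ ∃ c, ∀ x, |f x| ≤ c

namespace BddMeasurable

variable {α : Type*} [MeasurableSpace α] {f g : α → ℝ}

lemma const (c : ℝ) : BddMeasurable fun _ : α => c := ⟨measurable_const, |c|, fun _ => le_rfl⟩

lemma add (hf : BddMeasurable f) (hg : BddMeasurable g) : BddMeasurable fun x => f x + g x := by
  obtain ⟨mf, c, hc⟩ := hf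
  obtain ⟨mg, d, hd⟩ := hg
  exact ⟨mf.add mg, c + d, fun x => (abs_add_le _ _).trans (add_le_add (hc x) (hd x))⟩

lemma mul (hf : BddMeasurable f) (hg : BddMeasurable g) : BddMeasurable fun x => f x * g x := by
  obtain ⟨mf, c, hc⟩ := hf
  obtain ⟨mg, d, hd⟩ := hg
  refine ⟨mf.mul mg, c * d, fun x => ?_⟩
  rw [abs_mul]
  exact mul_le_mul (hc x) (hd x) (abs_nonneg _) ((abs_nonneg _).trans (hc x))

lemma integrable (hf : BddMeasurable f) {ν : Measure α} [IsFiniteMeasure ν] : Integrable f ν := by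
  obtain ⟨mf, c, hc⟩ := hf
  exact Integrable.of_bound mf.aestronglyMeasurable c (Eventually.of_forall hc)

end BddMeasurable

lemma IsHeight.bddMeasurable_incr {H : ℝ → ℝ} (hH : IsHeight H) (k l : Fin 3) :
    BddMeasurable (incr H k l) :=
  ⟨hH.measurable_incr k l, 1, abs_incr_le H k l⟩

lemma integral_params_add {f₁ f₂ g₁ g₂ : (Fin 3 → ℝ) → ℝ} (hf₁ : BddMeasurable f₁)
    (hf₂ : BddMeasurable f₂) (hg₁ : BddMeasurable g₁) (hg₂ : BddMeasurable g₂) :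
    ∫ ω : Params, (f₁ ω.1 * g₁ ω.2 + f₂ ω.1 * g₂ ω.2) ∂params =
      (∫ a, f₁ a ∂turns) * (∫ b, g₁ b ∂turns) + (∫ a, f₂ a ∂turns) * (∫ b, g₂ b ∂turns) := by
  rw [integral_add (hf₁.integrable.mul_prod hg₁.integrable)
    (hf₂.integrable.mul_prod hg₂.integrable), integral_prod_mul, integral_prod_mul]

/-! ### The expectations by the pattern of lines -/

/-- The data of an antipodal drawing that determine the limit of the triangle densities. -/
structure LimitData (X Y : Fin 2 → Frame) (m : ℝ) (τ σ : Fin 2 → ℝ) : Prop where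
  left : Nondegenerate X Y m
  right : Nondegenerate Y X m
  corr_left : ∀ i j j', j ≠ j' → HasCorrelation (height X Y i j) (height X Y i j') (τ i)
  corr_right : ∀ j i i', i ≠ i' → HasCorrelation (height Y X j i) (height Y X j i') (σ j)
  centre_left : ∀ i i' j j', centreSign X Y i i' j = centreSign X Y i i' j'
  centre_right : ∀ j j' i i', centreSign Y X j j' i = centreSign Y X j j' i'

section Classes

variable {X Y : Fin 2 → Frame} {m : ℝ} {τ σ : Fin 2 → ℝ}

lemma LimitData.symm (h : LimitData X Y m τ σ) : LimitData Y X m σ τ :=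
  ⟨h.right, h.left, h.corr_right, h.corr_left, h.centre_right, h.centre_left⟩

lemma LimitData.isHeight (h : LimitData X Y m τ σ) (i j : Fin 2) : IsHeight (height X Y i j) := by
  obtain ⟨j', hj⟩ := exists_ne j
  exact (h.corr_left i j j' hj.symm).left

lemma LimitData.centreSign_sq (h : LimitData X Y m τ σ) {i i' : Fin 2} (hi : i ≠ i') (j : Fin 2) :
    centreSign X Y i i' j ^ 2 = 1 :=
  sgn_sq (abs_pos.1 (h.left.pos.trans_le (h.left.le_det3 i i' j hi)))

lemma eq_one_or_neg_one {x : ℝ} (h : x ^ 2 = 1) : x = 1 ∨ x = -1 :=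
  mul_self_eq_one_iff.1 ((sq x).symm.trans h)

lemma ae_params_fst {p : (Fin 3 → ℝ) → Prop} (h : ∀ᵐ a ∂turns, p a) :
    ∀ᵐ ω ∂params, p ω.1 := Measure.quasiMeasurePreserving_fst.ae h

lemma ae_params_snd {p : (Fin 3 → ℝ) → Prop} (h : ∀ᵐ a ∂turns, p a) :
    ∀ᵐ ω ∂params, p ω.2 := Measure.quasiMeasurePreserving_snd.ae h

/-- The number of sign choices is `2` if the same edge is in the middle for both heights and `0`
otherwise. The two middle positions are independent, so they agree with probability `1 / 3`. -/
lemma signExpectation_same_same (h : LimitData X Y m τ σ) (i j : Fin 2) :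
    signExpectation X Y ![i, i, i] ![j, j, j] = 2 / 3 := by
  rw [signExpectation_eq h.left h.right]
  have dd : ∀ k l n a, limitSign X Y ![i, i, i] ![j, j, j] k l n a =
      incr (height X Y i j) k l a := by
    intro k l n a
    rw [limitSign_same _ _ _ _ _ _ _ (by fin_cases k <;> fin_cases l <;> rfl)]
    fin_cases k <;> fin_cases n <;> rfl
  have ee : ∀ k l n a, limitSign Y X ![j, j, j] ![i, i, i] k l n a =
      incr (height Y X j i) k l a := by
    intro k l n a
    rw [limitSign_same _ _ _ _ _ _ _ (by fin_cases k <;> fin_cases l <;> rfl)]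
    fin_cases k <;> fin_cases n <;> rfl
  simp only [dd, ee]
  have hH := h.isHeight i j
  have hK := h.symm.isHeight j i
  generalize height X Y i j = H at hH
  generalize height Y X j i = K at hK
  have hD := hH.bddMeasurable_incr
  have hE := hK.bddMeasurable_incr
  have e : ∫ ω : Params, (1 / 2 + (1 / 2 * ((incr H 0 1 ω.1 * incr H 0 2 ω.1) *
        (incr K 0 1 ω.2 * incr K 0 2 ω.2)) + 1 / 2 * ((incr H 1 0 ω.1 * incr H 1 2 ω.1) *
        (incr K 1 0 ω.2 * incr K 1 2 ω.2)) + 1 / 2 * ((incr H 2 0 ω.1 * incr H 2 1 ω.1) *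
        (incr K 2 0 ω.2 * incr K 2 1 ω.2)))) ∂params = 2 / 3 := by
    have b : ∀ k l k' l', Integrable (fun ω : Params => 1 / 2 * ((incr H k l ω.1 *
        incr H k' l' ω.1) * (incr K k l ω.2 * incr K k' l' ω.2))) params := fun k l k' l' =>
      ((((hD k l).mul (hD k' l')).integrable).mul_prod
        (((hE k l).mul (hE k' l')).integrable)).const_mul _
    have b' : Integrable (fun ω : Params => 1 / 2 * ((incr H 0 1 ω.1 * incr H 0 2 ω.1) *
        (incr K 0 1 ω.2 * incr K 0 2 ω.2)) + 1 / 2 * ((incr H 1 0 ω.1 * incr H 1 2 ω.1) *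
        (incr K 1 0 ω.2 * incr K 1 2 ω.2)) + 1 / 2 * ((incr H 2 0 ω.1 * incr H 2 1 ω.1) *
        (incr K 2 0 ω.2 * incr K 2 1 ω.2))) params := ((b 0 1 0 2).add (b 1 0 1 2)).add (b 2 0 2 1)
    obtain ⟨a1, a2, a3⟩ := hH.integral_incr_mul_incr
    obtain ⟨b1, b2, b3⟩ := hK.integral_incr_mul_incr
    rw [integral_add (integrable_const _) b', integral_add₃ (b 0 1 0 2) (b 1 0 1 2) (b 2 0 2 1),
      integral_const_mul, integral_const_mul, integral_const_mul,
      integral_prod_mul (fun a => incr H 0 1 a * incr H 0 2 a)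
        (fun b => incr K 0 1 b * incr K 0 2 b),
      integral_prod_mul (fun a => incr H 1 0 a * incr H 1 2 a)
        (fun b => incr K 1 0 b * incr K 1 2 b),
      integral_prod_mul (fun a => incr H 2 0 a * incr H 2 1 a)
        (fun b => incr K 2 0 b * incr K 2 1 b), a1, a2, a3, b1, b2, b3]
    simp
    norm_num
  rw [← e]
  refine integral_congr_ae ?_
  filter_upwards [ae_params_fst (hH.ae_sq (show (0 : Fin 3) ≠ 1 by decide)),
    ae_params_fst (hH.ae_sq (show (0 : Fin 3) ≠ 2 by decide)),
    ae_params_fst (hH.ae_sq (show (1 : Fin 3) ≠ 2 by decide)),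
    ae_params_snd (hK.ae_sq (show (0 : Fin 3) ≠ 1 by decide)),
    ae_params_snd (hK.ae_sq (show (0 : Fin 3) ≠ 2 by decide)),
    ae_params_snd (hK.ae_sq (show (1 : Fin 3) ≠ 2 by decide))] with ω p1 p2 p3 q1 q2 q3
  simp only [incr_swap _ 0 1, incr_swap _ 0 2, incr_swap _ 1 2]
  generalize incr H 0 1 ω.1 = x at *
  generalize incr H 0 2 ω.1 = y at *
  generalize incr H 1 2 ω.1 = z at *
  generalize incr K 0 1 ω.2 = x' at *
  generalize incr K 0 2 ω.2 = y' at *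
  generalize incr K 1 2 ω.2 = z' at *
  rcases eq_one_or_neg_one p1 with rfl | rfl <;>
  rcases eq_one_or_neg_one p2 with rfl | rfl <;>
  rcases eq_one_or_neg_one p3 with rfl | rfl <;>
  rcases eq_one_or_neg_one q1 with rfl | rfl <;>
  rcases eq_one_or_neg_one q2 with rfl | rfl <;>
  rcases eq_one_or_neg_one q3 with rfl | rfl <;> norm_num

/-- The count is a function of the `ω.1`-signs plus a term with a factor `incr K 0 1`, which is
independent of them and has mean zero. The remaining mean is `(1 + 1/3 + τ² + 1/3) / 4`. -/
lemma signExpectation_same_split (h : LimitData X Y m τ σ) (i : Fin 2) {j j' : Fin 2}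
    (hj : j ≠ j') :
    signExpectation X Y ![i, i, i] ![j, j, j'] = 1 / 4 * (5 / 3 + τ i ^ 2) := by
  rw [signExpectation_eq h.left h.right]
  have hc := h.corr_left i j j' hj
  have hK := h.symm.isHeight j i
  set H := height X Y i j with hHdef
  set H' := height X Y i j' with hHdef'
  set K := height Y X j i with hKdef
  have hs := h.symm.centreSign_sq hj i
  set s := centreSign Y X j j' i
  have d010 : ∀ a, limitSign X Y ![i, i, i] ![j, j, j'] 0 1 0 a = incr H 0 1 a :=
    limitSign_same _ _ _ _ _ _ _ rfl
  have d011 : ∀ a, limitSign X Y ![i, i, i] ![j, j, j'] 0 1 1 a = incr H 0 1 a :=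
    limitSign_same _ _ _ _ _ _ _ rfl
  have d020 : ∀ a, limitSign X Y ![i, i, i] ![j, j, j'] 0 2 0 a = incr H 0 2 a :=
    limitSign_same _ _ _ _ _ _ _ rfl
  have d022 : ∀ a, limitSign X Y ![i, i, i] ![j, j, j'] 0 2 2 a = incr H' 0 2 a :=
    limitSign_same _ _ _ _ _ _ _ rfl
  have d121 : ∀ a, limitSign X Y ![i, i, i] ![j, j, j'] 1 2 1 a = incr H 1 2 a :=
    limitSign_same _ _ _ _ _ _ _ rfl
  have d122 : ∀ a, limitSign X Y ![i, i, i] ![j, j, j'] 1 2 2 a = incr H' 1 2 a :=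
    limitSign_same _ _ _ _ _ _ _ rfl
  have e010 : ∀ a, limitSign Y X ![j, j, j'] ![i, i, i] 0 1 0 a = incr K 0 1 a :=
    limitSign_same _ _ _ _ _ _ _ rfl
  have e011 : ∀ a, limitSign Y X ![j, j, j'] ![i, i, i] 0 1 1 a = incr K 0 1 a :=
    limitSign_same _ _ _ _ _ _ _ rfl
  have e020 : ∀ a, limitSign Y X ![j, j, j'] ![i, i, i] 0 2 0 a = s :=
    limitSign_of_ne _ _ _ _ _ _ _ hj
  have e022 : ∀ a, limitSign Y X ![j, j, j'] ![i, i, i] 0 2 2 a = s :=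
    limitSign_of_ne _ _ _ _ _ _ _ hj
  have e121 : ∀ a, limitSign Y X ![j, j, j'] ![i, i, i] 1 2 1 a = s :=
    limitSign_of_ne _ _ _ _ _ _ _ hj
  have e122 : ∀ a, limitSign Y X ![j, j, j'] ![i, i, i] 1 2 2 a = s :=
    limitSign_of_ne _ _ _ _ _ _ _ hj
  simp only [d010, d011, d020, d022, d121, d122, e010, e011, e020, e022, e121, e122]
  clear_value H H' K s
  have hD := hc.left.bddMeasurable_incr
  have hD' := hc.right.bddMeasurable_incr
  have bq : BddMeasurable fun a => incr H 0 2 a * incr H 1 2 a := (hD 0 2).mul (hD 1 2)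
  have bc : BddMeasurable fun a => (incr H 0 2 a * incr H' 0 2 a) * (incr H 1 2 a * incr H' 1 2 a) :=
    ((hD 0 2).mul (hD' 0 2)).mul ((hD 1 2).mul (hD' 1 2))
  have bq' : BddMeasurable fun a => incr H' 0 2 a * incr H' 1 2 a := (hD' 0 2).mul (hD' 1 2)
  have bsum : BddMeasurable fun a => 1 / 4 * (1 + (incr H 0 2 a * incr H 1 2 a +
      (incr H 0 2 a * incr H' 0 2 a) * (incr H 1 2 a * incr H' 1 2 a) +
      incr H' 0 2 a * incr H' 1 2 a)) :=
    (BddMeasurable.const _).mul ((BddMeasurable.const 1).add ((bq.add bc).add bq'))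
  have e := integral_params_add bsum (bsum.mul ((hD 0 1).mul ((hD' 1 2).mul
    (BddMeasurable.const s)))) (BddMeasurable.const 1) (hK.bddMeasurable_incr 0 1)
  have hval : ∫ a, 1 / 4 * (1 + (incr H 0 2 a * incr H 1 2 a +
      (incr H 0 2 a * incr H' 0 2 a) * (incr H 1 2 a * incr H' 1 2 a) +
      incr H' 0 2 a * incr H' 1 2 a)) ∂turns = 1 / 4 * (5 / 3 + τ i ^ 2) := by
    have sw : ∀ (H : ℝ → ℝ) a, incr H 2 0 a * incr H 2 1 a = incr H 0 2 a * incr H 1 2 a := by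
      intro H a
      rw [incr_swap H 0 2, incr_swap H 1 2]; ring
    have a1 := hc.left.integral_incr_mul_incr.2.2
    have a2 := hc.right.integral_incr_mul_incr.2.2
    simp only [sw] at a1 a2
    rw [integral_const_mul, integral_add (integrable_const _) ((bq.add bc).add bq').integrable,
      integral_add₃ bq.integrable bc.integrable bq'.integrable, a1, a2, hc.integral_incr_mul]
    simp
    ring
  rw [hval, hK.integral_incr] at e
  simp only [integral_const, probReal_univ, one_smul, mul_one, mul_zero, add_zero] at e
  rw [← e]
  refine integral_congr_ae ?_
  filter_upwards [ae_params_fst (hc.left.ae_sq (show (0 : Fin 3) ≠ 1 by decide)),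
    ae_params_fst (hc.left.ae_sq (show (0 : Fin 3) ≠ 2 by decide)),
    ae_params_fst (hc.left.ae_sq (show (1 : Fin 3) ≠ 2 by decide)),
    ae_params_fst (hc.right.ae_sq (show (0 : Fin 3) ≠ 2 by decide)),
    ae_params_fst (hc.right.ae_sq (show (1 : Fin 3) ≠ 2 by decide)),
    ae_params_snd (hK.ae_sq (show (0 : Fin 3) ≠ 1 by decide))] with ω p1 p2 p3 q2 q3 k1
  generalize incr H 0 1 ω.1 = x at *
  generalize incr H 0 2 ω.1 = y at *
  generalize incr H 1 2 ω.1 = z at *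
  generalize incr H' 0 2 ω.1 = y' at *
  generalize incr H' 1 2 ω.1 = z' at *
  generalize incr K 0 1 ω.2 = x' at *
  rcases eq_one_or_neg_one p1 with rfl | rfl <;>
  rcases eq_one_or_neg_one p2 with rfl | rfl <;>
  rcases eq_one_or_neg_one p3 with rfl | rfl <;>
  rcases eq_one_or_neg_one q2 with rfl | rfl <;>
  rcases eq_one_or_neg_one q3 with rfl | rfl <;>
  rcases eq_one_or_neg_one k1 with rfl | rfl <;>
  rcases eq_one_or_neg_one hs with rfl | rfl <;> norm_num

/-- All signs involving the third edge are constants, and the count reduces to `1` plus a multiple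
of a product of two independent signs of mean zero. -/
lemma signExpectation_split_split (h : LimitData X Y m τ σ) {i i' j j' : Fin 2} (hi : i ≠ i')
    (hj : j ≠ j') : signExpectation X Y ![i, i, i'] ![j, j, j'] = 1 := by
  rw [signExpectation_eq h.left h.right]
  have hH := h.isHeight i j
  have hK := h.symm.isHeight j i
  set H := height X Y i j with hHdef
  set K := height Y X j i with hKdef
  have hs := h.centreSign_sq hi j
  have ht := h.symm.centreSign_sq hj i
  set s := centreSign X Y i i' j with hsdef
  set t := centreSign Y X j j' i with htdef
  have d010 : ∀ a, limitSign X Y ![i, i, i'] ![j, j, j'] 0 1 0 a = incr H 0 1 a :=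
    limitSign_same _ _ _ _ _ _ _ rfl
  have d011 : ∀ a, limitSign X Y ![i, i, i'] ![j, j, j'] 0 1 1 a = incr H 0 1 a :=
    limitSign_same _ _ _ _ _ _ _ rfl
  have d020 : ∀ a, limitSign X Y ![i, i, i'] ![j, j, j'] 0 2 0 a = s :=
    limitSign_of_ne _ _ _ _ _ _ _ hi
  have d022 : ∀ a, limitSign X Y ![i, i, i'] ![j, j, j'] 0 2 2 a = s := fun a =>
    (limitSign_of_ne _ _ _ _ _ _ _ hi a).trans (h.centre_left i i' j' j)
  have d121 : ∀ a, limitSign X Y ![i, i, i'] ![j, j, j'] 1 2 1 a = s :=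
    limitSign_of_ne _ _ _ _ _ _ _ hi
  have d122 : ∀ a, limitSign X Y ![i, i, i'] ![j, j, j'] 1 2 2 a = s := fun a =>
    (limitSign_of_ne _ _ _ _ _ _ _ hi a).trans (h.centre_left i i' j' j)
  have e010 : ∀ a, limitSign Y X ![j, j, j'] ![i, i, i'] 0 1 0 a = incr K 0 1 a :=
    limitSign_same _ _ _ _ _ _ _ rfl
  have e011 : ∀ a, limitSign Y X ![j, j, j'] ![i, i, i'] 0 1 1 a = incr K 0 1 a :=
    limitSign_same _ _ _ _ _ _ _ rfl
  have e020 : ∀ a, limitSign Y X ![j, j, j'] ![i, i, i'] 0 2 0 a = t :=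
    limitSign_of_ne _ _ _ _ _ _ _ hj
  have e022 : ∀ a, limitSign Y X ![j, j, j'] ![i, i, i'] 0 2 2 a = t := fun a =>
    (limitSign_of_ne _ _ _ _ _ _ _ hj a).trans (h.centre_right j j' i' i)
  have e121 : ∀ a, limitSign Y X ![j, j, j'] ![i, i, i'] 1 2 1 a = t :=
    limitSign_of_ne _ _ _ _ _ _ _ hj
  have e122 : ∀ a, limitSign Y X ![j, j, j'] ![i, i, i'] 1 2 2 a = t := fun a =>
    (limitSign_of_ne _ _ _ _ _ _ _ hj a).trans (h.centre_right j j' i' i)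
  simp only [d010, d011, d020, d022, d121, d122, e010, e011, e020, e022, e121, e122]
  clear_value H K s t
  have e := integral_params_add (BddMeasurable.const 1) (hH.bddMeasurable_incr 0 1)
    (BddMeasurable.const 1) ((BddMeasurable.const (s * t)).mul (hK.bddMeasurable_incr 0 1))
  rw [hH.integral_incr] at e
  simp only [integral_const, probReal_univ, one_smul, mul_one, zero_mul, add_zero] at e
  refine Eq.trans (integral_congr_ae ?_) e
  filter_upwards [ae_params_fst (hH.ae_sq (show (0 : Fin 3) ≠ 1 by decide)),
    ae_params_snd (hK.ae_sq (show (0 : Fin 3) ≠ 1 by decide))] with ω p1 k1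
  generalize incr H 0 1 ω.1 = x at *
  generalize incr K 0 1 ω.2 = x' at *
  rcases eq_one_or_neg_one p1 with rfl | rfl <;>
  rcases eq_one_or_neg_one k1 with rfl | rfl <;>
  rcases eq_one_or_neg_one hs with rfl | rfl <;>
  rcases eq_one_or_neg_one ht with rfl | rfl <;> norm_num

/-- The middle edge shares one line with each of the other two. With increments `x, x', y, y'` the
count is `(1 + s x)(1 + s x')(1 + t y)(1 + t y') / 8`; linear terms average to zero, and the
products `x x'` and `y y'` average to `τ` and `σ`. -/
lemma signExpectation_path (h : LimitData X Y m τ σ) {i i' j j' : Fin 2} (hi : i ≠ i')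
    (hj : j ≠ j') :
    signExpectation X Y ![i, i, i'] ![j', j, j] = 1 / 8 * (1 + τ i) * (1 + σ j) := by
  rw [signExpectation_eq h.left h.right]
  have hc := h.corr_left i j j' hj
  have hd := h.corr_right j i i' hi
  set H := height X Y i j with hHdef
  set H' := height X Y i j' with hHdef'
  set K := height Y X j i with hKdef
  set K' := height Y X j i' with hKdef'
  have hs := h.centreSign_sq hi j
  have ht := h.symm.centreSign_sq hj.symm i
  set s := centreSign X Y i i' j with hsdef
  set t := centreSign Y X j' j i with htdef
  have d010 : ∀ a, limitSign X Y ![i, i, i'] ![j', j, j] 0 1 0 a = incr H' 0 1 a :=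
    limitSign_same _ _ _ _ _ _ _ rfl
  have d011 : ∀ a, limitSign X Y ![i, i, i'] ![j', j, j] 0 1 1 a = incr H 0 1 a :=
    limitSign_same _ _ _ _ _ _ _ rfl
  have d020 : ∀ a, limitSign X Y ![i, i, i'] ![j', j, j] 0 2 0 a = s := fun a =>
    (limitSign_of_ne _ _ _ _ _ _ _ hi a).trans (h.centre_left i i' j' j)
  have d022 : ∀ a, limitSign X Y ![i, i, i'] ![j', j, j] 0 2 2 a = s :=
    limitSign_of_ne _ _ _ _ _ _ _ hi
  have d121 : ∀ a, limitSign X Y ![i, i, i'] ![j', j, j] 1 2 1 a = s :=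
    limitSign_of_ne _ _ _ _ _ _ _ hi
  have d122 : ∀ a, limitSign X Y ![i, i, i'] ![j', j, j] 1 2 2 a = s :=
    limitSign_of_ne _ _ _ _ _ _ _ hi
  have e010 : ∀ a, limitSign Y X ![j', j, j] ![i, i, i'] 0 1 0 a = t :=
    limitSign_of_ne _ _ _ _ _ _ _ hj.symm
  have e011 : ∀ a, limitSign Y X ![j', j, j] ![i, i, i'] 0 1 1 a = t :=
    limitSign_of_ne _ _ _ _ _ _ _ hj.symm
  have e020 : ∀ a, limitSign Y X ![j', j, j] ![i, i, i'] 0 2 0 a = t :=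
    limitSign_of_ne _ _ _ _ _ _ _ hj.symm
  have e022 : ∀ a, limitSign Y X ![j', j, j] ![i, i, i'] 0 2 2 a = t := fun a =>
    (limitSign_of_ne _ _ _ _ _ _ _ hj.symm a).trans (h.centre_right j' j i' i)
  have e121 : ∀ a, limitSign Y X ![j', j, j] ![i, i, i'] 1 2 1 a = incr K 1 2 a :=
    limitSign_same _ _ _ _ _ _ _ rfl
  have e122 : ∀ a, limitSign Y X ![j', j, j] ![i, i, i'] 1 2 2 a = incr K' 1 2 a :=
    limitSign_same _ _ _ _ _ _ _ rfl
  simp only [d010, d011, d020, d022, d121, d122, e010, e011, e020, e022, e121, e122]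
  clear_value H H' K K' s t
  have hD := hc.left.bddMeasurable_incr
  have hD' := hc.right.bddMeasurable_incr
  have hE := hd.left.bddMeasurable_incr
  have hE' := hd.right.bddMeasurable_incr
  have bE : BddMeasurable fun b => t * (incr K 1 2 b + incr K' 1 2 b) :=
    (BddMeasurable.const t).mul ((hE 1 2).add (hE' 1 2))
  have b0 : BddMeasurable fun b => 1 + incr K 1 2 b * incr K' 1 2 b :=
    (BddMeasurable.const 1).add ((hE 1 2).mul (hE' 1 2))
  have bF : BddMeasurable fun b => (1 + incr K 1 2 b * incr K' 1 2 b) +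
      t * (incr K 1 2 b + incr K' 1 2 b) := b0.add bE
  have e := integral_params_add
    ((BddMeasurable.const (1 / 8)).mul ((BddMeasurable.const 1).add ((hD 0 1).mul (hD' 0 1))))
    ((BddMeasurable.const (1 / 8 * s)).mul ((hD 0 1).add (hD' 0 1))) bF bF
  have f1 : ∫ a, 1 / 8 * (1 + incr H 0 1 a * incr H' 0 1 a) ∂turns = 1 / 8 * (1 + τ i) := by
    rw [integral_const_mul, integral_add (integrable_const _) ((hD 0 1).mul (hD' 0 1)).integrable,
      hc.integral_incr (by decide)]
    simp
  have f2 : ∫ a, 1 / 8 * s * (incr H 0 1 a + incr H' 0 1 a) ∂turns = 0 := by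
    rw [integral_const_mul, integral_add (hD 0 1).integrable (hD' 0 1).integrable,
      hc.left.integral_incr, hc.right.integral_incr]
    simp
  have f3 : ∫ b, ((1 + incr K 1 2 b * incr K' 1 2 b) +
      t * (incr K 1 2 b + incr K' 1 2 b)) ∂turns = 1 + σ j := by
    rw [integral_add b0.integrable bE.integrable, integral_add (integrable_const _)
      ((hE 1 2).mul (hE' 1 2)).integrable, integral_const_mul,
      integral_add (hE 1 2).integrable (hE' 1 2).integrable, hd.left.integral_incr,
      hd.right.integral_incr, hd.integral_incr (by decide)]
    simp
  rw [f1, f2, f3, zero_mul, add_zero] at e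
  rw [← e]
  refine integral_congr_ae ?_
  filter_upwards [ae_params_fst (hc.left.ae_sq (show (0 : Fin 3) ≠ 1 by decide)),
    ae_params_fst (hc.right.ae_sq (show (0 : Fin 3) ≠ 1 by decide)),
    ae_params_snd (hd.left.ae_sq (show (1 : Fin 3) ≠ 2 by decide)),
    ae_params_snd (hd.right.ae_sq (show (1 : Fin 3) ≠ 2 by decide))] with ω p p' q q'
  generalize incr H 0 1 ω.1 = x at *
  generalize incr H' 0 1 ω.1 = x' at *
  generalize incr K 1 2 ω.2 = y at *
  generalize incr K' 1 2 ω.2 = y' at *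
  rcases eq_one_or_neg_one p with rfl | rfl <;>
  rcases eq_one_or_neg_one p' with rfl | rfl <;>
  rcases eq_one_or_neg_one q with rfl | rfl <;>
  rcases eq_one_or_neg_one q' with rfl | rfl <;>
  rcases eq_one_or_neg_one hs with rfl | rfl <;>
  rcases eq_one_or_neg_one ht with rfl | rfl <;> norm_num

end Classes

/-! ### Summation over the patterns of lines -/

section Sum

variable {X Y : Fin 2 → Frame} {m : ℝ} {τ σ : Fin 2 → ℝ}

lemma signExpectation_swap_fst (X Y : Fin 2 → Frame) (a b c a' b' c' : Fin 2) :
    signExpectation X Y ![a, b, c] ![a', b', c'] = signExpectation X Y ![b, a, c] ![b', a', c'] := by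
  rw [← signExpectation_comp_perm X Y ![a, b, c] ![a', b', c'] (Equiv.swap 0 1)]
  congr 1 <;> ext k <;> fin_cases k <;> simp [Equiv.swap_apply_of_ne_of_ne]

lemma signExpectation_swap_snd (X Y : Fin 2 → Frame) (a b c a' b' c' : Fin 2) :
    signExpectation X Y ![a, b, c] ![a', b', c'] = signExpectation X Y ![a, c, b] ![a', c', b'] := by
  rw [← signExpectation_comp_perm X Y ![a, b, c] ![a', b', c'] (Equiv.swap 1 2)]
  congr 1 <;> ext k <;> fin_cases k <;> simp [Equiv.swap_apply_of_ne_of_ne]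

/-- The sum over the pairs with a constant first component. -/
lemma sum_signExpectation_same (h : LimitData X Y m τ σ) (i : Fin 2) :
    ∑ J, signExpectation X Y ![i, i, i] J = 4 / 3 + 3 / 2 * (5 / 3 + τ i ^ 2) := by
  have h01 := signExpectation_same_split h i (show (0 : Fin 2) ≠ 1 by decide)
  have h10 := signExpectation_same_split h i (show (1 : Fin 2) ≠ 0 by decide)
  have e := signExpectation_same_same h i
  simp only [sum_triples, Fin.sum_univ_two, e]
  rw [signExpectation_swap_snd X Y i i i 0 1 0, signExpectation_swap_fst X Y i i i 1 0 0,
    signExpectation_swap_snd X Y i i i 0 1 0, signExpectation_swap_fst X Y i i i 0 1 1,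
    signExpectation_swap_snd X Y i i i 1 0 1, h01, h10]
  ring

/-- The sum over the pairs whose first component has its exceptional value at the last place. -/
lemma sum_signExpectation_split (h : LimitData X Y m τ σ) {i i' : Fin 2} (hi : i ≠ i') :
    ∑ J, signExpectation X Y ![i, i, i'] J =
      1 / 4 * (5 / 3 + σ 0 ^ 2) + 1 / 4 * (5 / 3 + σ 1 ^ 2) + 2 +
        1 / 4 * (1 + τ i) * (1 + σ 0) + 1 / 4 * (1 + τ i) * (1 + σ 1) := by
  have s0 := signExpectation_same_split h.symm 0 hi
  have s1 := signExpectation_same_split h.symm 1 hi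
  rw [signExpectation_swap] at s0 s1
  have c0 := signExpectation_split_split h hi (show (0 : Fin 2) ≠ 1 by decide)
  have c1 := signExpectation_split_split h hi (show (1 : Fin 2) ≠ 0 by decide)
  have p0 := signExpectation_path h hi (show (0 : Fin 2) ≠ 1 by decide)
  have p1 := signExpectation_path h hi (show (1 : Fin 2) ≠ 0 by decide)
  have q0 := p0
  have q1 := p1
  rw [signExpectation_swap_fst] at q0 q1
  simp only [sum_triples, Fin.sum_univ_two, s0, s1, c0, c1, p0, p1, q0, q1]
  ring

/-- Of the 64 patterns, 4 are constant on both sides and 24 on exactly one; among the rest, 12 have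
their exceptional edge in the same place and 24 in different places. Permuting edges moves the
exceptional place of the first component to the end. -/
lemma sum_signExpectation (h : LimitData X Y m τ σ) :
    ∑ I, ∑ J, signExpectation X Y I J =
      8 / 3 + 3 / 2 * (20 / 3 + τ 0 ^ 2 + τ 1 ^ 2 + σ 0 ^ 2 + σ 1 ^ 2) + 12 +
        3 / 4 * ((2 + τ 0 + τ 1) * (2 + σ 0 + σ 1)) := by
  have r12 : ∀ a b c : Fin 2, ∑ J, signExpectation X Y ![a, b, c] J =
      ∑ J, signExpectation X Y ![a, c, b] J := fun a b c => by
    simp only [sum_triples]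
    refine Finset.sum_congr rfl fun x _ => ?_
    rw [Finset.sum_comm]
    exact Finset.sum_congr rfl fun y _ => Finset.sum_congr rfl fun z _ =>
      signExpectation_swap_snd X Y a b c x z y
  have r01 : ∀ a b c : Fin 2, ∑ J, signExpectation X Y ![a, b, c] J =
      ∑ J, signExpectation X Y ![b, a, c] J := fun a b c => by
    simp only [sum_triples]
    rw [Finset.sum_comm]
    exact Finset.sum_congr rfl fun y _ => Finset.sum_congr rfl fun x _ =>
      Finset.sum_congr rfl fun z _ => signExpectation_swap_fst X Y a b c x y z
  have s01 := sum_signExpectation_split h (show (0 : Fin 2) ≠ 1 by decide)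
  have s10 := sum_signExpectation_split h (show (1 : Fin 2) ≠ 0 by decide)
  rw [sum_triples]
  simp only [Fin.sum_univ_two, sum_signExpectation_same h]
  rw [r01 0 1 1, r12 1 0 1, r12 0 1 0, r01 1 0 0, r12 0 1 0, s01, s10]
  ring

end Sum

/-! ### The geometry of the drawing -/

lemma inner_eq_coords (x y : E3) : inner ℝ x y = x 0 * y 0 + x 1 * y 1 + x 2 * y 2 := by
  simp [PiLp.inner_apply, Fin.sum_univ_three, mul_comm]

lemma det3_sq (x y z : E3) : det3 x y z ^ 2 =
    inner ℝ x x * inner ℝ y y * inner ℝ z z + 2 * inner ℝ x y * inner ℝ y z * inner ℝ x z -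
      inner ℝ x x * inner ℝ y z ^ 2 - inner ℝ y y * inner ℝ x z ^ 2 -
      inner ℝ z z * inner ℝ x y ^ 2 := by
  simp only [inner_eq_coords, det3]; ring

namespace Frame

variable (F : Frame)

lemma det3_sq_eq_one : det3 F.c F.e F.f ^ 2 = 1 := by
  rw [det3_sq]
  simp [F.norm_c, F.norm_e, F.norm_f, F.inner_ce, F.inner_cf,
    F.inner_ef]

lemma det3_ce (w : E3) : det3 F.c F.e w = inner ℝ F.f w * det3 F.c F.e F.f := by
  conv_lhs => rw [F.expand w]
  simp [det3_add_right, det3_smul_right]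

lemma det3_cf (w : E3) : det3 F.c F.f w = -(inner ℝ F.e w * det3 F.c F.e F.f) := by
  conv_lhs => rw [F.expand w]
  simp [det3_add_right, det3_smul_right, det3_swap_right F.c F.e F.f]

/-- The tangent direction at the centre of the arc to a point. -/
def tangent (w : E3) : E3 := w - inner ℝ w F.c • F.c

/-- The two determinants are, up to a common sign, the tangent coordinates after a quarter turn.
Inner products do not notice the turn or the orientation. -/
lemma inner_tangent (w w' : E3) : inner ℝ (F.tangent w) (F.tangent w') =
    det3 F.c F.e w * det3 F.c F.e w' + det3 F.c F.f w * det3 F.c F.f w' := by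
  have h1 : inner ℝ (F.tangent w) (F.tangent w') =
      inner ℝ w w' - inner ℝ F.c w * inner ℝ F.c w' := by
    simp only [tangent, inner_sub_left, inner_sub_right, inner_smul_left, inner_smul_right,
      real_inner_self_eq_norm_sq, F.norm_c, real_inner_comm F.c]
    simp
  have h2 : inner ℝ w w' = inner ℝ F.c w * inner ℝ F.c w' + inner ℝ F.e w * inner ℝ F.e w' +
      inner ℝ F.f w * inner ℝ F.f w' := by
    conv_lhs => rw [F.expand w]
    simp [inner_add_left, inner_smul_left]
  rw [h1, h2, F.det3_ce w, F.det3_ce w', F.det3_cf w, F.det3_cf w']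
  linear_combination (-(inner ℝ F.f w * inner ℝ F.f w' + inner ℝ F.e w * inner ℝ F.e w')) *
    F.det3_sq_eq_one

lemma norm_tangent (w : E3) :
    ‖F.tangent w‖ = √(det3 F.c F.e w ^ 2 + det3 F.c F.f w ^ 2) := by
  rw [norm_eq_sqrt_real_inner, inner_tangent, sq, sq]

lemma norm_tangent_pos {u w : E3} (h : det3 F.c u w ≠ 0) : 0 < ‖F.tangent w‖ := by
  rw [norm_pos_iff]
  intro h0
  apply h
  rw [tangent, sub_eq_zero] at h0
  rw [h0, det3_smul_right, det3_self_outer, mul_zero]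

lemma sphericalAngle_eq (w w' : E3) :
    sphericalAngle w F.c w' = InnerProductGeometry.angle (F.tangent w) (F.tangent w') := rfl

end Frame

lemma sphericalAngle_comm (a b c : E3) : sphericalAngle a b c = sphericalAngle c b a :=
  InnerProductGeometry.angle_comm _ _

lemma isHeight_height {X Y : Fin 2 → Frame} {i j : Fin 2}
    (h : 0 < ‖(X i).tangent (Y j).c‖) : IsHeight (height X Y i j) := by
  refine ⟨by unfold height; fun_prop, fun s => ?_⟩
  rw [Frame.norm_tangent] at h
  rw [← turn_trig_eq_zero h (-height X Y i j s)]
  congr 1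
  ext x
  simp only [Set.mem_ofPred_eq]
  rw [neg_add_eq_zero, eq_comm]
  rfl

/-- By `inner_tangent`, the angle between the coefficient vectors of the two heights is the angle
between tangent directions, that is, the spherical angle. -/
lemma hasCorrelation_height {X Y : Fin 2 → Frame} {i j j' : Fin 2}
    (h : 0 < ‖(X i).tangent (Y j).c‖) (h' : 0 < ‖(X i).tangent (Y j').c‖) :
    HasCorrelation (height X Y i j) (height X Y i j')
      (1 - 2 * (sphericalAngle (Y j).c (X i).c (Y j').c / Real.pi)) := by
  refine ⟨isHeight_height h, isHeight_height h', fun s => ?_⟩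
  have hθ := InnerProductGeometry.cos_angle_mul_norm_mul_norm ((X i).tangent (Y j).c)
    ((X i).tangent (Y j').c)
  rw [Frame.inner_tangent, Frame.norm_tangent, Frame.norm_tangent, ← Frame.sphericalAngle_eq] at hθ
  rw [Frame.norm_tangent] at h h'
  refine Eq.trans (integral_congr_ae (Eventually.of_forall fun x => ?_))
    (integral_sgn_increments (θ := sphericalAngle (Y j).c (X i).c (Y j').c)
      (InnerProductGeometry.angle_nonneg _ _) (InnerProductGeometry.angle_le_pi _ _) h h'
      (hθ.symm.trans (mul_comm _ _)) s)
  simp only [height]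
  congr 2 <;> ring

lemma exists_pos_forall_le {ι : Type*} [Finite ι] [Nonempty ι] {f : ι → ℝ} (h : ∀ i, 0 < f i) :
    ∃ m, 0 < m ∧ ∀ i, m ≤ f i := by
  obtain ⟨i, hi⟩ := Finite.exists_min f
  exact ⟨f i, h i, hi⟩

lemma Nondegenerate.mono {X Y : Fin 2 → Frame} {m m' : ℝ} (h : Nondegenerate X Y m) (h0 : 0 < m')
    (hm : m' ≤ m) : Nondegenerate X Y m' :=
  ⟨h0, fun i i' j hi => hm.trans (h.le_det3 i i' j hi), fun i j => hm.trans (h.le_tangent i j)⟩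

lemma exists_nondegenerate {X Y : Fin 2 → Frame}
    (h : ∀ i i' j, i ≠ i' → det3 (X i).c (X i').c (Y j).c ≠ 0) : ∃ m, Nondegenerate X Y m := by
  obtain ⟨m₁, h₁, hm₁⟩ := exists_pos_forall_le (ι := Fin 2 × Fin 2 × Fin 2)
    -- The value `1` on equal indices, where the determinant vanishes, only keeps the minimum
    -- positive.
    (f := fun p => if p.1 = p.2.1 then 1 else |det3 (X p.1).c (X p.2.1).c (Y p.2.2).c|)
    (fun p => by
      split_ifs with hp
      · exact one_pos
      · exact abs_pos.2 (h _ _ _ hp))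
  obtain ⟨m₂, h₂, hm₂⟩ := exists_pos_forall_le (ι := Fin 2 × Fin 2)
    (f := fun p => ‖(X p.1).tangent (Y p.2).c‖) (fun p => by
      obtain ⟨i', hi⟩ := exists_ne p.1
      exact (X p.1).norm_tangent_pos (h p.1 i' p.2 hi.symm))
  refine ⟨min m₁ m₂, lt_min h₁ h₂, fun i i' j hi => (min_le_left _ _).trans ?_,
    fun i j => (min_le_right _ _).trans ?_⟩
  · simpa [hi] using hm₁ (i, i', j)
  · rw [← Frame.norm_tangent]
    exact hm₂ (i, j)

lemma centreSign_eq {X Y : Fin 2 → Frame} (h : centreSign X Y 0 1 0 = centreSign X Y 0 1 1)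
    (i i' j j' : Fin 2) : centreSign X Y i i' j = centreSign X Y i i' j' := by
  have h0 : ∀ i j, centreSign X Y i i j = 0 := fun i j => by simp [centreSign]
  have h1 : ∀ j, centreSign X Y 1 0 j = -centreSign X Y 0 1 j := fun j => by
    rw [centreSign, det3_swap, sgn_neg, centreSign]
  fin_cases i <;> fin_cases i' <;> fin_cases j <;> fin_cases j' <;> simp [h0, h1, h]

/-- General position supplies a uniform lower bound `m`. The crossing of `v 0 w 1` and `v 1 w 0`
supplies two sign equalities: `w 0`, `w 1` lie on the same side of the plane of `v 0`, `v 1`, and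
vice versa. -/
lemma exists_limitData {v w : Fin 2 → E3} {X Y : Fin 2 → Frame} (hX : ∀ i, (X i).c = v i)
    (hY : ∀ i, (Y i).c = w i) (hD : IsAntipodalDrawing v w)
    (hcross : (openArc (v 0) (w 1) ∩ openArc (v 1) (w 0)).Nonempty) :
    ∃ m, LimitData X Y m (fun i => 1 - 2 * (sphericalAngle (w 0) (v i) (w 1) / Real.pi))
      (fun j => 1 - 2 * (sphericalAngle (v 0) (w j) (v 1) / Real.pi)) := by
  have hx : ∀ i i' j, i ≠ i' → det3 (X i).c (X i').c (Y j).c ≠ 0 := fun i i' j hi => by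
    rw [hX, hX, hY]
    exact det3_ne_zero (hD.generalPosition (.inl i) (.inl i') (.inr j) (by simpa) (by simp)
      (by simp))
  have hy : ∀ i i' j, i ≠ i' → det3 (Y i).c (Y i').c (X j).c ≠ 0 := fun i i' j hi => by
    rw [hY, hY, hX]
    exact det3_ne_zero (hD.generalPosition (.inr i) (.inr i') (.inl j) (by simpa) (by simp)
      (by simp))
  obtain ⟨m₁, hm₁⟩ := exists_nondegenerate hx
  obtain ⟨m₂, hm₂⟩ := exists_nondegenerate hy
  have hm := lt_min hm₁.pos hm₂.pos
  have h1 := hm₁.mono hm (min_le_left _ _)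
  have h2 := hm₂.mono hm (min_le_right _ _)
  have px : ∀ i j, 0 < ‖(X i).tangent (Y j).c‖ := fun i j => by
    obtain ⟨i', hi⟩ := exists_ne i
    exact (X i).norm_tangent_pos (hx i i' j hi.symm)
  have py : ∀ i j, 0 < ‖(Y i).tangent (X j).c‖ := fun i j => by
    obtain ⟨i', hi⟩ := exists_ne i
    exact (Y i).norm_tangent_pos (hy i i' j hi.symm)
  have hcs : CrossSign (v 0) (w 1) (v 1) (w 0) := crossSign_of_nonempty (by
    have := hx 0 1 1 (by decide)
    rwa [hX, hX, hY] at this) hcross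
  obtain ⟨-, e1, e2, e3⟩ := hcs
  refine ⟨_, h1, h2, fun i j j' hj => ?_, fun j i i' hi => ?_, centreSign_eq ?_, centreSign_eq ?_⟩
  · have := hasCorrelation_height (px i j) (px i j')
    rw [hX, hY, hY] at this
    convert this using 4
    fin_cases j <;> fin_cases j' <;> first | exact absurd rfl hj | rfl | exact sphericalAngle_comm ..
  · have := hasCorrelation_height (py j i) (py j i')
    rw [hY, hX, hX] at this
    convert this using 4
    fin_cases i <;> fin_cases i' <;> first | exact absurd rfl hi | rfl | exact sphericalAngle_comm ..
  · rw [centreSign, centreSign, ← sign_eq_sign_iff_sgn, hX, hX, hY, hY]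
    exact e1.symm
  · rw [centreSign, centreSign, ← sign_eq_sign_iff_sgn, hX, hX, hY, hY, det3_swap (w 1),
      det3_swap (w 1), Left.sign_neg, Left.sign_neg, e2.symm.trans e3]

end
end SphericalDrawing

/-! ### The theorem -/

open Filter Topology SphericalDrawing
theorem theorem4 (v₁ v₂ w₁ w₂ : E3)
    (hD : IsAntipodalDrawing ![v₁, v₂] ![w₁, w₂])
    -- the labelling of the vertices: the edges `v₁ w₂` and `v₂ w₁` cross
    (hcross : (openArc v₁ w₂ ∩ openArc v₂ w₁).Nonempty)
    (α β γ δ : ℝ)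
    (hα : α = sphericalAngle v₂ w₂ v₁) (hβ : β = sphericalAngle w₂ v₂ w₁)
    (hγ : γ = sphericalAngle w₁ v₁ w₂) (hδ : δ = sphericalAngle v₁ w₁ v₂) :
    ∃ C r₀ : ℝ, 0 < r₀ ∧ ∀ ρ : ℝ, 0 ≤ ρ → ρ < r₀ →
      ∃ t : ℝ,
        |t - (3 / (2 ^ 12 * Real.pi ^ 2) *
              ((2 * Real.pi - α - δ) * (2 * Real.pi - γ - β)
                + 2 * (α ^ 2 + β ^ 2 + γ ^ 2 + δ ^ 2)
                - 2 * Real.pi * (α + β + γ + δ))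
            + 23 / (3 * 2 ^ 10))| ≤ C * ρ ∧
        ∀ (r : ℕ → ℝ) (P Q : (n : ℕ) → Fin 2 × Bool → Fin n → E3),
          (∀ n, 1 ≤ n → 0 < r n) → Tendsto r atTop (𝓝 ρ) →
          (∀ n, 1 ≤ n → IsBlowup ![v₁, v₂] ![w₁, w₂] (r n) n (P n) (Q n)) →
          Tendsto (fun n => triangleDensity (P n) (Q n)) atTop (𝓝 t) := by
  choose X hX using fun i => exists_frame (hD.norm_left i)
  choose Y hY using fun i => exists_frame (hD.norm_right i)
  obtain ⟨m, hm⟩ := exists_limitData hX hY hD hcross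
  have hpos := hm.left.pos
  -- Below `m / 1000` the perturbation estimates apply; below `π` the factor `sin r` is eventually
  -- positive.
  refine ⟨54 * (400 / m), min (m / 1000) Real.pi, lt_min (by positivity) Real.pi_pos,
    fun ρ h0 hρ => ⟨limitDensity X Y ρ, ?_, fun r P Q hr hlim hB => ?_⟩⟩
  · have h1 : 1000 * ρ < m := by linarith [hρ.trans_le (min_le_left _ _)]
    refine le_of_eq_of_le ?_ (abs_limitDensity_sub_le hm.left hm.right h0 h1)
    congr 2
    -- Substituting `1 - 2θ/π` for each correlation, the constants add up to `8/3 + 10 + 12 + 6 =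
    -- 92/3`, which divided by `2 ^ 12` is the constant of `F`.
    rw [limitDensity_zero, sum_signExpectation hm]
    simp only [Matrix.cons_val_zero, Matrix.cons_val_one]
    rw [sphericalAngle_comm w₁ v₂ w₂, sphericalAngle_comm v₁ w₂ v₂, ← hα, ← hβ, ← hγ, ← hδ]
    have := Real.pi_pos
    field_simp
    ring
  · have h1 : 1000 * ρ < m := by linarith [hρ.trans_le (min_le_left _ _)]
    exact tendsto_triangleDensity hm.left hm.right h0 h1 (hρ.trans_le (min_le_right _ _)) hX hY
      hr hlim hB
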